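/- **Conventions.** Groups are finite and $\operatorname{Irr}$ denotes complex irreducible characters. Write $a^g=g^{-1}ag$ and $f^g(x)=f(gxg^{-1})$, and $(\cdot,\cdot)_G$ for the usual inner product of class functions. For $N\le V$ and $\theta\in\operatorname{Irr}N$, $\operatorname{Irr}(V\mid\theta)$ is the set of $\chi\in\operatorname{Irr}V$ with $(\chi_N,\theta)_N\ne0$, and $\mathbb C[\operatorname{Irr}(V\mid\theta)]$ is its complex span. For a class function $\gamma$ on $V$ put $\gamma_\theta=\sum_{\chi\in\operatorname{Irr}(V\mid\theta)}(\gamma,\chi)_V\,\chi$. Put $e_\chi=\frac{\chi(1)}{|G|}\sum_{g\in G}\chi(g^{-1})g$ for $\chi\in\operatorname{Irr}G$. For a subfield $\mathbb F$ of $\mathbb C$, $[\chi]_{\mathbb F}$ denotes the class of $\mathbb F(\chi)Ge_\chi$ in the Brauer group of $\mathbb F(\chi)$. **Hypothesis.** Let $\mathbb F$ be a subfield of $\mathbb C$, $G$ a finite group, $K\trianglelefteq G$, $H\le G$ with $G=HK$, and $L=H\cap K$. Let $\theta\in\operatorname{Irr}K$ and $\phi\in\operatorname{Irr}L$ be $H$-invariant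 characters with values in $\mathbb F$ such that $(\theta_L,\phi)_L>0$. Put $i=e_\phi e_\theta$, which is an idempotent of $\mathbb FK$, and let $S=(i\mathbb FKi)^L$ be the centralizer of $L$ in $i\mathbb FKi$. This is a central simple $\mathbb F$-algebra with unit element $i$; let $\operatorname{tr}$ be its reduced trace. Let $\sigma\colon H/L\to S^*$ be a magic representation, that is, a group homomorphism with $h^{-1}sh=\sigma(Lh)^{-1}s\,\sigma(Lh)$ for all $s\in S$, $h\in H$. Let $\psi(Lh)=\operatorname{tr}(\sigma(Lh))$ be its (magic) character, and let $s_0\in S$ with $\operatorname{tr}(s_0)=1$ (such elements exist). **Theorem.** For every $U$ with $K\le U\le G$, the formula $$\chi^\iota(h)=\chi\bigl(s_0\,\sigma(Lh)^{-1}h\bigr)\qquad(h\in U\cap H),$$ where $\chi$ is extended linearly to the group algebra of $U$, defines a linear isomorphism $\iota\colon\mathbb C[\operatorname{Irr}(U\mid\theta)]\to\mathbb C[\operatorname{Irr}(U\cap H\mid\phi)]$, which does not depend on the choice of $s_0$. These isomorphisms have the following properties, where $U,U_1,U_2$ are subgroups of $G$ containing $K$ and $\chi,\chi_1,\chi_2\in\mathbb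 C[\operatorname{Irr}(U\mid\theta)]$ unless stated otherwise: 1. $\chi\in\operatorname{Irr}(U\mid\theta)$ if and only if $\chi^\iota\in\operatorname{Irr}(U\cap H\mid\phi)$. 2. $(\chi_1^\iota,\chi_2^\iota)_{U\cap H}=(\chi_1,\chi_2)_U$. 3. $\chi(1)/\theta(1)=\chi^\iota(1)/\phi(1)$. 4. $(\chi_{U_1})^\iota=(\chi^\iota)_{U_1\cap H}$ for $U_1\le U_2$ and $\chi\in\mathbb C[\operatorname{Irr}(U_2\mid\theta)]$. 5. $(\tau^{U_2})^\iota=(\tau^\iota)^{U_2\cap H}$ for $U_1\le U_2$ and $\tau\in\mathbb C[\operatorname{Irr}(U_1\mid\theta)]$. 6. $(\chi^\iota)^h=(\chi^h)^\iota$ for $h\in H$. 7. $(\beta\chi)^\iota=\beta\chi^\iota$ for $\beta\in\mathbb C[\operatorname{Irr}(U/K)]$. 8. $(\chi^\alpha)^\iota=(\chi^\iota)^\alpha$ for every field automorphism $\alpha$ of $\mathbb C$ fixing $\mathbb F$ elementwise, and $\mathbb F(\chi)=\mathbb F(\chi^\iota)$. 9. $[\chi]_{\mathbb F}=[S\otimes_{\mathbb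 F}\mathbb F(\chi)]\,[\chi^\iota]_{\mathbb F}$ in the Brauer group of $\mathbb F(\chi)$, for $\chi\in\operatorname{Irr}(U\mid\theta)$. 10. $(\chi_{U\cap H})_\phi=\psi\chi^\iota$. 11. $(\xi^U)_\theta=\overline\psi\,\xi^{\iota^{-1}}$ for $\xi\in\mathbb C[\operatorname{Irr}(U\cap H\mid\phi)]$, where $\psi$ is viewed as a function on $G/K$ through the canonical isomorphism $G/K\cong H/L$. -/

import Mathlib

open scoped TensorProduct ComplexConjugate

noncomputable section

namespace MagicRep

/-! ### Complex characters of finite groups -/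

section Characters

/-- `χ` is the character of an irreducible complex representation of `G`. -/
def IsIrrChar {G : Type*} [Group G] (χ : G → ℂ) : Prop :=
  ∃ (n : ℕ) (ρ : Representation ℂ G (Fin n → ℂ)), ρ.IsIrreducible ∧ χ = ρ.character

/-- `ℂ[Irr G]`, the space of complex linear combinations of irreducible characters. -/
def irrSpan (G : Type*) [Group G] : Submodule ℂ (G → ℂ) :=
  Submodule.span ℂ {χ | IsIrrChar χ}

/-- The inner product `(α, β)_G = |G|⁻¹ ∑ α(g) conj β(g)`. -/
def classInner {G : Type*} [Group G] [Finite G] (α β : G → ℂ) : ℂ :=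
  (Nat.card G : ℂ)⁻¹ * ∑ᶠ g : G, α g * conj (β g)

variable {G : Type*} [Group G]

/-- Restriction of functions from `W` to a smaller subgroup `V`. -/
def resFun {V W : Subgroup G} (h : V ≤ W) (f : W → ℂ) : V → ℂ :=
  fun v => f (Subgroup.inclusion h v)

open scoped Classical in
/-- Induction of class functions from the subgroup `V` to the subgroup `W ≥ V`. -/
def indFun (V W : Subgroup G) (f : V → ℂ) : W → ℂ :=
  fun w => (Nat.card V : ℂ)⁻¹ *
    ∑ᶠ x : W, if h : (x : G) * w * (x : G)⁻¹ ∈ V then f ⟨_, h⟩ else 0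

/-- The conjugate subgroup `V^g = g⁻¹ V g`. -/
def conjSub (V : Subgroup G) (g : G) : Subgroup G :=
  V.comap (MulAut.conj g).toMonoidHom

/-- The conjugate `f^g` of a function on `V`; it lives on `V^g` and `f^g (x^g) = f x`. -/
def conjFun {V : Subgroup G} (f : V → ℂ) (g : G) : conjSub V g → ℂ :=
  fun x => f ⟨g * x * g⁻¹, x.2⟩

theorem le_conjSub {K U : Subgroup G} [hK : K.Normal] (h : K ≤ U) (g : G) : K ≤ conjSub U g :=
  fun x hx => h (hK.conj_mem x hx g)

theorem mem_conjSub_inf {U H : Subgroup G} {h x : G} (hh : h ∈ H) (hx : x ∈ conjSub U h ⊓ H) :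
    x ∈ conjSub (U ⊓ H) h :=
  ⟨hx.1, H.mul_mem (H.mul_mem hh hx.2) (H.inv_mem hh)⟩

theorem inf_le_inf_right_of_le {H K U : Subgroup G} (h : K ≤ U) : H ⊓ K ≤ U ⊓ H :=
  fun _ hx => ⟨h hx.2, hx.1⟩

theorem inf_mono_left {H U₁ U₂ : Subgroup G} (h : U₁ ≤ U₂) : U₁ ⊓ H ≤ U₂ ⊓ H :=
  fun _ hx => ⟨h hx.1, hx.2⟩

variable [Finite G]

/-- `Irr(V ∣ θ)`: the irreducible characters of `V` whose restriction to `N` contains `θ`. -/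
def irrAbove {N V : Subgroup G} (hN : N ≤ V) (θ : N → ℂ) : Set (V → ℂ) :=
  {χ | IsIrrChar χ ∧ classInner (resFun hN χ) θ ≠ 0}

/-- `ℂ[Irr(V ∣ θ)]`. -/
def irrAboveSpan {N V : Subgroup G} (hN : N ≤ V) (θ : N → ℂ) : Submodule ℂ (V → ℂ) :=
  Submodule.span ℂ (irrAbove hN θ)

/-- `γ_θ`, the part of the class function `γ` that lies above `θ`. -/
def partAbove {N V : Subgroup G} (hN : N ≤ V) (θ : N → ℂ) (γ : V → ℂ) : V → ℂ :=
  ∑ᶠ χ ∈ irrAbove hN θ, classInner γ χ • χ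

end Characters

/-! ### The central idempotent of a character -/

section Idempotent

/-- The idempotent `e_χ = (χ(1)/|G|) ∑ χ(g⁻¹) g`, as an element of the group algebra `E G`, where
the coefficients, which are complex numbers, are supposed to lie in the subfield `E`. -/
def charIdem (E : Type*) [Field E] [Algebra E ℂ] {G : Type*} [Group G] [Finite G] (χ : G → ℂ) :
    MonoidAlgebra E G :=
  MonoidAlgebra.ofCoeff (Finsupp.equivFunOnFinite.symm fun g =>
    Function.invFun (algebraMap E ℂ) (χ 1 / (Nat.card G : ℂ) * χ g⁻¹))

variable {G : Type*} [Group G]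

theorem IsIrrChar.conj_eq {χ : G → ℂ} (hχ : IsIrrChar χ) (g h : G) : χ (h * g * h⁻¹) = χ g := by
  obtain ⟨n, ρ, -, rfl⟩ := hχ
  exact ρ.char_conj g h

/-- `∑ χ(g⁻¹) χ(h g) = (|G| / χ(1)) χ(h)` for irreducible characters. -/
theorem IsIrrChar.convolution [Finite G] {χ : G → ℂ} (hχ : IsIrrChar χ) [Fintype G] (h : G) :
    χ 1 * ∑ g : G, χ g⁻¹ * χ (h * g) = (Nat.card G : ℂ) * χ h := by
  obtain ⟨n, ρ, hρ, rfl⟩ := hχ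
  let f : ρ.IntertwiningMap ρ :=
    { toLinearMap := ∑ g : G, ρ.character g⁻¹ • ρ g
      isIntertwining' := by
        intro x
        change (∑ g : G, ρ.character g⁻¹ • ρ g) * ρ x = ρ x * (∑ g : G, ρ.character g⁻¹ • ρ g)
        rw [Finset.sum_mul, Finset.mul_sum]
        refine Fintype.sum_equiv (MulAut.conj x⁻¹).toEquiv _ _ fun g => ?_
        simp only [MulEquiv.toEquiv_eq_coe, EquivLike.coe_coe, MulAut.conj_apply, inv_inv,
          mul_inv_rev, smul_mul_assoc, mul_smul_comm, ← map_mul]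
        have h1 := ρ.char_conj g⁻¹ x⁻¹
        rw [inv_inv] at h1
        rw [← h1]
        simp only [mul_assoc, mul_inv_cancel_left] }
  obtain ⟨c, hc⟩ :=
    (Representation.IsIrreducible.algebraMap_intertwiningMap_bijective_of_isAlgClosed
      (ρ := ρ)).2 f
  have hf : ∑ g : G, ρ.character g⁻¹ • ρ g = c • (1 : Module.End ℂ (Fin n → ℂ)) := by
    have h2 := congrArg Representation.IntertwiningMap.toLinearMap hc
    exact h2.symm
  have key : ∀ x : G, ∑ g : G, ρ.character g⁻¹ * ρ.character (x * g) = c * ρ.character x := by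
    intro x
    have h3 := congrArg (fun T => LinearMap.trace ℂ (Fin n → ℂ) (ρ x * T)) hf
    simpa [Finset.mul_sum, Representation.character, map_mul] using h3
  have hcard : (Nat.card G : ℂ) ≠ 0 := by
    exact_mod_cast Nat.card_pos.ne'
  have : Invertible (Nat.card G : ℂ) := invertibleOfNonzero hcard
  have horth := Representation.card_inv_mul_sum_char_mul_char_eq_finrank ρ ρ
  rw [Representation.IsIrreducible.finrank_intertwiningMap_self, Nat.cast_one,
    inv_mul_eq_one₀ hcard] at horth
  have h1 := key 1
  simp only [one_mul] at h1
  rw [key h, ← mul_assoc, mul_comm (ρ.character 1) c, ← h1, horth]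
  congr 1
  exact Finset.sum_congr rfl fun g _ => mul_comm _ _

variable {E : Type*} [Field E] [Algebra E ℂ] [Finite G]

theorem algebraMap_coeff_charIdem {χ : G → ℂ} (hE : ∀ g, χ g ∈ Set.range (algebraMap E ℂ))
    (g : G) : algebraMap E ℂ ((charIdem E χ).coeff g) = χ 1 / (Nat.card G : ℂ) * χ g⁻¹ := by
  refine Function.invFun_eq (f := algebraMap E ℂ) ?_
  have h : χ 1 / (Nat.card G : ℂ) * χ g⁻¹ ∈ (algebraMap E ℂ).fieldRange :=
    mul_mem (div_mem (hE 1) (natCast_mem _ _)) (hE g⁻¹)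
  exact h

theorem charIdem_idem {χ : G → ℂ} (hχ : IsIrrChar χ)
    (hE : ∀ g, χ g ∈ Set.range (algebraMap E ℂ)) :
    charIdem E χ * charIdem E χ = charIdem E χ := by
  have := Fintype.ofFinite G
  have hcard : (Nat.card G : ℂ) ≠ 0 := by
    exact_mod_cast Nat.card_pos.ne'
  refine MonoidAlgebra.coeff_injective (Finsupp.ext fun x => (algebraMap E ℂ).injective ?_)
  rw [MonoidAlgebra.coeff_mul_apply_left, Finsupp.sum_fintype _ _ (fun _ => zero_mul _), map_sum]
  simp only [map_mul, algebraMap_coeff_charIdem hE, mul_inv_rev, inv_inv]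
  have h1 := hχ.convolution x⁻¹
  have h2 : ∀ g : G, χ 1 / (Nat.card G : ℂ) * χ g⁻¹ * (χ 1 / (Nat.card G : ℂ) * χ (x⁻¹ * g)) =
      (χ 1 / (Nat.card G : ℂ)) * (Nat.card G : ℂ)⁻¹ * (χ 1 * (χ g⁻¹ * χ (x⁻¹ * g))) := by
    intro g
    ring
  rw [Finset.sum_congr rfl fun g _ => h2 g, ← Finset.mul_sum, ← Finset.mul_sum, h1]
  field_simp

theorem charIdem_conj {χ : G → ℂ} (hχ : ∀ g : G, ∀ h : G, χ (h * g * h⁻¹) = χ g) (h : G) :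
    MonoidAlgebra.of E G h * charIdem E χ = charIdem E χ * MonoidAlgebra.of E G h := by
  refine MonoidAlgebra.coeff_injective (Finsupp.ext fun x => ?_)
  rw [MonoidAlgebra.of_apply, MonoidAlgebra.coeff_single_mul_apply,
    MonoidAlgebra.coeff_mul_single_apply, one_mul, mul_one]
  change Function.invFun _ _ = Function.invFun _ _
  have h1 := hχ (h⁻¹ * x)⁻¹ h
  rw [← h1]
  congr 3
  group

theorem charIdem_central {χ : G → ℂ} (hχ : ∀ g : G, ∀ h : G, χ (h * g * h⁻¹) = χ g)
    (a : MonoidAlgebra E G) : a * charIdem E χ = charIdem E χ * a := by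
  induction a using MonoidAlgebra.induction_on with
  | of g => exact charIdem_conj hχ g
  | add a b ha hb => rw [add_mul, mul_add, ha, hb]
  | smul r a ha => rw [smul_mul_assoc, mul_smul_comm, ha]

end Idempotent

/-! ### Algebras with a unit other than the one of the ambient algebra -/

section Unital

variable {R A : Type*} [CommRing R] [Ring A] [Algebra R A]

/-- A multiplicatively closed submodule `B` of `A` that has the unit `e` of its own, as a type. -/
def SubAlg (B : NonUnitalSubalgebra R A) (e : A) (_ : e ∈ B ∧ ∀ x ∈ B, e * x = x ∧ x * e = x) :
    Type _ := ↥B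

variable {B : NonUnitalSubalgebra R A} {e : A} {h : e ∈ B ∧ ∀ x ∈ B, e * x = x ∧ x * e = x}

/-- The inclusion into the ambient algebra. -/
def SubAlg.val (x : SubAlg B e h) : A := Subtype.val (p := fun a => a ∈ B) x

instance SubAlg.instNonUnitalRing : NonUnitalRing (SubAlg B e h) :=
  inferInstanceAs (NonUnitalRing ↥B)

instance SubAlg.instRing : Ring (SubAlg B e h) :=
  { SubAlg.instNonUnitalRing (B := B) (e := e) (h := h) with
    one := ⟨e, h.1⟩
    one_mul := fun x => Subtype.ext (h.2 _ x.2).1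
    mul_one := fun x => Subtype.ext (h.2 _ x.2).2 }

instance SubAlg.instModule : Module R (SubAlg B e h) :=
  inferInstanceAs (Module R ↥B)

instance SubAlg.instAlgebra : Algebra R (SubAlg B e h) :=
  Algebra.ofModule
    (fun r x y => Subtype.ext (smul_mul_assoc r (SubAlg.val x) (SubAlg.val y)))
    (fun r x y => Subtype.ext (mul_smul_comm r (SubAlg.val x) (SubAlg.val y)))

end Unital

/-! ### Reduced traces and Brauer classes -/

section BrauerTrace

/-- `t` is the reduced trace of the `F`-algebra `S`: there is an isomorphism of `S ⊗ F̄` with a full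
matrix algebra over the algebraic closure `F̄` of `F` that turns `t` into the matrix trace. -/
def IsReducedTrace (F S : Type*) [Field F] [Ring S] [Algebra F S] (t : S → F) : Prop :=
  ∃ (n : ℕ) (ε : AlgebraicClosure F ⊗[F] S ≃ₐ[AlgebraicClosure F]
      Matrix (Fin n) (Fin n) (AlgebraicClosure F)),
    ∀ s, algebraMap F (AlgebraicClosure F) (t s) = (ε (1 ⊗ₜ[F] s)).trace

open scoped Classical in
/-- The reduced trace of a central simple algebra. -/
def reducedTrace (F : Type*) {S : Type*} [Field F] [Ring S] [Algebra F S] : S → F :=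
  if h : ∃ t : S → F, IsReducedTrace F S t then h.choose else 0

/-- `A` and `B` are (finite-dimensional) central simple `E`-algebras with the same class in the
Brauer group of `E`. -/
def SameBrauerClass.{u, v} (E : Type u) [Field E] (A B : Type v) [Ring A] [Algebra E A] [Ring B]
    [Algebra E B] : Prop :=
  ∃ X Y : CSA.{u, v} E, Nonempty (X ≃ₐ[E] A) ∧ Nonempty (Y ≃ₐ[E] B) ∧ IsBrauerEquivalent X Y

variable {G : Type*} [Group G] [Finite G]

/-- The ideal `E G e_χ` of the group algebra `E G`. -/
def blockSub (E : Type*) [Field E] [Algebra E ℂ] (χ : G → ℂ) :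
    NonUnitalSubalgebra E (MonoidAlgebra E G) where
  carrier := {x | ∃ a, x = a * charIdem E χ}
  add_mem' := by
    rintro _ _ ⟨a, rfl⟩ ⟨b, rfl⟩
    exact ⟨a + b, (add_mul _ _ _).symm⟩
  zero_mem' := ⟨0, (zero_mul _).symm⟩
  mul_mem' := by
    rintro _ _ ⟨a, rfl⟩ ⟨b, rfl⟩
    exact ⟨a * charIdem E χ * b, by simp only [mul_assoc]⟩
  smul_mem' := by
    rintro r _ ⟨a, rfl⟩
    exact ⟨r • a, (smul_mul_assoc r a _).symm⟩

theorem blockSub_unit {E : Type*} [Field E] [Algebra E ℂ] {χ : G → ℂ} (hχ : IsIrrChar χ)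
    (hE : ∀ g, χ g ∈ Set.range (algebraMap E ℂ)) :
    charIdem E χ ∈ blockSub E χ ∧
      ∀ x ∈ blockSub E χ, charIdem E χ * x = x ∧ x * charIdem E χ = x := by
  refine ⟨⟨1, (one_mul _).symm⟩, ?_⟩
  rintro _ ⟨a, rfl⟩
  rw [← mul_assoc, ← charIdem_central hχ.conj_eq, mul_assoc, charIdem_idem hχ hE]
  exact ⟨rfl, rfl⟩

/-- The algebra `E G e_χ` of an irreducible character `χ` with values in `E`. -/
abbrev BlockAlg {E : Type*} [Field E] [Algebra E ℂ] {χ : G → ℂ} (hχ : IsIrrChar χ)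
    (hE : ∀ g, χ g ∈ Set.range (algebraMap E ℂ)) : Type _ :=
  SubAlg (blockSub E χ) (charIdem E χ) (blockSub_unit hχ hE)

/-- The field of values `F(χ)`. -/
def charField (F : Subfield ℂ) {X : Type*} (χ : X → ℂ) : IntermediateField F ℂ :=
  IntermediateField.adjoin F (Set.range χ)

theorem mem_charField (F : Subfield ℂ) {X : Type*} (χ : X → ℂ) (g : X) :
    χ g ∈ Set.range (algebraMap (charField F χ) ℂ) :=
  ⟨⟨χ g, IntermediateField.subset_adjoin F _ ⟨g, rfl⟩⟩, rfl⟩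

end BrauerTrace

/-! ### Magic representations -/

section Magic

variable {G : Type*} [Group G]

/-- The subalgebra `F K` of `F G`. -/
def subgroupAlg (F : Type*) [Field F] (K : Subgroup G) : Subalgebra F (MonoidAlgebra F G) :=
  (MonoidAlgebra.mapDomainAlgHom F F K.subtype).range

theorem of_mem_subgroupAlg (F : Subfield ℂ) {K : Subgroup G} (k : K) :
    MonoidAlgebra.of F G k ∈ subgroupAlg F K :=
  ⟨MonoidAlgebra.of F K k, MonoidAlgebra.mapDomain_single⟩

variable [Finite G]

/-- The idempotent `e_χ` of a character of a subgroup `V`, as an element of `F G`. -/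
def subIdem (F : Subfield ℂ) {V : Subgroup G} (χ : V → ℂ) : MonoidAlgebra F G :=
  MonoidAlgebra.mapDomainAlgHom F F V.subtype (charIdem F χ)

/-- The basic configuration: `G = HK` is a finite group with `K` normal, `L = H ∩ K`, and
`θ ∈ Irr K`, `φ ∈ Irr L` are `H`-invariant characters with values in `F` such that `φ` occurs in
the restriction of `θ` to `L`. -/
structure BasicConfig (F : Subfield ℂ) (H K : Subgroup G) [hK : K.Normal]
    (θ : K → ℂ) (φ : ↥(H ⊓ K) → ℂ) : Prop where
  exists_mul : ∀ g : G, ∃ h ∈ H, ∃ k ∈ K, g = h * k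
  irr_θ : IsIrrChar θ
  irr_φ : IsIrrChar φ
  occurs : classInner (resFun inf_le_right θ) φ ≠ 0
  inv_θ : ∀ h ∈ H, ∀ k : K, θ ⟨h * k * h⁻¹, hK.conj_mem k k.2 h⟩ = θ k
  inv_φ : ∀ (h : G) (hh : h ∈ H) (l : ↥(H ⊓ K)),
    φ ⟨h * l * h⁻¹, H.mul_mem (H.mul_mem hh l.2.1) (H.inv_mem hh), hK.conj_mem l l.2.2 h⟩ = φ l
  val_θ : ∀ k, θ k ∈ F
  val_φ : ∀ l, φ l ∈ F

/-- `i = e_φ e_θ`. -/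
def magicIdem (F : Subfield ℂ) {H K : Subgroup G} (θ : K → ℂ) (φ : ↥(H ⊓ K) → ℂ) :
    MonoidAlgebra F G :=
  subIdem F φ * subIdem F θ

theorem subIdem_central {F : Subfield ℂ} {V : Subgroup G} {χ : V → ℂ} (hχ : IsIrrChar χ)
    {a : MonoidAlgebra F G} (ha : a ∈ subgroupAlg F V) :
    a * subIdem F χ = subIdem F χ * a := by
  obtain ⟨b, rfl⟩ := ha
  have h := congrArg (MonoidAlgebra.mapDomainAlgHom F F V.subtype)
    (charIdem_central (E := F) hχ.conj_eq b)
  rw [map_mul, map_mul] at h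
  exact h

theorem subIdem_idem {F : Subfield ℂ} {V : Subgroup G} {χ : V → ℂ} (hχ : IsIrrChar χ)
    (hF : ∀ v, χ v ∈ F) : subIdem F χ * subIdem F χ = subIdem F χ := by
  unfold subIdem
  rw [← map_mul, charIdem_idem hχ fun v => ⟨⟨χ v, hF v⟩, rfl⟩]

theorem subIdem_mem_of_le {F : Subfield ℂ} {V W : Subgroup G} (h : V ≤ W) (χ : V → ℂ) :
    subIdem F χ ∈ subgroupAlg F W := by
  refine ⟨MonoidAlgebra.mapDomainAlgHom F F (Subgroup.inclusion h) (charIdem F χ), ?_⟩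
  change ((MonoidAlgebra.mapDomainAlgHom F F W.subtype).comp
    (MonoidAlgebra.mapDomainAlgHom F F (Subgroup.inclusion h))) _ = _
  rw [← MonoidAlgebra.mapDomainAlgHom_comp]
  rfl

section

variable {F : Subfield ℂ} {H K : Subgroup G} [K.Normal] {θ : K → ℂ} {φ : ↥(H ⊓ K) → ℂ}

theorem BasicConfig.idem (hB : BasicConfig F H K θ φ) :
    magicIdem F θ φ * magicIdem F θ φ = magicIdem F θ φ := by
  have h1 := subIdem_central (F := F) hB.irr_θ (subIdem_mem_of_le inf_le_right φ)
  have h2 := subIdem_idem hB.irr_θ hB.val_θ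
  have h3 := subIdem_idem hB.irr_φ hB.val_φ
  unfold magicIdem
  rw [mul_assoc, ← mul_assoc (subIdem F θ), ← h1, mul_assoc, h2, ← mul_assoc, h3]

theorem BasicConfig.idem_comm (hB : BasicConfig F H K θ φ) (l : ↥(H ⊓ K)) :
    MonoidAlgebra.of F G (l : G) * magicIdem F θ φ =
      magicIdem F θ φ * MonoidAlgebra.of F G (l : G) := by
  have h1 := subIdem_central (F := F) hB.irr_φ (of_mem_subgroupAlg F l)
  have h2 := subIdem_central (F := F) hB.irr_θ (of_mem_subgroupAlg F (⟨l, l.2.2⟩ : K))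
  change MonoidAlgebra.of F G (l : G) * _ = _ * MonoidAlgebra.of F G (l : G) at h2
  unfold magicIdem
  rw [← mul_assoc, h1, mul_assoc, h2, mul_assoc]

/-- `S = (i F K i)^L`, the centralizer of `L` in `i F K i`. -/
def magicSub (F : Subfield ℂ) {H K : Subgroup G} (θ : K → ℂ) (φ : ↥(H ⊓ K) → ℂ) :
    NonUnitalSubalgebra F (MonoidAlgebra F G) where
  carrier := {x | (∃ a ∈ subgroupAlg F K, x = magicIdem F θ φ * a * magicIdem F θ φ) ∧
    ∀ l : ↥(H ⊓ K), MonoidAlgebra.of F G (l : G) * x = x * MonoidAlgebra.of F G (l : G)}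
  add_mem' := by
    rintro _ _ ⟨⟨a, ha, rfl⟩, hx⟩ ⟨⟨b, hb, rfl⟩, hy⟩
    refine ⟨⟨a + b, add_mem ha hb, by rw [mul_add, add_mul]⟩, fun l => ?_⟩
    rw [mul_add, add_mul, hx, hy]
  zero_mem' := ⟨⟨0, zero_mem _, by rw [mul_zero, zero_mul]⟩, fun l => by rw [mul_zero, zero_mul]⟩
  mul_mem' := by
    rintro x y ⟨⟨a, ha, hxa⟩, hx⟩ ⟨⟨b, hb, hyb⟩, hy⟩
    refine ⟨⟨a * magicIdem F θ φ * (magicIdem F θ φ * b), ?_, ?_⟩, fun l => ?_⟩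
    · have hi : magicIdem F θ φ ∈ subgroupAlg F K :=
        mul_mem (subIdem_mem_of_le inf_le_right φ) (subIdem_mem_of_le le_rfl θ)
      exact mul_mem (mul_mem ha hi) (mul_mem hi hb)
    · rw [hxa, hyb]
      simp only [mul_assoc]
    · rw [← mul_assoc, hx, mul_assoc, hy, mul_assoc]
  smul_mem' := by
    rintro r _ ⟨⟨a, ha, rfl⟩, hx⟩
    refine ⟨⟨r • a, Subalgebra.smul_mem _ ha r, ?_⟩, fun l => ?_⟩
    · rw [mul_smul_comm, smul_mul_assoc]
    · rw [mul_smul_comm, hx, smul_mul_assoc]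

theorem BasicConfig.unit (hB : BasicConfig F H K θ φ) :
    magicIdem F θ φ ∈ magicSub F θ φ ∧ ∀ x ∈ magicSub F θ φ,
      magicIdem F θ φ * x = x ∧ x * magicIdem F θ φ = x := by
  refine ⟨⟨⟨1, one_mem _, by rw [mul_one, hB.idem]⟩, hB.idem_comm⟩, ?_⟩
  rintro _ ⟨⟨a, -, rfl⟩, -⟩
  constructor
  · rw [← mul_assoc, ← mul_assoc, hB.idem]
  · rw [mul_assoc, hB.idem]

/-- The `F`-algebra `S = (i F K i)^L`, with unit element `i`. -/
abbrev MagicAlg (hB : BasicConfig F H K θ φ) : Type _ :=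
  SubAlg (magicSub F θ φ) (magicIdem F θ φ) hB.unit

/-- The coset `Lh` in `H/L` (here `L = H ∩ K` is written as the subgroup `K.subgroupOf H` of
`H`). -/
def coset (K : Subgroup G) {H : Subgroup G} {h : G} (hh : h ∈ H) : H ⧸ K.subgroupOf H :=
  QuotientGroup.mk ⟨h, hh⟩

/-- `σ : H/L → Sˣ` is a magic representation: it is multiplicative, and `h⁻¹ s h` equals
`σ(Lh)⁻¹ s σ(Lh)` for all `s ∈ S` and `h ∈ H`. -/
def IsMagic (hB : BasicConfig F H K θ φ) (σ : H ⧸ K.subgroupOf H →* (MagicAlg hB)ˣ) : Prop :=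
  ∀ (s : MagicAlg hB) (h : G) (hh : h ∈ H),
    MonoidAlgebra.of F G h⁻¹ * s.val * MonoidAlgebra.of F G h =
      SubAlg.val (((σ (coset K hh))⁻¹ : (MagicAlg hB)ˣ).val * s * (σ (coset K hh)).val)

/-- The magic character `ψ(Lh) = tr(σ(Lh))`, with values in `F ≤ ℂ`. -/
def magicChar (hB : BasicConfig F H K θ φ) (σ : H ⧸ K.subgroupOf H →* (MagicAlg hB)ˣ)
    (x : H ⧸ K.subgroupOf H) : ℂ :=
  ((reducedTrace F (σ x).val : F) : ℂ)

/-- The value at `x ∈ F U ≤ F G` of the linear extension of a function `χ` on `U`. -/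
def linExt {U : Subgroup G} (χ : U → ℂ) (x : MonoidAlgebra F G) : ℂ :=
  ∑ᶠ u : U, (x.coeff (u : G) : ℂ) * χ u

/-- The function `h ↦ χ(s₀ σ(Lh)⁻¹ h)` on `U ∩ H`. -/
def iotaFun (hB : BasicConfig F H K θ φ) (σ : H ⧸ K.subgroupOf H →* (MagicAlg hB)ˣ)
    (s₀ : MagicAlg hB) {U : Subgroup G} (χ : U → ℂ) : ↥(U ⊓ H) → ℂ :=
  fun h => linExt χ
    (SubAlg.val (s₀ * ((σ (coset K h.2.2))⁻¹ : (MagicAlg hB)ˣ).val) * MonoidAlgebra.of F G (h : G))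

end

end Magic

end MagicRep

end

noncomputable section

namespace MagicRep

attribute [local instance 10] Fintype.ofFinite

/-! ### Irreducible characters of a finite group -/

section IrrChar

variable {G : Type*} [Group G]

/-! Write c_h = σ(Lh)⁻¹h (`magicElt`) and tr for the functional s ↦ θ(s)/φ(1) (`magicTr`). The magic
relation makes c_h centralize S, and h ↦ c_h is multiplicative, with c_l = il for l in L. The corner
i(FU)i is spanned by the products s·c_h with s in S and h in U ∩ H, so it behaves like S tensored
with the image of F(U ∩ H) under h ↦ c_h. A class function above θ can only be a multiple of the
trace on the S-factor, and ι keeps its values on the other factor.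

All constants come from Schur's lemma in averaged form: the K-conjugates of b in FK sum, after
multiplication by e_θ, to |K|θ(b)/θ(1) times e_θ, and likewise for L and φ (`subgroup_sum_conj`).
Let P be the projection a ↦ |L|⁻¹ Σ l(iai)l⁻¹ of FK onto S. The two averages together give the
Casimir identity Σ_k P(k) s P(k⁻¹) = |K|/(θ(1)φ(1)) tr(s) i and an expansion in dual bases
(`sum_magicProj_mul_magicProj`, `sum_magicTr_smul_magicProj`). The variant `sum_conj_mul_magicElt`
evaluates Σ_k ik(s c_y)k⁻¹i as a multiple of tr(s) Σ_l c_{lyl⁻¹}. For f above θ this yields tr(i)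
f(s c_y) = tr(s) f(c_y) (`linFun_mul_magicElt`). Hence the formula for ι does not depend on s₀, and
s₀ = i/tr(i) serves throughout (`magicMap`).

For invariant θ, the span of Irr(V | θ) is cut out by two linear conditions: f is a class function
and f(e_θ v) = f(v) (`mem_irrAboveSpan_iff`). The map ι is injective because the K-conjugates of i
add up to a nonzero multiple of e_θ, so f is determined on i(FU)i. An explicit right inverse
(`magicInv`) is also adjoint to ι for the form |U|⁻¹ Σ f(u)χ(u⁻¹); being inverse and adjoint at once
makes ι an isometry. Irreducibility needs no modules: a class function of norm 1 with f(1) > 0 and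
f(1) Σ_u f(uau⁻¹b) = |V| f(a)f(b) is an irreducible character (`isIrrChar_of_sum_conj_mul`), and
averaging over U transports this relation to U ∩ H (`magicMap_product_formula`).

Most compatibilities are read off the formula; induction follows from restriction by Frobenius
reciprocity. The two formulas with ψ come from ih = σ(Lh)c_h, which gives f(ih) = tr(σ(Lh))
f(c_h)/tr(i).

For reduced traces and Brauer classes, an algebra with a trace form and Casimir identities
(`CasimirDatum`) is finite-dimensional and central simple of dimension tr(1)². If tr(1) is a natural
number, here the multiplicity of φ in θ_L, the form is the reduced trace. Over E = F(χ), the algebra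
S and the block of χ^ι have commuting images in EU, and their product maps onto a corner of the
block of χ. A nonzero corner of a simple algebra is Morita equivalent to it
(`exists_matrix_algEquiv_of_corner`), which is the relation between the Brauer classes. -/

theorem IsIrrChar.exists_one_eq {χ : G → ℂ} (hχ : IsIrrChar χ) : ∃ n : ℕ, n ≠ 0 ∧ χ 1 = n := by
  obtain ⟨n, ρ, hρ, rfl⟩ := hχ
  refine ⟨n, ?_, by simp⟩
  rintro rfl
  -- Irreducibility provides two different subrepresentations, but the zero space has only one.
  obtain ⟨a, b, hab⟩ := hρ.exists_pair_ne
  refine hab (SetLike.ext fun x => ?_)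
  rw [Subsingleton.elim x 0]
  exact ⟨fun _ => b.toSubmodule.zero_mem, fun _ => a.toSubmodule.zero_mem⟩

theorem IsIrrChar.one_ne_zero {χ : G → ℂ} (hχ : IsIrrChar χ) : χ 1 ≠ 0 := by
  obtain ⟨n, hn, h⟩ := hχ.exists_one_eq
  rw [h]
  exact_mod_cast hn

theorem IsIrrChar.mul_comm_apply {χ : G → ℂ} (hχ : IsIrrChar χ) (g h : G) :
    χ (g * h) = χ (h * g) := by
  rw [← hχ.conj_eq (g * h) h]
  congr 1
  group

variable [Finite G]

theorem natCard_ne_zero' (G : Type*) [Group G] [Finite G] : (Nat.card G : ℂ) ≠ 0 := by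
  exact_mod_cast Nat.card_pos.ne'

open scoped ComplexOrder in
-- Weyl's unitary trick: the averaged Hermitian form B is invertible and G-invariant, so the adjoint
-- of A(g) is conjugate under B to A(g⁻¹), and the two have the same trace.
theorem IsIrrChar.conj_apply {χ : G → ℂ} (hχ : IsIrrChar χ) (g : G) : conj (χ g) = χ g⁻¹ := by
  obtain ⟨n, ρ, -, rfl⟩ := hχ
  classical
  let A : G → Matrix (Fin n) (Fin n) ℂ := fun g => LinearMap.toMatrix' (ρ g)
  have hmul : ∀ x y, A (x * y) = A x * A y := fun x y => by
    simp only [A, map_mul, Module.End.mul_eq_comp, LinearMap.toMatrix'_comp]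
  have hone : A 1 = 1 := by simp [A]
  have htr : ∀ x, ρ.character x = (A x).trace := fun x => by
    simp only [A, Representation.character, LinearMap.trace_eq_matrix_trace ℂ (Pi.basisFun ℂ (Fin n)),
      LinearMap.toMatrix_eq_toMatrix']
  let B : Matrix (Fin n) (Fin n) ℂ := ∑ x, (A x).conjTranspose * A x
  have hB : B.PosDef := by
    -- Splitting off the summand at the identity element gives definiteness; the other summands are
    -- only semidefinite.
    have : B = (1 : Matrix (Fin n) (Fin n) ℂ) +
        ∑ x ∈ Finset.univ.erase (1 : G), (A x).conjTranspose * A x := by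
      simp only [B]
      rw [← Finset.add_sum_erase _ _ (Finset.mem_univ (1 : G)), hone]
      simp
    rw [this]
    exact Matrix.PosDef.one.add_posSemidef
      (Matrix.posSemidef_sum _ fun x _ => Matrix.posSemidef_conjTranspose_mul_self _)
  have hdet : IsUnit B.det := (Matrix.isUnit_iff_isUnit_det _).1 hB.isUnit
  have hinv : (A g).conjTranspose * B * A g = B := by
    simp only [B, Finset.mul_sum, Finset.sum_mul]
    refine Fintype.sum_equiv (Equiv.mulRight g) _ _ fun x => ?_
    simp only [Equiv.coe_mulRight, hmul, Matrix.conjTranspose_mul, Matrix.mul_assoc]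
  have hg : A g * A g⁻¹ = 1 := by rw [← hmul, mul_inv_cancel, hone]
  have h2 : (A g).conjTranspose * B = B * A g⁻¹ := by
    rw [← hinv, Matrix.mul_assoc _ (A g), hg, Matrix.mul_one, hinv]
  have h3 : (A g).conjTranspose = B * A g⁻¹ * B⁻¹ := by
    rw [← h2, Matrix.mul_assoc, Matrix.mul_nonsing_inv _ hdet, Matrix.mul_one]
  rw [htr, htr, starRingEnd_apply, ← Matrix.trace_conjTranspose, h3, Matrix.trace_mul_comm,
    ← Matrix.mul_assoc, Matrix.nonsing_inv_mul _ hdet, Matrix.one_mul]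

/-- Schur's lemma in the language of characters. -/
theorem IsIrrChar.sum_conj_mul {χ : G → ℂ} (hχ : IsIrrChar χ) (a b : G) :
    χ 1 * ∑ u : G, χ (u * a * u⁻¹ * b) = Nat.card G * (χ a * χ b) := by
  obtain ⟨n, ρ, hρ, rfl⟩ := hχ
  let f : ρ.IntertwiningMap ρ :=
    { toLinearMap := ∑ u : G, ρ (u * a * u⁻¹)
      isIntertwining' := by
        intro x
        change (∑ u : G, ρ (u * a * u⁻¹)) * ρ x = ρ x * (∑ u : G, ρ (u * a * u⁻¹))
        rw [Finset.sum_mul, Finset.mul_sum]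
        refine Fintype.sum_equiv (Equiv.mulLeft x⁻¹) _ _ fun u => ?_
        simp only [Equiv.coe_mulLeft, ← map_mul]
        congr 1
        group }
  obtain ⟨c, hc⟩ :=
    (Representation.IsIrreducible.algebraMap_intertwiningMap_bijective_of_isAlgClosed
      (ρ := ρ)).2 f
  have hf : ∑ u : G, ρ (u * a * u⁻¹) = c • (1 : Module.End ℂ (Fin n → ℂ)) :=
    (congrArg Representation.IntertwiningMap.toLinearMap hc).symm
  have key : ∀ x : G, ∑ u : G, ρ.character (u * a * u⁻¹ * x) = c * ρ.character x := by
    intro x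
    have h3 := congrArg (fun T => LinearMap.trace ℂ (Fin n → ℂ) (T * ρ x)) hf
    simpa [Finset.sum_mul, Representation.character, map_mul] using h3
  have h1 := key 1
  simp only [mul_one, Representation.char_conj, Finset.sum_const, Finset.card_univ, nsmul_eq_mul]
    at h1
  rw [key, ← mul_assoc, mul_comm _ c, ← h1, Fintype.card_eq_nat_card]
  ring

/-- Orthonormality phrased by equality of characters instead of isomorphism of representations.
Equal characters of non-isomorphic representations would have norm 0 and norm 1 at once. -/
theorem IsIrrChar.eq_of_equiv {n m : ℕ} {ρ : Representation ℂ G (Fin n → ℂ)}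
    {τ : Representation ℂ G (Fin m → ℂ)} (hρ : ρ.IsIrreducible) (hτ : τ.IsIrreducible) :
    (Nat.card G : ℂ)⁻¹ * ∑ g : G, ρ.character g * τ.character g⁻¹ =
      open scoped Classical in if ρ.character = τ.character then 1 else 0 := by
  classical
  have : Invertible (Nat.card G : ℂ) := invertibleOfNonzero (natCard_ne_zero' G)
  rw [Representation.char_orthonormal]
  by_cases h : Nonempty (τ.Equiv ρ)
  · rw [if_pos h, if_pos]
    exact (Representation.char_iso h.some).symm
  · rw [if_neg h, if_neg]
    intro he
    have h1 := Representation.char_orthonormal ρ τ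
    have h2 := Representation.char_orthonormal ρ ρ
    rw [if_neg h] at h1
    rw [if_pos ⟨Representation.Equiv.refl _⟩] at h2
    simp only [he] at h1 h2
    rw [h1] at h2
    exact zero_ne_one h2

theorem classInner_eq (α β : G → ℂ) :
    classInner α β = (Nat.card G : ℂ)⁻¹ * ∑ g : G, α g * conj (β g) := by
  rw [classInner, finsum_eq_sum_of_fintype]

theorem IsIrrChar.classInner_right {χ : G → ℂ} (hχ : IsIrrChar χ) (α : G → ℂ) :
    classInner α χ = (Nat.card G : ℂ)⁻¹ * ∑ g : G, α g * χ g⁻¹ := by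
  simp only [classInner_eq, hχ.conj_apply]

open scoped Classical in
theorem IsIrrChar.classInner {χ χ' : G → ℂ} (hχ : IsIrrChar χ) (hχ' : IsIrrChar χ') :
    classInner χ χ' = if χ = χ' then 1 else 0 := by
  rw [hχ'.classInner_right]
  obtain ⟨n, ρ, hρ, rfl⟩ := hχ
  obtain ⟨m, τ, hτ, rfl⟩ := hχ'
  exact IsIrrChar.eq_of_equiv hρ hτ

/-- The inner product as a sesquilinear map. -/
def classInnerₗ (G : Type*) [Group G] [Finite G] : (G → ℂ) →ₗ[ℂ] (G → ℂ) →ₗ⋆[ℂ] ℂ :=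
  LinearMap.mk₂'ₛₗ (RingHom.id ℂ) (starRingEnd ℂ) classInner
    (fun a b c => by simp only [classInner_eq, Pi.add_apply, add_mul, Finset.sum_add_distrib, mul_add])
    (fun r a b => by
      simp only [classInner_eq, Pi.smul_apply, smul_eq_mul, RingHom.id_apply, mul_assoc,
        ← Finset.mul_sum]
      ring)
    (fun a b c => by
      simp only [classInner_eq, Pi.add_apply, map_add, mul_add, Finset.sum_add_distrib])
    (fun r a b => by
      simp only [classInner_eq, Pi.smul_apply, smul_eq_mul, map_mul, Finset.mul_sum]
      refine Finset.sum_congr rfl fun x _ => ?_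
      ring)

theorem classInnerₗ_apply (α β : G → ℂ) : classInnerₗ G α β = classInner α β := rfl

theorem classInner_conj_symm (α β : G → ℂ) : conj (classInner α β) = classInner β α := by
  simp only [classInner_eq, map_mul, map_inv₀, map_natCast, map_sum, Complex.conj_conj, mul_comm]

theorem classInner_self_eq_zero {α : G → ℂ} (h : classInner α α = 0) : α = 0 := by
  rw [classInner_eq] at h
  have h1 := (mul_eq_zero.1 h).resolve_left (inv_ne_zero (natCard_ne_zero' G))
  have h2 : ∑ g : G, Complex.normSq (α g) = 0 := by
    have : ((∑ g : G, Complex.normSq (α g) : ℝ) : ℂ) = 0 := by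
      rw [← h1]
      push_cast
      simp only [Complex.mul_conj]
    exact_mod_cast this
  rw [Finset.sum_eq_zero_iff_of_nonneg fun g _ => Complex.normSq_nonneg _] at h2
  funext g
  exact Complex.normSq_eq_zero.1 (h2 g (Finset.mem_univ g))

theorem IsIrrChar.linearIndependent :
    LinearIndependent ℂ (fun χ : {χ : G → ℂ | IsIrrChar χ} => (χ : G → ℂ)) := by
  classical
  rw [linearIndependent_iff']
  intro s c hc χ hχ
  have h := congrArg (fun f => classInnerₗ G f χ.1) hc
  simp only [map_sum, LinearMap.sum_apply, map_smul, LinearMap.smul_apply, map_zero,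
    LinearMap.zero_apply, classInnerₗ_apply, smul_eq_mul] at h
  rw [Finset.sum_eq_single χ] at h
  · simpa [χ.2.classInner χ.2] using h
  · intro b _ hb
    rw [b.2.classInner χ.2, if_neg (fun h => hb (Subtype.ext h)), mul_zero]
  · exact fun h => absurd hχ h

/-- Orthonormality makes the irreducible characters linearly independent inside a finite-dimensional
space of functions. -/
theorem finite_isIrrChar (G : Type*) [Group G] [Finite G] : {χ : G → ℂ | IsIrrChar χ}.Finite := by
  have := (IsIrrChar.linearIndependent (G := G)).finite
  exact Set.toFinite _

end IrrChar

/-! ### Class functions -/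

section LinearExtension

variable {E M : Type*} [Field E] [AddCommGroup M] [Module E M] {G : Type*}

/-- The linear extension of a function on `G` to the group algebra. -/
def linFun (E : Type*) {M : Type*} [Field E] [AddCommGroup M] [Module E M] {G : Type*} (f : G → M) :
    MonoidAlgebra E G →ₗ[E] M :=
  Finsupp.linearCombination E f ∘ₗ (MonoidAlgebra.coeffLinearEquiv E).toLinearMap

theorem linFun_single (f : G → M) (g : G) (r : E) :
    linFun E f (MonoidAlgebra.single g r) = r • f g := by
  simp [linFun, MonoidAlgebra.coeffLinearEquiv]

theorem linFun_of [Group G] (f : G → M) (g : G) :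
    linFun E f (MonoidAlgebra.of E G g) = f g := by
  rw [MonoidAlgebra.of_apply, linFun_single, one_smul]

theorem linFun_apply [Finite G] (f : G → M) (x : MonoidAlgebra E G) :
    linFun E f x = ∑ g : G, x.coeff g • f g := by
  simp [linFun, MonoidAlgebra.coeffLinearEquiv, Finsupp.linearCombination_apply,
    Finsupp.sum_fintype]

end LinearExtension

/-! ### Trace functionals on matrix algebras -/

section Trace

variable {K : Type*} [Field K]

/-- A linear functional on a full matrix algebra that vanishes on commutators is a multiple of the
trace. -/
theorem exists_eq_mul_trace {n : ℕ} (f : Matrix (Fin n) (Fin n) K →ₗ[K] K)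
    (hf : ∀ a b, f (a * b) = f (b * a)) : ∃ c, ∀ a, f a = c * a.trace := by
  classical
  -- An off-diagonal matrix unit is the commutator of itself with e_jj; the diagonal ones differ
  -- from each other by commutators.
  have hne : ∀ i j, i ≠ j → f (Matrix.single i j 1) = 0 := by
    intro i j hij
    have h := hf (Matrix.single i j 1) (Matrix.single j j 1)
    rwa [Matrix.single_mul_single_same, Matrix.single_mul_single_of_ne _ _ _ _ hij.symm, mul_one,
      map_zero] at h
  have heq : ∀ i j, f (Matrix.single i i 1) = f (Matrix.single j j 1) := by
    intro i j
    have h := hf (Matrix.single i j 1) (Matrix.single j i 1)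
    rwa [Matrix.single_mul_single_same, Matrix.single_mul_single_same, mul_one] at h
  obtain ⟨c, hc⟩ : ∃ c, ∀ i, f (Matrix.single i i 1) = c := by
    rcases isEmpty_or_nonempty (Fin n) with h | ⟨⟨j⟩⟩
    · exact ⟨0, fun i => isEmptyElim i⟩
    · exact ⟨f (Matrix.single j j 1), fun i => heq i j⟩
  refine ⟨c, fun a => ?_⟩
  conv_lhs => rw [Matrix.matrix_eq_sum_single a]
  simp only [map_sum, Matrix.trace, Matrix.diag_apply, Finset.mul_sum]
  refine Finset.sum_congr rfl fun i _ => ?_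
  rw [Finset.sum_eq_single i]
  · rw [← mul_one (a i i), ← smul_eq_mul, ← Matrix.smul_single, map_smul, hc, smul_eq_mul,
      smul_eq_mul, mul_one, mul_comm]
  · intro j _ hj
    rw [← mul_one (a i j), ← smul_eq_mul, ← Matrix.smul_single, map_smul, hne i j hj.symm,
      smul_zero]
  · exact fun h => absurd (Finset.mem_univ i) h

end Trace

/-! ### Expansion of class functions and a criterion for irreducibility -/

section ClassFunctions

variable {G : Type*} [Group G]

theorem mul_comm_of_mem_irrSpan {f : G → ℂ} (hf : f ∈ irrSpan G) (g h : G) :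
    f (g * h) = f (h * g) := by
  induction hf using Submodule.span_induction with
  | mem χ hχ => exact IsIrrChar.mul_comm_apply hχ g h
  | zero => rfl
  | add a b _ _ ha hb => exact congrArg₂ (· + ·) ha hb
  | smul r a _ ha => exact congrArg (r * ·) ha

variable [Finite G]

/-- The irreducible characters span the class functions. -/
theorem mem_irrSpan_of_mul_comm {f : G → ℂ} (hf : ∀ g h, f (g * h) = f (h * g)) :
    f ∈ irrSpan G := by
  classical
  have : NeZero (Nat.card G : ℂ) := ⟨natCard_ne_zero' G⟩
  have : FiniteDimensional ℂ (MonoidAlgebra ℂ G) :=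
    Module.Finite.equiv (MonoidAlgebra.coeffLinearEquiv (R := ℂ) (S := ℂ) (M := G)).symm
  -- By Maschke and Wedderburn the group algebra is a product of matrix algebras. On each factor the
  -- linear extension of f vanishes on commutators, so it is a multiple of the matrix trace, and the
  -- trace of a factor is the character of the corresponding representation.
  obtain ⟨N, d, hd, ⟨e⟩⟩ :=
    IsSemisimpleRing.exists_algEquiv_pi_matrix_of_isAlgClosed ℂ (MonoidAlgebra ℂ G)
  let F : MonoidAlgebra ℂ G →ₗ[ℂ] ℂ := linFun ℂ f
  have hF : ∀ a b, F (a * b) = F (b * a) := by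
    intro a b
    induction a using MonoidAlgebra.induction_on with
    | of g =>
      induction b using MonoidAlgebra.induction_on with
      | of h => rw [← map_mul, ← map_mul]; simp only [F, linFun_of, hf]
      | add a b ha hb => rw [mul_add, add_mul, map_add, map_add, ha, hb]
      | smul r a ha => rw [mul_smul_comm, smul_mul_assoc, map_smul, map_smul, ha]
    | add a b ha hb => rw [mul_add, add_mul, map_add, map_add, ha, hb]
    | smul r a ha => rw [mul_smul_comm, smul_mul_assoc, map_smul, map_smul, ha]
  have hcomp : ∀ i, ∃ c, ∀ a : Matrix (Fin (d i)) (Fin (d i)) ℂ,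
      F (e.symm (Pi.single i a)) = c * a.trace := by
    intro i
    have hs : ∀ a b : Matrix (Fin (d i)) (Fin (d i)) ℂ,
        (Pi.single i (a * b) : Π i, Matrix (Fin (d i)) (Fin (d i)) ℂ) =
          Pi.single i a * Pi.single i b := fun a b => by
      funext j
      by_cases h : j = i
      · subst h
        simp
      · simp [Pi.single_eq_of_ne h]
    let f' : Matrix (Fin (d i)) (Fin (d i)) ℂ →ₗ[ℂ] ℂ :=
      { toFun := fun a => F (e.symm (Pi.single i a))
        map_add' := fun a b => by rw [Pi.single_add, map_add, map_add]
        map_smul' := fun r a => by rw [Pi.single_smul, map_smul, map_smul, RingHom.id_apply] }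
    exact exists_eq_mul_trace f' fun a b => by
      change F (e.symm (Pi.single i (a * b))) = F (e.symm (Pi.single i (b * a)))
      rw [hs, hs, map_mul e.symm, hF, ← map_mul e.symm]
  choose c hc using hcomp
  let ρ : ∀ i, Representation ℂ G (Fin (d i) → ℂ) := fun i =>
    (((Matrix.toLinAlgEquiv' : Matrix (Fin (d i)) (Fin (d i)) ℂ ≃ₐ[ℂ] _) :
      Matrix (Fin (d i)) (Fin (d i)) ℂ →* _).comp
      (((Pi.evalAlgHom ℂ (fun i => Matrix (Fin (d i)) (Fin (d i)) ℂ) i).comp e.toAlgHom :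
        MonoidAlgebra ℂ G →ₐ[ℂ] _) : MonoidAlgebra ℂ G →* _)).comp (MonoidAlgebra.of ℂ G)
  have hρ : ∀ i g, ρ i g = Matrix.toLin' (e (MonoidAlgebra.of ℂ G g) i) := fun i g => rfl
  have hirr : ∀ i, (ρ i).IsIrreducible := by
    intro i
    have hd' := hd i
    have hsub : ∀ (W : Subrepresentation (ρ i)) (a : MonoidAlgebra ℂ G), ∀ w ∈ W,
        Matrix.toLin' (e a i) w ∈ W := by
      intro W a w hw
      induction a using MonoidAlgebra.induction_on with
      | of g => exact W.apply_mem_toSubmodule g hw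
      | add a b ha hb =>
        rw [map_add, Pi.add_apply, map_add, LinearMap.add_apply]
        exact W.toSubmodule.add_mem ha hb
      | smul r a ha =>
        rw [map_smul, Pi.smul_apply, map_smul, LinearMap.smul_apply]
        exact W.toSubmodule.smul_mem r ha
    -- Every matrix is the i-th component of an element of the group algebra, so a subrepresentation
    -- is stable under all matrices.
    have hsub' : ∀ (W : Subrepresentation (ρ i)) (A : Matrix (Fin (d i)) (Fin (d i)) ℂ), ∀ w ∈ W,
        Matrix.toLin' A w ∈ W := by
      intro W A w hw
      have h := hsub W (e.symm (Pi.single i A)) w hw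
      rwa [AlgEquiv.apply_symm_apply, Pi.single_eq_same] at h
    refine { exists_pair_ne := ⟨⊥, ⊤, fun h => ?_⟩, eq_bot_or_eq_top := fun W => ?_ }
    · have h1 : (fun _ => 1 : Fin (d i) → ℂ) ∈ (⊥ : Subrepresentation (ρ i)) := by
        rw [h]; trivial
      have h2 : (fun _ => 1 : Fin (d i) → ℂ) = 0 := h1
      exact one_ne_zero (congrFun h2 0)
    · by_cases hW : ∃ w ∈ W, w ≠ 0
      · right
        obtain ⟨w, hw, hw0⟩ := hW
        obtain ⟨j, hj⟩ := Function.ne_iff.1 hw0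
        rw [eq_top_iff]
        intro v _
        -- This matrix has the single nonzero column v/w_j in position j and therefore maps w to v.
        have h := hsub' W (Matrix.of fun a b => if b = j then v a * (w j)⁻¹ else 0) w hw
        convert! h using 1
        funext a
        simp [Matrix.toLin'_apply, Matrix.mulVec, dotProduct, ite_mul, mul_assoc,
          inv_mul_cancel₀ hj]
      · left
        rw [eq_bot_iff]
        intro w hw
        by_contra h
        exact hW ⟨w, hw, h⟩
  have hfin : f = ∑ i, c i • (ρ i).character := by
    funext g
    have h1 : f g = F (e.symm (e (MonoidAlgebra.of ℂ G g))) := by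
      rw [AlgEquiv.symm_apply_apply]
      exact (linFun_of f g).symm
    rw [h1, ← Finset.univ_sum_single (e (MonoidAlgebra.of ℂ G g)), map_sum, map_sum,
      Finset.sum_apply]
    refine Finset.sum_congr rfl fun i _ => ?_
    rw [hc, Pi.smul_apply, smul_eq_mul, Representation.character, hρ, Matrix.trace_toLin'_eq]
  rw [hfin]
  exact Submodule.sum_mem _ fun i _ =>
    Submodule.smul_mem _ _ (Submodule.subset_span ⟨d i, ρ i, hirr i, rfl⟩)

/-- A class function that is orthogonal to all irreducible characters is zero. -/
theorem exists_classInner_ne_zero {f : G → ℂ} (hf : f ∈ irrSpan G) (h0 : f ≠ 0) :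
    ∃ χ, IsIrrChar χ ∧ classInner f χ ≠ 0 := by
  by_contra! h
  refine h0 (classInner_self_eq_zero ?_)
  rw [← classInnerₗ_apply]
  have : irrSpan G ≤ LinearMap.ker (classInnerₗ G f) := Submodule.span_le.2 fun χ hχ => h χ hχ
  exact this hf

/-- The expansion of a class function in irreducible characters. -/
theorem eq_sum_irr {f : G → ℂ} (hf : f ∈ irrSpan G) :
    f = ∑ χ ∈ (finite_isIrrChar G).toFinset, classInner f χ • χ := by
  rw [← sub_eq_zero]
  have hmem : f - ∑ χ ∈ (finite_isIrrChar G).toFinset, classInner f χ • χ ∈ irrSpan G :=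
    Submodule.sub_mem _ hf <| Submodule.sum_mem _ fun χ hχ =>
      Submodule.smul_mem _ _ (Submodule.subset_span ((finite_isIrrChar G).mem_toFinset.1 hχ))
  by_contra h0
  obtain ⟨χ, hχ, h⟩ := exists_classInner_ne_zero hmem h0
  refine h ?_
  rw [← classInnerₗ_apply, map_sub, map_sum, LinearMap.sub_apply, LinearMap.sum_apply,
    Finset.sum_eq_single χ, map_smul, LinearMap.smul_apply, classInnerₗ_apply, classInnerₗ_apply,
    hχ.classInner hχ, if_pos rfl, smul_eq_mul, mul_one, sub_self]
  · intro b hb hbχ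
    rw [map_smul, LinearMap.smul_apply, classInnerₗ_apply,
      IsIrrChar.classInner ((finite_isIrrChar G).mem_toFinset.1 hb) hχ, if_neg hbχ, smul_zero]
  · exact fun h => absurd ((finite_isIrrChar G).mem_toFinset.2 hχ) h

/-- A class function with the multiplicativity property of irreducible characters, of norm `1` and
with positive value at `1`, is an irreducible character. -/
theorem isIrrChar_of_sum_conj_mul {f : G → ℂ} (hf : ∀ g h, f (g * h) = f (h * g)) {r : ℝ}
    (hr : 0 < r) (h1 : f 1 = r)
    (hmul : ∀ a b, f 1 * ∑ u : G, f (u * a * u⁻¹ * b) = Nat.card G * (f a * f b))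
    (hnorm : ∑ g : G, f g * f g⁻¹ = Nat.card G) : IsIrrChar f := by
  have hf1 : f 1 ≠ 0 := by
    rw [h1]
    exact_mod_cast hr.ne'
  obtain ⟨χ, hχ, hχ0⟩ := exists_classInner_ne_zero (mem_irrSpan_of_mul_comm hf)
    (fun h => hf1 (congrFun h 1))
  rw [hχ.classInner_right] at hχ0
  set s := ∑ g : G, f g * χ g⁻¹ with hs
  have hs0 : s ≠ 0 := right_ne_zero_of_mul hχ0
  have hcard := natCard_ne_zero' G
  -- The sum of f(yx)χ(y⁻¹) over y is evaluated twice, once with the product relation of f and once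
  -- with that of χ. Comparing the results makes f proportional to χ, since s is nonzero.
  have key1 : ∀ x, f 1 * ∑ y, f (y * x) * χ y⁻¹ = f x * s := by
    intro x
    have h2 : ∑ y, (f 1 * ∑ u : G, f (u * x * u⁻¹ * y)) * χ y⁻¹ = Nat.card G * (f x * s) := by
      simp only [hmul, hs, Finset.mul_sum]
      refine Finset.sum_congr rfl fun y _ => ?_
      ring
    have h3 : ∑ y, (f 1 * ∑ u : G, f (u * x * u⁻¹ * y)) * χ y⁻¹ =
        f 1 * ∑ u : G, ∑ y, f (y * x) * χ y⁻¹ := by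
      simp only [Finset.mul_sum, Finset.sum_mul]
      rw [Finset.sum_comm]
      refine Finset.sum_congr rfl fun u _ => ?_
      refine Fintype.sum_equiv (MulAut.conj u⁻¹).toEquiv _ _ fun y => ?_
      simp only [MulEquiv.toEquiv_eq_coe, EquivLike.coe_coe, MulAut.conj_apply, inv_inv,
        mul_inv_rev]
      have h4 := hχ.conj_eq y⁻¹ u⁻¹
      rw [inv_inv] at h4
      rw [show u⁻¹ * (y⁻¹ * u) = u⁻¹ * y⁻¹ * u by group, h4, hf _ y,
        show y * (u * x * u⁻¹) = y * (u * x) * u⁻¹ by group, hf _ u⁻¹,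
        show u⁻¹ * (y * (u * x)) = u⁻¹ * y * u * x by group, mul_assoc]
    rw [h3, Finset.sum_const, Finset.card_univ, Fintype.card_eq_nat_card, nsmul_eq_mul] at h2
    refine mul_left_cancel₀ hcard ?_
    rw [← h2]
    ring
  have key2 : ∀ x, χ 1 * ∑ y, f (y * x) * χ y⁻¹ = χ x * s := by
    intro x
    have h2 : ∑ y, (χ 1 * ∑ u : G, χ (u * x * u⁻¹ * y⁻¹)) * f y = Nat.card G * (χ x * s) := by
      simp only [hχ.sum_conj_mul, hs, Finset.mul_sum]
      refine Finset.sum_congr rfl fun y _ => ?_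
      ring
    have h3 : ∑ y, (χ 1 * ∑ u : G, χ (u * x * u⁻¹ * y⁻¹)) * f y =
        χ 1 * ∑ u : G, ∑ y, f (y * x) * χ y⁻¹ := by
      simp only [Finset.mul_sum, Finset.sum_mul]
      rw [Finset.sum_comm]
      refine Finset.sum_congr rfl fun u _ => ?_
      refine Fintype.sum_equiv ((MulAut.conj u⁻¹).toEquiv.trans (Equiv.mulRight x⁻¹)) _ _
        fun y => ?_
      simp only [MulEquiv.toEquiv_eq_coe, Equiv.trans_apply, EquivLike.coe_coe, MulAut.conj_apply,
        inv_inv, mul_inv_rev, Equiv.coe_mulRight, inv_mul_cancel_right]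
      rw [hf (u⁻¹ * y) u, mul_inv_cancel_left,
        show x * (u⁻¹ * (y⁻¹ * u)) = x * u⁻¹ * y⁻¹ * u by group, hχ.mul_comm_apply _ u,
        show u * (x * u⁻¹ * y⁻¹) = u * x * u⁻¹ * y⁻¹ by group]
      ring
    rw [h3, Finset.sum_const, Finset.card_univ, Fintype.card_eq_nat_card, nsmul_eq_mul] at h2
    refine mul_left_cancel₀ hcard ?_
    rw [← h2]
    ring
  have hprop : ∀ x, f x * χ 1 = f 1 * χ x := by
    intro x
    refine mul_right_cancel₀ hs0 ?_
    linear_combination (-χ 1) * key1 x + f 1 * key2 x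
  obtain ⟨n, hn, hχ1⟩ := hχ.exists_one_eq
  have hn' : (0 : ℝ) < n := by exact_mod_cast Nat.pos_of_ne_zero hn
  have hfχ : ∀ x, f x = ((r / n : ℝ) : ℂ) * χ x := by
    intro x
    have := hprop x
    have hn0 : (n : ℂ) ≠ 0 := by exact_mod_cast hn
    rw [h1, hχ1] at this
    push_cast
    field_simp
    exact this
  -- Both f and χ have norm 1, so the factor of proportionality squares to 1; its positivity then
  -- excludes -1.
  have h5 : ((r / n : ℝ) : ℂ) ^ 2 = 1 := by
    have h6 : ∑ g : G, χ g * χ g⁻¹ = Nat.card G := by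
      have := hχ.classInner hχ
      rw [hχ.classInner_right, if_pos rfl] at this
      field_simp at this
      exact this
    have h7 : ∑ g : G, f g * f g⁻¹ = ((r / n : ℝ) : ℂ) ^ 2 * ∑ g : G, χ g * χ g⁻¹ := by
      rw [Finset.mul_sum]
      refine Finset.sum_congr rfl fun g _ => ?_
      rw [hfχ, hfχ g⁻¹]
      ring
    rw [hnorm, h6] at h7
    exact mul_right_cancel₀ hcard (by rw [← h7, one_mul])
  have h8 : (r / n : ℝ) = 1 := by
    have h9 : (r / n : ℝ) ^ 2 = 1 := by exact_mod_cast h5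
    have h10 := div_pos hr hn'
    nlinarith
  have : f = χ := by
    funext x
    rw [hfχ, h8, Complex.ofReal_one, one_mul]
  rw [this]
  exact hχ

end ClassFunctions

/-! ### Characters above a character of a normal subgroup -/

section ExtZero

variable {G : Type*} [Group G] {V : Subgroup G}

open scoped Classical in
/-- The extension of a function on `V` by zero. -/
def extZero {M : Type*} [Zero M] (V : Subgroup G) (f : V → M) (g : G) : M :=
  if h : g ∈ V then f ⟨g, h⟩ else 0

theorem extZero_coe {M : Type*} [Zero M] (f : V → M) (v : V) : extZero V f v = f v := by
  rw [extZero, dif_pos v.2]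

theorem extZero_of_mem {M : Type*} [Zero M] (f : V → M) {g : G} (h : g ∈ V) :
    extZero V f g = f ⟨g, h⟩ := by
  rw [extZero, dif_pos h]

theorem extZero_of_notMem {M : Type*} [Zero M] (f : V → M) {g : G} (h : g ∉ V) :
    extZero V f g = 0 := by
  rw [extZero, dif_neg h]

end ExtZero

section Above

variable {G : Type*} [Group G] [Finite G] {N V : Subgroup G} (hN : N ≤ V) (θ : N → ℂ)

/-- The function `v ↦ γ(e_θ v)`. -/
def aboveProj : (V → ℂ) →ₗ[ℂ] (V → ℂ) where
  toFun γ v := θ 1 / Nat.card N * ∑ n : N, θ n⁻¹ * γ (Subgroup.inclusion hN n * v)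
  map_add' a b := by
    funext v
    simp only [Pi.add_apply, mul_add, Finset.sum_add_distrib]
  map_smul' r a := by
    funext v
    simp only [Pi.smul_apply, smul_eq_mul, RingHom.id_apply, Finset.mul_sum]
    refine Finset.sum_congr rfl fun n _ => ?_
    ring

theorem aboveProj_apply (γ : V → ℂ) (v : V) : aboveProj hN θ γ v =
    θ 1 / Nat.card N * ∑ n : N, θ n⁻¹ * γ (Subgroup.inclusion hN n * v) := rfl

/-- The class functions `f` on `V` with `f(e_θ v) = f(v)`. -/
def IsAbove (f : V → ℂ) : Prop := (∀ g h, f (g * h) = f (h * g)) ∧ aboveProj hN θ f = f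

variable {hN θ}

/-- This is the idempotency of e_θ, that is, the convolution identity for θ. -/
theorem aboveProj_aboveProj (hθ : IsIrrChar θ) (f : V → ℂ) :
    aboveProj hN θ (aboveProj hN θ f) = aboveProj hN θ f := by
  have hcard := natCard_ne_zero' N
  funext v
  have h1 : ∀ p : N, θ 1 * ∑ n : N, θ n⁻¹ * θ (p * n⁻¹)⁻¹ = Nat.card N * θ p⁻¹ := by
    intro p
    rw [← hθ.convolution p⁻¹]
    congr 1
    refine Finset.sum_congr rfl fun n _ => ?_
    rw [mul_inv_rev, inv_inv, hθ.mul_comm_apply]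
  have h2 : ∑ n : N, θ n⁻¹ * ∑ m : N, θ m⁻¹ * f (Subgroup.inclusion hN m *
      (Subgroup.inclusion hN n * v)) =
      ∑ p : N, f (Subgroup.inclusion hN p * v) * ∑ n : N, θ n⁻¹ * θ (p * n⁻¹)⁻¹ := by
    simp only [Finset.mul_sum]
    rw [Finset.sum_comm (f := fun p n => f (Subgroup.inclusion hN p * v) *
      (θ n⁻¹ * θ (p * n⁻¹)⁻¹))]
    refine Finset.sum_congr rfl fun n _ => ?_
    refine Fintype.sum_equiv (Equiv.mulRight n) _ _ fun m => ?_
    simp only [Equiv.coe_mulRight, mul_inv_cancel_right]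
    simp only [map_mul, mul_assoc]
    ring
  simp only [aboveProj_apply]
  rw [show ∑ n : N, θ n⁻¹ * (θ 1 / Nat.card N * ∑ m : N, θ m⁻¹ * f (Subgroup.inclusion hN m *
      (Subgroup.inclusion hN n * v))) = (Nat.card N : ℂ)⁻¹ * (θ 1 * ∑ n : N, θ n⁻¹ *
      ∑ m : N, θ m⁻¹ * f (Subgroup.inclusion hN m * (Subgroup.inclusion hN n * v))) by
    simp only [Finset.mul_sum]
    refine Finset.sum_congr rfl fun n _ => Finset.sum_congr rfl fun m _ => ?_
    ring, h2, Finset.mul_sum (a := θ 1)]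
  rw [Finset.sum_congr rfl fun p _ => show θ 1 * (f (Subgroup.inclusion hN p * v) *
    ∑ n : N, θ n⁻¹ * θ (p * n⁻¹)⁻¹) = Nat.card N * (θ p⁻¹ * f (Subgroup.inclusion hN p * v)) by
      rw [mul_left_comm, h1]; ring, ← Finset.mul_sum, inv_mul_cancel_left₀ hcard]

variable (hθ : IsIrrChar θ)
  (hinv : ∀ v ∈ V, ∀ n : N, ∃ h : v * n * v⁻¹ ∈ N, θ ⟨v * n * v⁻¹, h⟩ = θ n)

include hinv in
theorem sum_conj_eq (f : G → ℂ) (v : V) :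
    ∑ n : N, θ n⁻¹ * f (v * n * (v : G)⁻¹) = ∑ n : N, θ n⁻¹ * f n := by
  choose h h' using hinv v v.2
  let e : N → N := fun n => ⟨v * n * (v : G)⁻¹, h n⟩
  have hinj : Function.Injective e := by
    intro a b hab
    have h1 := congrArg Subtype.val hab
    simp only [e] at h1
    exact Subtype.ext (by simpa using h1)
  refine Fintype.sum_equiv (Equiv.ofBijective e (Finite.injective_iff_bijective.1 hinj)) _ _
    fun n => ?_
  rw [Equiv.ofBijective_apply]
  congr 1
  rw [← h' n⁻¹]
  congr 1
  refine Subtype.ext ?_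
  simp [e, mul_assoc]

include hθ hinv in
-- Since θ is V-invariant, e_θ commutes with V and acts on an irreducible module as the scalar
-- χ(e_θ)/χ(1). In terms of characters, one averages over V and applies the product formula of χ.
theorem aboveProj_irr {χ : V → ℂ} (hχ : IsIrrChar χ) :
    aboveProj hN θ χ = (θ 1 / χ 1 * classInner (resFun hN χ) θ) • χ := by
  funext v
  have h1 := hχ.one_ne_zero
  have hcard := natCard_ne_zero' V
  have h2 : ∀ u : V, ∑ n : N, θ n⁻¹ * χ (u * Subgroup.inclusion hN n * u⁻¹ * v) =
      ∑ n : N, θ n⁻¹ * χ (Subgroup.inclusion hN n * v) := by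
    intro u
    refine Eq.trans (Finset.sum_congr rfl fun n _ => ?_)
      ((sum_conj_eq hinv (extZero V fun w => χ (w * v)) u).trans
        (Finset.sum_congr rfl fun n _ => ?_))
    · rw [extZero_of_mem _ (V.mul_mem (V.mul_mem u.2 (hN n.2)) (V.inv_mem u.2))]
      rfl
    · rw [extZero_of_mem _ (hN n.2)]
      rfl
  have h3 : χ 1 * (Nat.card V * ∑ n : N, θ n⁻¹ * χ (Subgroup.inclusion hN n * v)) =
      Nat.card V * ((∑ n : N, θ n⁻¹ * χ (Subgroup.inclusion hN n)) * χ v) := by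
    have h4 : (Nat.card V : ℂ) * ∑ n : N, θ n⁻¹ * χ (Subgroup.inclusion hN n * v) =
        ∑ u : V, ∑ n : N, θ n⁻¹ * χ (u * Subgroup.inclusion hN n * u⁻¹ * v) := by
      simp only [h2, Finset.sum_const, Finset.card_univ, Fintype.card_eq_nat_card, nsmul_eq_mul]
    rw [h4, Finset.sum_comm, Finset.mul_sum, Finset.sum_mul, Finset.mul_sum]
    refine Finset.sum_congr rfl fun n _ => ?_
    rw [← Finset.mul_sum, mul_left_comm]
    erw [hχ.sum_conj_mul]
    ring
  rw [mul_left_comm] at h3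
  replace h3 := mul_left_cancel₀ hcard h3
  rw [aboveProj_apply, Pi.smul_apply, hθ.classInner_right, smul_eq_mul]
  have h5 : ∑ n : N, resFun hN χ n * θ n⁻¹ = ∑ n : N, θ n⁻¹ * χ (Subgroup.inclusion hN n) :=
    Finset.sum_congr rfl fun n _ => mul_comm _ _
  rw [h5]
  field_simp
  linear_combination θ 1 * h3

open scoped Classical in
include hθ hinv in
-- The scalar by which e_θ acts is idempotent, hence 0 or 1, and it vanishes exactly when θ does not
-- occur in χ.
theorem aboveProj_irr_eq_ite {χ : V → ℂ} (hχ : IsIrrChar χ) :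
    aboveProj hN θ χ = if χ ∈ irrAbove hN θ then χ else 0 := by
  have h := aboveProj_irr (hN := hN) hθ hinv hχ
  have hχ0 : χ ≠ 0 := fun h0 => hχ.one_ne_zero (congrFun h0 1)
  split_ifs with hm
  · have h1 := aboveProj_aboveProj (hN := hN) hθ χ
    rw [h, map_smul, h, smul_smul] at h1
    have h2 := smul_left_injective ℂ hχ0 h1
    have h3 : θ 1 / χ 1 * classInner (resFun hN χ) θ ≠ 0 :=
      mul_ne_zero (div_ne_zero hθ.one_ne_zero hχ.one_ne_zero) hm.2
    rw [h, mul_right_cancel₀ h3 (h2.trans (one_mul _).symm), one_smul]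
  · have h1 : classInner (resFun hN χ) θ = 0 := by
      by_contra h1
      exact hm ⟨hχ, h1⟩
    rw [h, h1, mul_zero, zero_smul]

include hθ hinv in
-- Turns membership in a span of characters into identities that can be checked by computing in
-- group algebras; all later arguments about class functions use this form.
theorem mem_irrAboveSpan_iff {f : V → ℂ} : f ∈ irrAboveSpan hN θ ↔ IsAbove hN θ f := by
  classical
  constructor
  · intro hf
    refine ⟨mul_comm_of_mem_irrSpan (Submodule.span_mono (fun χ hχ => hχ.1) hf), ?_⟩
    have : irrAboveSpan hN θ ≤ LinearMap.eqLocus (aboveProj hN θ) LinearMap.id := by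
      refine Submodule.span_le.2 fun χ hχ => ?_
      change aboveProj hN θ χ = χ
      rw [aboveProj_irr_eq_ite hθ hinv hχ.1, if_pos hχ]
    exact this hf
  · rintro ⟨h1, h2⟩
    rw [← h2, eq_sum_irr (mem_irrSpan_of_mul_comm h1), map_sum]
    refine Submodule.sum_mem _ fun χ hχ => ?_
    rw [map_smul, aboveProj_irr_eq_ite hθ hinv ((finite_isIrrChar V).mem_toFinset.1 hχ)]
    refine Submodule.smul_mem _ _ ?_
    split_ifs with h
    · exact Submodule.subset_span h
    · exact Submodule.zero_mem _

include hθ hinv in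
-- Taking the part above θ amounts to inserting e_θ, because e_θ keeps or kills each irreducible
-- constituent.
theorem partAbove_eq {γ : V → ℂ} (hγ : γ ∈ irrSpan V) :
    partAbove hN θ γ = aboveProj hN θ γ := by
  classical
  have hfin : (irrAbove hN θ).Finite := (finite_isIrrChar V).subset fun χ hχ => hχ.1
  rw [partAbove, finsum_mem_eq_finite_toFinset_sum _ hfin]
  conv_rhs => rw [eq_sum_irr hγ, map_sum]
  rw [Finset.sum_congr rfl fun χ hχ => show aboveProj hN θ (classInner γ χ • χ) =
    if χ ∈ irrAbove hN θ then classInner γ χ • χ else 0 by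
      rw [map_smul, aboveProj_irr_eq_ite hθ hinv ((finite_isIrrChar V).mem_toFinset.1 hχ),
        smul_ite, smul_zero], ← Finset.sum_filter]
  refine Finset.sum_congr ?_ fun _ _ => rfl
  ext χ
  simp only [Set.Finite.mem_toFinset, Finset.mem_filter, Set.mem_ofPred_eq]
  exact ⟨fun h => ⟨h.1, h⟩, fun h => h.2⟩

theorem classInner_partAbove (γ : V → ℂ) {χ : V → ℂ} (hχ : χ ∈ irrAbove hN θ) :
    classInner (partAbove hN θ γ) χ = classInner γ χ := by
  classical
  have hfin : (irrAbove hN θ).Finite := (finite_isIrrChar V).subset fun χ hχ => hχ.1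
  rw [partAbove, finsum_mem_eq_finite_toFinset_sum _ hfin, ← classInnerₗ_apply, map_sum,
    LinearMap.sum_apply, Finset.sum_eq_single χ, map_smul, LinearMap.smul_apply, classInnerₗ_apply,
    hχ.1.classInner hχ.1, if_pos rfl, smul_eq_mul, mul_one]
  · intro b hb hbχ
    rw [map_smul, LinearMap.smul_apply, classInnerₗ_apply,
      IsIrrChar.classInner (hfin.mem_toFinset.1 hb).1 hχ.1, if_neg hbχ, smul_zero]
  · exact fun h => absurd (hfin.mem_toFinset.2 hχ) h

theorem partAbove_mem (γ : V → ℂ) : partAbove hN θ γ ∈ irrAboveSpan hN θ := by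
  have hfin : (irrAbove hN θ).Finite := (finite_isIrrChar V).subset fun χ hχ => hχ.1
  rw [partAbove, finsum_mem_eq_finite_toFinset_sum _ hfin]
  exact Submodule.sum_mem _ fun χ hχ =>
    Submodule.smul_mem _ _ (Submodule.subset_span (hfin.mem_toFinset.1 hχ))

/-- Elements of `ℂ[Irr(V ∣ θ)]` are determined by their inner products with `Irr(V ∣ θ)`. -/
theorem eq_of_classInner_eq {f g : V → ℂ} (hf : f ∈ irrAboveSpan hN θ)
    (hg : g ∈ irrAboveSpan hN θ) (h : ∀ χ ∈ irrAbove hN θ, classInner f χ = classInner g χ) :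
    f = g := by
  rw [← sub_eq_zero]
  refine classInner_self_eq_zero ?_
  rw [← classInnerₗ_apply]
  have : irrAboveSpan hN θ ≤ LinearMap.ker (classInnerₗ V (f - g)) :=
    Submodule.span_le.2 fun χ hχ => by
      change classInnerₗ V (f - g) χ = 0
      rw [map_sub, LinearMap.sub_apply, classInnerₗ_apply, classInnerₗ_apply, h χ hχ, sub_self]
  exact this (Submodule.sub_mem _ hf hg)

end Above

/-! ### Induced class functions and Frobenius reciprocity -/

section Induction

variable {G : Type*} [Group G] [Finite G] {V W : Subgroup G}

theorem sum_extZero_mul (f : V → ℂ) (a : G → ℂ) (h : V ≤ W) :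
    ∑ w : W, extZero V f w * a w = ∑ v : V, f v * a v := by
  symm
  refine Finset.sum_of_injOn (Subgroup.inclusion h) (Subgroup.inclusion_injective h).injOn
    (fun _ _ => Finset.mem_coe.2 (Finset.mem_univ _)) ?_ ?_
  · intro w _ hw
    rw [extZero_of_notMem, zero_mul]
    intro hv
    exact hw ⟨⟨w, hv⟩, Finset.mem_coe.2 (Finset.mem_univ _), rfl⟩
  · intro v _
    rw [Subgroup.coe_inclusion, extZero_coe]

theorem indFun_apply (f : V → ℂ) (w : W) : indFun V W f w =
    (Nat.card V : ℂ)⁻¹ * ∑ x : W, extZero V f (x * w * (x : G)⁻¹) := by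
  rw [indFun, finsum_eq_sum_of_fintype]
  rfl

theorem indFun_conj (f : V → ℂ) (w u : W) :
    indFun V W f (u * w * u⁻¹) = indFun V W f w := by
  rw [indFun_apply, indFun_apply]
  congr 1
  refine Fintype.sum_equiv (Equiv.mulRight u) _ _ fun x => ?_
  congr 1
  push_cast [Equiv.coe_mulRight]
  group

theorem indFun_mul_comm (f : V → ℂ) (g h : W) :
    indFun V W f (g * h) = indFun V W f (h * g) := by
  rw [← indFun_conj f (h * g) g]
  congr 1
  group

/-- Frobenius reciprocity. -/
theorem classInner_indFun (h : V ≤ W) (f : V → ℂ) {g : W → ℂ} (hg : g ∈ irrSpan W) :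
    classInner (indFun V W f) g = classInner f (resFun h g) := by
  have hcard := natCard_ne_zero' W
  have hconj : ∀ x w : W, g (x * w * x⁻¹) = g w := by
    intro x w
    rw [mul_comm_of_mem_irrSpan hg, inv_mul_cancel_left]
  -- After the substitution w ↦ xwx⁻¹, every x contributes the same sum because g is a class
  -- function.
  have h1 : ∀ x : W, ∑ w : W, extZero V f (x * w * (x : G)⁻¹) * conj (g w) =
      ∑ v : V, f v * conj (resFun h g v) := by
    intro x
    have h2 := sum_extZero_mul f (fun a => extZero W (fun w => conj (g w)) a) h
    have h3 : ∑ v : V, f v * extZero W (fun w => conj (g w)) v =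
        ∑ v : V, f v * conj (resFun h g v) :=
      Finset.sum_congr rfl fun v _ => by rw [extZero_of_mem _ (h v.2)]; rfl
    rw [← h3, ← h2]
    refine Fintype.sum_equiv (MulAut.conj x).toEquiv _ _ fun w => ?_
    simp only [MulEquiv.toEquiv_eq_coe, EquivLike.coe_coe, MulAut.conj_apply,
      Subgroup.coe_mul, Subgroup.coe_inv]
    congr 1
    have h4 := extZero_coe (fun w => conj (g w)) (x * w * x⁻¹)
    push_cast at h4
    rw [h4, hconj]
  rw [classInner_eq, classInner_eq]
  simp only [indFun_apply]
  simp only [mul_assoc (Nat.card V : ℂ)⁻¹, ← Finset.mul_sum]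
  simp only [Finset.sum_mul]
  rw [Finset.sum_comm, Finset.sum_congr rfl fun x _ => h1 x, Finset.sum_const, Finset.card_univ,
    Fintype.card_eq_nat_card, nsmul_eq_mul]
  field_simp

end Induction

/-! ### Averaging identities in group algebras -/

section GroupAlgebra

variable {E : Type*} [Field E] [Algebra E ℂ] {G : Type*} [Group G]

/-- The character `χ`, with values in the subfield `E`. -/
def charVal (E : Type*) [Field E] [Algebra E ℂ] {X : Type*} (χ : X → ℂ) (g : X) : E :=
  Function.invFun (algebraMap E ℂ) (χ g)

theorem algebraMap_charVal {X : Type*} {χ : X → ℂ} (hE : ∀ g, χ g ∈ Set.range (algebraMap E ℂ))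
    (g : X) : algebraMap E ℂ (charVal E χ g) = χ g :=
  Function.invFun_eq (hE g)

theorem charVal_eq_zero {X : Type*} {χ : X → ℂ} (hE : ∀ g, χ g ∈ Set.range (algebraMap E ℂ))
    {g : X} : charVal E χ g = 0 ↔ χ g = 0 := by
  rw [← algebraMap_charVal hE g, map_eq_zero]

theorem charVal_mul_comm {χ : G → ℂ} (hχ : IsIrrChar χ) (g h : G) :
    charVal E χ (g * h) = charVal E χ (h * g) := by
  rw [charVal, charVal, hχ.mul_comm_apply]

theorem charZero_of_algebra (E : Type*) [Field E] [Algebra E ℂ] : CharZero E :=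
  (algebraMap E ℂ).charZero

theorem natCard_ne_zero (E : Type*) [Field E] [Algebra E ℂ] (G : Type*) [Group G] [Finite G] :
    (Nat.card G : E) ≠ 0 := by
  have := charZero_of_algebra E
  exact_mod_cast Nat.card_pos.ne'

omit [Algebra E ℂ] in
theorem linFun_mul_comm {M : Type*} [AddCommGroup M] [Module E M] {f : G → M}
    (hf : ∀ g h, f (g * h) = f (h * g)) (a b : MonoidAlgebra E G) :
    linFun E f (a * b) = linFun E f (b * a) := by
  induction a using MonoidAlgebra.induction_on with
  | of g =>
    induction b using MonoidAlgebra.induction_on with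
    | of h => rw [← map_mul, ← map_mul, linFun_of, linFun_of, hf]
    | add a b ha hb => rw [mul_add, add_mul, map_add, map_add, ha, hb]
    | smul r a ha => rw [mul_smul_comm, smul_mul_assoc, map_smul, map_smul, ha]
  | add a b ha hb => rw [mul_add, add_mul, map_add, map_add, ha, hb]
  | smul r a ha => rw [mul_smul_comm, smul_mul_assoc, map_smul, map_smul, ha]

variable [Finite G]

omit [Algebra E ℂ] in
theorem eq_sum_coeff (a : MonoidAlgebra E G) : a = ∑ g : G, a.coeff g • MonoidAlgebra.of E G g := by
  have h : linFun E (MonoidAlgebra.of E G) a = a := by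
    induction a using MonoidAlgebra.induction_on with
    | of g => rw [linFun_of]
    | add a b ha hb => rw [map_add, ha, hb]
    | smul r a ha => rw [map_smul, ha]
  conv_lhs => rw [← h, linFun_apply]

variable {χ : G → ℂ} (hχ : IsIrrChar χ) (hE : ∀ g, χ g ∈ Set.range (algebraMap E ℂ))

include hE in
theorem charIdem_eq_sum : charIdem E χ =
    (charVal E χ 1 / Nat.card G) • ∑ g : G, charVal E χ g⁻¹ • MonoidAlgebra.of E G g := by
  rw [eq_sum_coeff (charIdem E χ), Finset.smul_sum]
  refine Finset.sum_congr rfl fun g _ => ?_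
  rw [smul_smul]
  congr 1
  refine (algebraMap E ℂ).injective ?_
  rw [algebraMap_coeff_charIdem hE, map_mul, map_div₀, algebraMap_charVal hE, algebraMap_charVal hE,
    map_natCast]

omit [Finite G] in
include hχ hE in
theorem charVal_one_ne_zero : charVal E χ 1 ≠ 0 :=
  fun h => hχ.one_ne_zero ((charVal_eq_zero hE).1 h)

include hχ hE in
theorem sum_charVal_smul_of : ∑ g : G, charVal E χ g⁻¹ • MonoidAlgebra.of E G g =
    ((Nat.card G : E) / charVal E χ 1) • charIdem E χ := by
  have h1 := charVal_one_ne_zero hχ hE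
  have h2 := natCard_ne_zero E G
  rw [charIdem_eq_sum hE, smul_smul, div_mul_div_cancel₀ h1, div_self h2, one_smul]

include hχ hE in
/-- The coefficients of `a e_χ` in terms of the character. -/
theorem sum_linFun_smul_of (a : MonoidAlgebra E G) :
    ∑ g : G, linFun E (charVal E χ) (a * MonoidAlgebra.of E G g⁻¹) • MonoidAlgebra.of E G g =
      ((Nat.card G : E) / charVal E χ 1) • (a * charIdem E χ) := by
  induction a using MonoidAlgebra.induction_on with
  | of x =>
    rw [← mul_smul_comm, ← sum_charVal_smul_of hχ hE, Finset.mul_sum]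
    refine Fintype.sum_equiv (Equiv.mulLeft x⁻¹) _ _ fun g => ?_
    rw [← map_mul, linFun_of, Equiv.coe_mulLeft, mul_smul_comm, ← map_mul, mul_inv_cancel_left,
      mul_inv_rev, inv_inv, charVal_mul_comm hχ]
  | add a b ha hb =>
    simp only [add_mul, map_add, add_smul, Finset.sum_add_distrib, ha, hb, smul_add]
  | smul r a ha =>
    simp only [smul_mul_assoc, map_smul, smul_eq_mul, mul_smul, ← Finset.smul_sum, ha]
    rw [smul_comm]

include hχ hE in
/-- Averaging over the group in `E G e_χ`. -/
theorem sum_conj_mul_charIdem (a : MonoidAlgebra E G) :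
    ∑ g : G, MonoidAlgebra.of E G g * a * MonoidAlgebra.of E G g⁻¹ * charIdem E χ =
      ((Nat.card G : E) / charVal E χ 1 * linFun E (charVal E χ) a) • charIdem E χ := by
  have h1 := charVal_one_ne_zero hχ hE
  have h2 := natCard_ne_zero E G
  induction a using MonoidAlgebra.induction_on with
  | of x =>
    -- Written out in coefficients, each conjugate of x times e_χ involves only values of χ. The sum
    -- over g is then the product formula, which is verified after embedding E into the complex
    -- numbers.
    have h3 : ∀ g : G, MonoidAlgebra.of E G g * MonoidAlgebra.of E G x *
        MonoidAlgebra.of E G g⁻¹ * charIdem E χ = ((Nat.card G : E) / charVal E χ 1)⁻¹ •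
          ∑ u : G, charVal E χ (g * x * g⁻¹ * u⁻¹) • MonoidAlgebra.of E G u := by
      intro g
      have h4 := sum_linFun_smul_of hχ hE (MonoidAlgebra.of E G (g * x * g⁻¹))
      simp only [← map_mul, linFun_of] at h4 ⊢
      rw [h4, smul_smul, inv_mul_cancel₀ (div_ne_zero h2 h1), one_smul]
    simp only [h3, ← Finset.smul_sum]
    rw [Finset.sum_comm]
    simp only [← Finset.sum_smul]
    have h5 : ∀ u : G, ∑ g : G, charVal E χ (g * x * g⁻¹ * u⁻¹) =
        (Nat.card G : E) / charVal E χ 1 * (charVal E χ x * charVal E χ u⁻¹) := by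
      intro u
      refine (algebraMap E ℂ).injective ?_
      have h6 := hχ.sum_conj_mul x u⁻¹
      rw [map_sum, map_mul, map_div₀, map_mul, map_natCast]
      simp only [algebraMap_charVal hE]
      rw [div_mul_eq_mul_div, eq_div_iff hχ.one_ne_zero, mul_comm, h6]
    simp only [h5, ← mul_assoc, mul_smul]
    rw [← Finset.smul_sum, ← Finset.smul_sum, sum_charVal_smul_of hχ hE, linFun_of, smul_smul,
      inv_mul_cancel₀ (div_ne_zero h2 h1), one_smul, smul_comm]
  | add a b ha hb =>
    simp only [mul_add, add_mul, Finset.sum_add_distrib, ha, hb, map_add, add_smul]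
  | smul r a ha =>
    simp only [mul_smul_comm, smul_mul_assoc, ← Finset.smul_sum, ha, map_smul, smul_smul]
    congr 1

end GroupAlgebra

/-! ### Group algebras of subgroups inside F G -/

section SubgroupAlgebra

variable {G : Type*} [Group G] {F : Subfield ℂ} {V : Subgroup G}

local notation "δ" => MonoidAlgebra.of F G

-- The algebras of all subgroups live in the one algebra FG, so that elements of K, H and U can be
-- multiplied with each other. This principle reduces linear statements about FV to group elements
-- of V.
@[elab_as_elim]
theorem subgroupAlg_induction {p : ∀ a : MonoidAlgebra F G, a ∈ subgroupAlg F V → Prop}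
    (hof : ∀ v : V, p (δ v) (of_mem_subgroupAlg F v))
    (hadd : ∀ a b ha hb, p a ha → p b hb → p (a + b) (add_mem ha hb))
    (hsmul : ∀ (r : F) a ha, p a ha → p (r • a) (Subalgebra.smul_mem _ ha r))
    {a : MonoidAlgebra F G} (ha : a ∈ subgroupAlg F V) : p a ha := by
  obtain ⟨b, rfl⟩ := ha
  suffices h : ∃ h, p (MonoidAlgebra.mapDomainAlgHom F F V.subtype b) h from h.2
  induction b using MonoidAlgebra.induction_on with
  | of v =>
    have h := hof v
    have h1 : δ (v : G) = MonoidAlgebra.mapDomainAlgHom F F V.subtype (MonoidAlgebra.of F V v) :=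
      MonoidAlgebra.mapDomain_single.symm
    exact ⟨h1 ▸ of_mem_subgroupAlg F v, by simpa only [h1] using h⟩
  | add a b ha hb =>
    rw [map_add]
    exact ⟨_, hadd _ _ _ _ ha.2 hb.2⟩
  | smul r a ha =>
    rw [map_smul]
    exact ⟨_, hsmul _ _ _ ha.2⟩

theorem subgroupAlg_mono {V W : Subgroup G} (h : V ≤ W) {a : MonoidAlgebra F G}
    (ha : a ∈ subgroupAlg F V) : a ∈ subgroupAlg F W := by
  induction ha using subgroupAlg_induction with
  | hof v => exact of_mem_subgroupAlg F (⟨v, h v.2⟩ : W)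
  | hadd a b _ _ ha hb => exact add_mem ha hb
  | hsmul r a _ ha => exact Subalgebra.smul_mem _ ha r

theorem subIdem_mem [Finite G] (χ : V → ℂ) : subIdem F χ ∈ subgroupAlg F V := ⟨_, rfl⟩

theorem mapDomain_of (v : V) :
    MonoidAlgebra.mapDomainAlgHom F F V.subtype (MonoidAlgebra.of F V v) = δ v :=
  MonoidAlgebra.mapDomain_single

variable {M : Type*} [AddCommGroup M] [Module F M]

theorem linFun_extZero_mapDomain (f : V → M) (a : MonoidAlgebra F V) :
    linFun F (extZero V f) (MonoidAlgebra.mapDomainAlgHom F F V.subtype a) = linFun F f a := by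
  induction a using MonoidAlgebra.induction_on with
  | of v => rw [mapDomain_of, linFun_of, linFun_of, extZero_coe]
  | add a b ha hb => rw [map_add, map_add, map_add, ha, hb]
  | smul r a ha => rw [map_smul, map_smul, map_smul, ha]

/-- The linear extension of a class function of `V` is invariant under conjugation by `V`. -/
theorem linFun_extZero_mul_comm {f : V → M} (hf : ∀ g h, f (g * h) = f (h * g))
    {a : MonoidAlgebra F G} (ha : a ∈ subgroupAlg F V) (b : MonoidAlgebra F G) :
    linFun F (extZero V f) (a * b) = linFun F (extZero V f) (b * a) := by
  induction ha using subgroupAlg_induction with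
  | hof v =>
    induction b using MonoidAlgebra.induction_on with
    | of g =>
      rw [← map_mul, ← map_mul, linFun_of, linFun_of]
      by_cases hg : g ∈ V
      · rw [extZero_of_mem _ (V.mul_mem v.2 hg), extZero_of_mem _ (V.mul_mem hg v.2)]
        exact hf v ⟨g, hg⟩
      · rw [extZero_of_notMem, extZero_of_notMem]
        · exact fun h => hg ((V.mul_mem_cancel_right v.2).1 h)
        · exact fun h => hg ((V.mul_mem_cancel_left v.2).1 h)
    | add a b ha hb => rw [mul_add, add_mul, map_add, map_add, ha, hb]
    | smul r a ha => rw [mul_smul_comm, smul_mul_assoc, map_smul, map_smul, ha]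
  | hadd a b _ _ ha hb => rw [mul_add, add_mul, map_add, map_add, ha, hb]
  | hsmul r a _ ha => rw [mul_smul_comm, smul_mul_assoc, map_smul, map_smul, ha]

variable [Finite G]

theorem linExt_eq (f : V → ℂ) (x : MonoidAlgebra F G) :
    linExt f x = linFun F (extZero V f) x := by
  rw [linExt, finsum_eq_sum_of_fintype, linFun_apply]
  refine Finset.sum_of_injOn Subtype.val Subtype.val_injective.injOn
    (fun _ _ => Finset.mem_coe.2 (Finset.mem_univ _)) ?_ ?_
  · intro g _ hg
    rw [extZero_of_notMem, smul_zero]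
    exact fun h => hg ⟨⟨g, h⟩, Finset.mem_coe.2 (Finset.mem_univ _), rfl⟩
  · intro v _
    rw [extZero_coe]
    rfl

theorem mem_range_of_mem {X : Type*} {χ : X → ℂ} (hF : ∀ v, χ v ∈ F) (v : X) :
    χ v ∈ Set.range (algebraMap F ℂ) := ⟨⟨χ v, hF v⟩, rfl⟩

theorem subIdem_eq_sum {χ : V → ℂ} (hF : ∀ v, χ v ∈ F) : subIdem F χ =
    (charVal F χ 1 / Nat.card V) • ∑ v : V, charVal F χ v⁻¹ • δ v := by
  rw [subIdem, charIdem_eq_sum (mem_range_of_mem hF), map_smul, map_sum]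
  simp only [map_smul, mapDomain_of]

/-- No membership of a is needed: for g outside V all elements ng with n in N are outside V too, and
both sides vanish. -/
theorem linFun_subIdem_mul {N : Subgroup G} (hN : N ≤ V) {θ : N → ℂ} (hF : ∀ n, θ n ∈ F)
    {f : V → ℂ} (hf : IsAbove hN θ f) (a : MonoidAlgebra F G) :
    linFun F (extZero V f) (subIdem F θ * a) = linFun F (extZero V f) a := by
  induction a using MonoidAlgebra.induction_on with
  | of g =>
    simp only [subIdem_eq_sum hF, smul_mul_assoc, Finset.sum_mul, ← map_mul, map_smul, map_sum,
      linFun_of]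
    by_cases hg : g ∈ V
    · have h := congrFun hf.2 ⟨g, hg⟩
      rw [aboveProj_apply] at h
      rw [extZero_of_mem _ hg, ← h, Subfield.smul_def, smul_eq_mul]
      have h1 := algebraMap_charVal (mem_range_of_mem hF)
      congr 1
      · push_cast
        exact congrArg (· / _) (h1 1)
      · refine Finset.sum_congr rfl fun n _ => ?_
        rw [extZero_of_mem _ (V.mul_mem (hN n.2) hg), Subfield.smul_def, smul_eq_mul]
        exact congrArg (· * _) (h1 n⁻¹)
    · rw [extZero_of_notMem _ hg, Finset.sum_eq_zero, smul_zero]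
      intro n _
      rw [extZero_of_notMem, smul_zero]
      exact fun h => hg ((V.mul_mem_cancel_left (hN n.2)).1 h)
  | add a b ha hb => rw [mul_add, map_add, map_add, ha, hb]
  | smul r a ha => rw [mul_smul_comm, map_smul, map_smul, ha]

variable {χ : V → ℂ} (hχ : IsIrrChar χ) (hF : ∀ v, χ v ∈ F)

include hχ hF in
theorem subgroup_sum_charVal_smul_of : ∑ v : V, charVal F χ v⁻¹ • δ v =
    ((Nat.card V : F) / charVal F χ 1) • subIdem F χ := by
  have h := congrArg (MonoidAlgebra.mapDomainAlgHom F F V.subtype)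
    (sum_charVal_smul_of hχ (mem_range_of_mem hF))
  simp only [map_sum, map_smul, mapDomain_of] at h
  exact h

include hχ hF in
theorem subgroup_sum_linFun_smul_of {a : MonoidAlgebra F G} (ha : a ∈ subgroupAlg F V) :
    ∑ v : V, linFun F (extZero V (charVal F χ)) (a * δ (v : G)⁻¹) • δ v =
      ((Nat.card V : F) / charVal F χ 1) • (a * subIdem F χ) := by
  obtain ⟨b, rfl⟩ := ha
  have h := congrArg (MonoidAlgebra.mapDomainAlgHom F F V.subtype)
    (sum_linFun_smul_of hχ (mem_range_of_mem hF) b)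
  simp only [map_sum, map_smul, mapDomain_of, map_mul] at h
  rw [subIdem]
  refine Eq.trans (Finset.sum_congr rfl fun v _ => ?_) h
  rw [← linFun_extZero_mapDomain, map_mul (MonoidAlgebra.mapDomainAlgHom F F V.subtype),
    mapDomain_of]
  rfl

include hχ hF in
theorem subgroup_sum_conj {a : MonoidAlgebra F G} (ha : a ∈ subgroupAlg F V) :
    (∑ v : V, δ v * a * δ (v : G)⁻¹) * subIdem F χ =
      ((Nat.card V : F) / charVal F χ 1 * linFun F (extZero V (charVal F χ)) a) •
        subIdem F χ := by
  obtain ⟨b, rfl⟩ := ha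
  have h := congrArg (MonoidAlgebra.mapDomainAlgHom F F V.subtype)
    (sum_conj_mul_charIdem hχ (mem_range_of_mem hF) b)
  simp only [map_sum, map_smul, mapDomain_of, map_mul] at h
  change _ = (_ * linFun F _ (MonoidAlgebra.mapDomainAlgHom F F V.subtype b)) • _
  rw [linFun_extZero_mapDomain, subIdem, ← h, Finset.sum_mul]
  rfl

omit [Finite G] in
theorem coe_linFun_charVal {χ : V → ℂ} (hF : ∀ v, χ v ∈ F) (a : MonoidAlgebra F G) :
    ((linFun F (extZero V (charVal F χ)) a : F) : ℂ) = linFun F (extZero V χ) a := by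
  induction a using MonoidAlgebra.induction_on with
  | of g =>
    rw [linFun_of, linFun_of]
    by_cases hg : g ∈ V
    · rw [extZero_of_mem _ hg, extZero_of_mem _ hg]
      exact algebraMap_charVal (mem_range_of_mem hF) _
    · rw [extZero_of_notMem _ hg, extZero_of_notMem _ hg]
      rfl
  | add a b ha hb => rw [map_add, map_add, Subfield.coe_add, ha, hb]
  | smul r a ha => rw [map_smul, map_smul, smul_eq_mul, Subfield.coe_mul, ha]; rfl

end SubgroupAlgebra

/-! ### The algebra `S` -/

section Magic

variable {G : Type*} [Group G] [Finite G] {F : Subfield ℂ} {H K : Subgroup G} [hK : K.Normal]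
  {θ : K → ℂ} {φ : ↥(H ⊓ K) → ℂ}

local notation "δ" => MonoidAlgebra.of F G

omit [Finite G] in
theorem of_mul_of_inv (g : G) : δ g * δ g⁻¹ = 1 := by rw [← map_mul, mul_inv_cancel, map_one]

omit [Finite G] in
theorem of_inv_mul_of (g : G) : δ g⁻¹ * δ g = 1 := by rw [← map_mul, inv_mul_cancel, map_one]

/-- A class function on `V` that is invariant under `g` gives an idempotent that commutes
with `g`. -/
theorem of_mul_subIdem {V : Subgroup G} {χ : V → ℂ} (hF : ∀ v, χ v ∈ F) (g : G)
    (h : ∀ v : V, ∃ hv : g * v * g⁻¹ ∈ V, χ ⟨g * v * g⁻¹, hv⟩ = χ v) :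
    δ g * subIdem F χ = subIdem F χ * δ g := by
  choose h h' using h
  let e : V → V := fun n => ⟨g * n * g⁻¹, h n⟩
  have hinj : Function.Injective e := by
    intro a b hab
    have h1 := congrArg Subtype.val hab
    simp only [e] at h1
    exact Subtype.ext (by simpa using h1)
  rw [subIdem_eq_sum hF, mul_smul_comm, smul_mul_assoc, Finset.mul_sum, Finset.sum_mul]
  congr 1
  refine Fintype.sum_equiv (Equiv.ofBijective e (Finite.injective_iff_bijective.1 hinj)) _ _
    fun n => ?_
  rw [Equiv.ofBijective_apply, mul_smul_comm, smul_mul_assoc, ← map_mul, ← map_mul]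
  congr 1
  · rw [charVal, charVal, ← h' n⁻¹]
    congr 2
    refine Subtype.ext ?_
    simp [e, mul_assoc]
  · simp [e]

namespace BasicConfig

variable (hB : BasicConfig F H K θ φ)

include hB

/-- G = HK, where H fixes θ by hypothesis and K because θ is a class function. This makes e_θ
central in all of FG. -/
theorem invariant_θ (g : G) (k : K) : θ ⟨g * k * g⁻¹, hK.conj_mem k k.2 g⟩ = θ k := by
  obtain ⟨h, hh, x, hx, rfl⟩ := hB.exists_mul g
  have h1 := hB.inv_θ h hh (⟨x, hx⟩ * k * ⟨x, hx⟩⁻¹)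
  rw [hB.irr_θ.conj_eq] at h1
  rw [← h1]
  congr 1
  refine Subtype.ext ?_
  simp [mul_assoc]

theorem of_mul_idem_θ (g : G) : δ g * subIdem F θ = subIdem F θ * δ g :=
  of_mul_subIdem hB.val_θ g fun k => ⟨_, hB.invariant_θ g k⟩

theorem idem_θ_central (a : MonoidAlgebra F G) : a * subIdem F θ = subIdem F θ * a := by
  induction a using MonoidAlgebra.induction_on with
  | of g => exact hB.of_mul_idem_θ g
  | add a b ha hb => rw [add_mul, mul_add, ha, hb]
  | smul r a ha => rw [smul_mul_assoc, mul_smul_comm, ha]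

theorem of_mul_idem_φ {h : G} (hh : h ∈ H) : δ h * subIdem F φ = subIdem F φ * δ h :=
  of_mul_subIdem hB.val_φ h fun l => ⟨_, hB.inv_φ h hh l⟩

theorem of_mul_idem {h : G} (hh : h ∈ H) :
    δ h * magicIdem F θ φ = magicIdem F θ φ * δ h := by
  rw [magicIdem, ← mul_assoc, hB.of_mul_idem_φ hh, mul_assoc, hB.of_mul_idem_θ, mul_assoc]

theorem idem_φ_mul_idem : subIdem F φ * magicIdem F θ φ = magicIdem F θ φ := by
  rw [magicIdem, ← mul_assoc, subIdem_idem hB.irr_φ hB.val_φ]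

theorem idem_θ_mul_idem : subIdem F θ * magicIdem F θ φ = magicIdem F θ φ := by
  rw [← hB.idem_θ_central, magicIdem, mul_assoc, subIdem_idem hB.irr_θ hB.val_θ]

omit hB hK in
theorem idem_mem : magicIdem F θ φ ∈ subgroupAlg F K :=
  mul_mem (subIdem_mem_of_le inf_le_right φ) (subIdem_mem θ)

end BasicConfig

/-- The linear extension of `θ`, by zero outside of `K`, with values in `F`. -/
def thetaTr (F : Subfield ℂ) (θ : K → ℂ) : MonoidAlgebra F G →ₗ[F] F :=
  linFun F (extZero K (charVal F θ))

/-- The reduced trace `θ(s)/φ(1)` of `S`, as a function on the whole group algebra. -/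
def magicTr (F : Subfield ℂ) (θ : K → ℂ) (φ : ↥(H ⊓ K) → ℂ) : MonoidAlgebra F G →ₗ[F] F :=
  (charVal F φ 1)⁻¹ • thetaTr F θ

section

variable (hB : BasicConfig F H K θ φ)

include hB

theorem BasicConfig.θ_ne : charVal F θ 1 ≠ 0 :=
  charVal_one_ne_zero hB.irr_θ (mem_range_of_mem hB.val_θ)

theorem BasicConfig.φ_ne : charVal F φ 1 ≠ 0 :=
  charVal_one_ne_zero hB.irr_φ (mem_range_of_mem hB.val_φ)

theorem thetaTr_eq (a : MonoidAlgebra F G) : thetaTr F θ a = charVal F φ 1 * magicTr F θ φ a := by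
  rw [magicTr, LinearMap.smul_apply, smul_eq_mul, mul_inv_cancel_left₀ hB.φ_ne]

theorem thetaTr_mul_comm {a : MonoidAlgebra F G} (ha : a ∈ subgroupAlg F K)
    (b : MonoidAlgebra F G) : thetaTr F θ (a * b) = thetaTr F θ (b * a) :=
  linFun_extZero_mul_comm (charVal_mul_comm hB.irr_θ) ha b

theorem magicTr_mul_comm {a : MonoidAlgebra F G} (ha : a ∈ subgroupAlg F K)
    (b : MonoidAlgebra F G) : magicTr F θ φ (a * b) = magicTr F θ φ (b * a) := by
  rw [magicTr, LinearMap.smul_apply, LinearMap.smul_apply, thetaTr_mul_comm hB ha]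

omit hK hB in
theorem isAbove_self {N : Subgroup G} {χ : N → ℂ} (hχ : IsIrrChar χ) :
    IsAbove (le_refl N) χ χ := by
  refine (mem_irrAboveSpan_iff hχ fun v hv n => ?_).1 (Submodule.subset_span ⟨hχ, ?_⟩)
  · exact ⟨N.mul_mem (N.mul_mem hv n.2) (N.inv_mem hv), hχ.conj_eq n ⟨v, hv⟩⟩
  · change classInner χ χ ≠ 0
    rw [hχ.classInner hχ, if_pos rfl]
    exact one_ne_zero

theorem thetaTr_idem_mul (a : MonoidAlgebra F G) :
    thetaTr F θ (subIdem F θ * a) = thetaTr F θ a := by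
  refine Subtype.ext ?_
  rw [thetaTr, coe_linFun_charVal hB.val_θ, coe_linFun_charVal hB.val_θ]
  exact linFun_subIdem_mul le_rfl hB.val_θ (isAbove_self hB.irr_θ) a

end

/-- The projection of `F K` onto `S`. -/
def magicProj (F : Subfield ℂ) (θ : K → ℂ) (φ : ↥(H ⊓ K) → ℂ) :
    MonoidAlgebra F G →ₗ[F] MonoidAlgebra F G :=
  (Nat.card ↥(H ⊓ K) : F)⁻¹ • ∑ l : ↥(H ⊓ K),
    LinearMap.mulLeftRight F (MonoidAlgebra.of F G (l : G) * magicIdem F θ φ,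
      magicIdem F θ φ * MonoidAlgebra.of F G (l : G)⁻¹)

omit hK in
theorem magicProj_apply (a : MonoidAlgebra F G) : magicProj F θ φ a =
    (Nat.card ↥(H ⊓ K) : F)⁻¹ • ∑ l : ↥(H ⊓ K),
      δ (l : G) * (magicIdem F θ φ * a * magicIdem F θ φ) * δ (l : G)⁻¹ := by
  simp only [magicProj, LinearMap.smul_apply, LinearMap.sum_apply, LinearMap.mulLeftRight_apply,
    mul_assoc]

section

variable (hB : BasicConfig F H K θ φ) {s : MonoidAlgebra F G} (hs : s ∈ magicSub F θ φ)

omit hK in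
theorem mem_subgroupAlg_of_mem_magicSub (hs : s ∈ magicSub F θ φ) : s ∈ subgroupAlg F K := by
  obtain ⟨⟨a, ha, rfl⟩, -⟩ := hs
  exact mul_mem (mul_mem BasicConfig.idem_mem ha) BasicConfig.idem_mem

include hB hs in
theorem idem_mul_of_mem_magicSub : magicIdem F θ φ * s = s := (hB.unit.2 s hs).1

include hB hs in
theorem mul_idem_of_mem_magicSub : s * magicIdem F θ φ = s := (hB.unit.2 s hs).2

omit hK in
include hs in
theorem of_mul_of_mem_magicSub {l : G} (hl : l ∈ H ⊓ K) : δ l * s = s * δ l := hs.2 ⟨l, hl⟩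

include hB in
theorem magicProj_mem {a : MonoidAlgebra F G} (ha : a ∈ subgroupAlg F K) :
    magicProj F θ φ a ∈ magicSub F θ φ := by
  have hmem : magicProj F θ φ a ∈ subgroupAlg F K := by
    rw [magicProj_apply]
    refine Subalgebra.smul_mem _ (sum_mem fun l _ => ?_) _
    have h1 : δ (l : G) ∈ subgroupAlg F K := of_mem_subgroupAlg F (⟨l, l.2.2⟩ : K)
    have h2 : δ (l : G)⁻¹ ∈ subgroupAlg F K := of_mem_subgroupAlg F (⟨l, l.2.2⟩ : K)⁻¹
    exact mul_mem (mul_mem h1 (mul_mem (mul_mem BasicConfig.idem_mem ha) BasicConfig.idem_mem)) h2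
  refine ⟨⟨magicProj F θ φ a, hmem, ?_⟩, fun x => ?_⟩
  · have h1 : ∀ l : ↥(H ⊓ K), magicIdem F θ φ * (δ (l : G) *
        (magicIdem F θ φ * a * magicIdem F θ φ) * δ (l : G)⁻¹) * magicIdem F θ φ =
        δ (l : G) * (magicIdem F θ φ * a * magicIdem F θ φ) * δ (l : G)⁻¹ := by
      intro l
      have h1 := hB.idem_comm l
      have h2 := hB.idem_comm l⁻¹
      have h3 := hB.idem
      rw [Subgroup.coe_inv] at h2
      calc _ = (magicIdem F θ φ * δ (l : G)) * (magicIdem F θ φ * a * magicIdem F θ φ) *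
            (δ (l : G)⁻¹ * magicIdem F θ φ) := by simp only [mul_assoc]
        _ = δ (l : G) * (magicIdem F θ φ * magicIdem F θ φ * a *
            (magicIdem F θ φ * magicIdem F θ φ)) * δ (l : G)⁻¹ := by
          rw [← h1, h2]; simp only [mul_assoc]
        _ = _ := by rw [h3]
    rw [magicProj_apply, mul_smul_comm, smul_mul_assoc, Finset.mul_sum, Finset.sum_mul,
      Finset.sum_congr rfl fun l _ => h1 l]
  · have h1 : ∀ l : ↥(H ⊓ K), δ (x : G) * (δ (l : G) * (magicIdem F θ φ * a * magicIdem F θ φ) *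
        δ (l : G)⁻¹) = δ ((x * l : ↥(H ⊓ K)) : G) * (magicIdem F θ φ * a * magicIdem F θ φ) *
          δ ((x * l : ↥(H ⊓ K)) : G)⁻¹ * δ (x : G) := by
      intro l
      rw [Subgroup.coe_mul, mul_inv_rev, map_mul, map_mul]
      simp only [mul_assoc, of_inv_mul_of, mul_one]
    rw [magicProj_apply, mul_smul_comm, smul_mul_assoc, Finset.mul_sum, Finset.sum_mul,
      Finset.sum_congr rfl fun l _ => h1 l]
    exact congrArg _ (Fintype.sum_equiv (Equiv.mulLeft x) _ _ fun l => rfl)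

include hB hs in
theorem magicProj_of_mem : magicProj F θ φ s = s := by
  have hcard := natCard_ne_zero F ↥(H ⊓ K)
  have h1 : ∀ l : ↥(H ⊓ K), δ (l : G) * s * δ (l : G)⁻¹ = s := fun l => by
    rw [of_mul_of_mem_magicSub hs l.2, mul_assoc, of_mul_of_inv, mul_one]
  rw [magicProj_apply, idem_mul_of_mem_magicSub hB hs, mul_idem_of_mem_magicSub hB hs]
  simp only [h1]
  rw [Finset.sum_const, Finset.card_univ, Fintype.card_eq_nat_card, ← Nat.cast_smul_eq_nsmul F,
    smul_smul, inv_mul_cancel₀ hcard, one_smul]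

include hB hs in
/-- On `L`, the functional `l ↦ θ(s l)` is a multiple of `φ`. -/
theorem magicTr_mul_of (l : ↥(H ⊓ K)) :
    thetaTr F θ (s * δ (l : G)) = magicTr F θ φ s * charVal F φ l := by
  have hcard := natCard_ne_zero F ↥(H ⊓ K)
  have hsK := mem_subgroupAlg_of_mem_magicSub hs
  have hsφ : subIdem F φ * s = s := by
    rw [← idem_mul_of_mem_magicSub hB hs, ← mul_assoc, hB.idem_φ_mul_idem]
  -- As s commutes with L and absorbs e_φ, the element l may be replaced by the average of its
  -- L-conjugates times e_φ, which Schur's lemma identifies with the scalar φ(l)/φ(1).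
  have h1 : ∀ m : ↥(H ⊓ K), thetaTr F θ (δ (m : G) * δ (l : G) * δ (m : G)⁻¹ * subIdem F φ * s) =
      thetaTr F θ (s * δ (l : G)) := by
    intro m
    have hm := of_mem_subgroupAlg F (⟨m, m.2.2⟩ : K)
    change δ (m : G) ∈ _ at hm
    have hm' := of_mem_subgroupAlg F (⟨m, m.2.2⟩ : K)⁻¹
    change δ (m : G)⁻¹ ∈ _ at hm'
    rw [mul_assoc _ _ s, hsφ, mul_assoc, mul_assoc, thetaTr_mul_comm hB hm, mul_assoc, mul_assoc,
      ← of_mul_of_mem_magicSub hs m.2, ← mul_assoc (δ (m : G)⁻¹), of_inv_mul_of, one_mul,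
      thetaTr_mul_comm hB (mem_subgroupAlg_of_mem_magicSub hs)]
  have h2 := subgroup_sum_conj hB.irr_φ hB.val_φ (of_mem_subgroupAlg F l)
  have h3 := congrArg (fun a => thetaTr F θ (a * s)) h2
  simp only [Finset.sum_mul, map_sum, h1, smul_mul_assoc, map_smul, hsφ, linFun_of, extZero_coe,
    Finset.sum_const, Finset.card_univ, Fintype.card_eq_nat_card, nsmul_eq_mul, smul_eq_mul] at h3
  refine mul_left_cancel₀ hcard (h3.trans ?_)
  rw [thetaTr_eq hB]
  have := hB.φ_ne
  field_simp

include hB in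
theorem sum_charVal_of_mul_idem : ∑ l : ↥(H ⊓ K), charVal F φ l⁻¹ • (δ (l : G) * magicIdem F θ φ) =
    ((Nat.card ↥(H ⊓ K) : F) / charVal F φ 1) • magicIdem F θ φ := by
  have h := congrArg (· * magicIdem F θ φ) (subgroup_sum_charVal_smul_of hB.irr_φ hB.val_φ)
  simpa only [Finset.sum_mul, smul_mul_assoc, hB.idem_φ_mul_idem] using h

include hB hs in
/-- The Casimir element of `S`, first form. -/
theorem sum_magicProj_mul_mul : ∑ k : K, magicProj F θ φ (δ (k : G)) * s *
      (magicIdem F θ φ * δ (k : G)⁻¹ * magicIdem F θ φ) =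
    ((Nat.card K : F) / (charVal F θ 1 * charVal F φ 1) * magicTr F θ φ s) • magicIdem F θ φ := by
  have hcard := natCard_ne_zero F ↥(H ⊓ K)
  have hsi := idem_mul_of_mem_magicSub hB hs
  have his := mul_idem_of_mem_magicSub hB hs
  have hii := hB.idem
  -- The contribution of one m to the average defining the projection. Schur's lemma for θ, applied
  -- to s m⁻¹, produces θ(s m⁻¹) = tr(s)φ(m⁻¹); summing over m then recovers e_φ, which i absorbs.
  have h1 : ∀ m : ↥(H ⊓ K), ∑ k : K, δ (m : G) * (magicIdem F θ φ * δ (k : G) * magicIdem F θ φ) *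
      δ (m : G)⁻¹ * s * (magicIdem F θ φ * δ (k : G)⁻¹ * magicIdem F θ φ) =
      ((Nat.card K : F) / charVal F θ 1 * (magicTr F θ φ s * charVal F φ m⁻¹)) •
        (δ (m : G) * magicIdem F θ φ) := by
    intro m
    have hc := hB.idem_comm m
    have hc' := hB.idem_comm m⁻¹
    rw [Subgroup.coe_inv] at hc'
    have hK' : δ (m : G)⁻¹ ∈ subgroupAlg F K := of_mem_subgroupAlg F (⟨m, m.2.2⟩ : K)⁻¹
    have hsm := of_mul_of_mem_magicSub hs (inv_mem m.2)
    have h2 := subgroup_sum_conj hB.irr_θ hB.val_θ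
      (mul_mem (mem_subgroupAlg_of_mem_magicSub hs) hK')
    have h4 := magicTr_mul_of hB hs m⁻¹
    rw [Subgroup.coe_inv] at h4
    have h3 : magicIdem F θ φ * ((∑ k : K, δ (k : G) * (s * δ (m : G)⁻¹) * δ (k : G)⁻¹) *
        (magicIdem F θ φ * δ (m : G))) = ((Nat.card K : F) / charVal F θ 1 *
          (magicTr F θ φ s * charVal F φ m⁻¹)) • (δ (m : G) * magicIdem F θ φ) := by
      rw [← h4]
      have h5 := congrArg (fun a => magicIdem F θ φ * (a * (magicIdem F θ φ * δ (m : G)))) h2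
      rw [mul_assoc _ (subIdem F θ), ← mul_assoc (subIdem F θ), hB.idem_θ_mul_idem,
        smul_mul_assoc, mul_smul_comm, ← mul_assoc (subIdem F θ), hB.idem_θ_mul_idem,
        ← mul_assoc (magicIdem F θ φ) (magicIdem F θ φ), hii, ← hc] at h5
      rw [← hc, h5]
      rfl
    rw [← h3, Finset.sum_mul, Finset.mul_sum]
    -- The substitution k ↦ mk moves m⁻¹ next to s.
    refine Fintype.sum_equiv (Equiv.mulLeft (⟨m, m.2.2⟩ : K)) _ _ fun k => ?_
    simp only [Equiv.coe_mulLeft, Subgroup.coe_mul, mul_inv_rev, map_mul]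
    calc _ = (δ (m : G) * magicIdem F θ φ) * δ (k : G) * (magicIdem F θ φ * δ (m : G)⁻¹) *
          (s * magicIdem F θ φ) * δ (k : G)⁻¹ * magicIdem F θ φ := by simp only [mul_assoc]
      _ = magicIdem F θ φ * (δ (m : G) * δ (k : G) * (δ (m : G)⁻¹ * (magicIdem F θ φ * s)) *
          δ (k : G)⁻¹ * magicIdem F θ φ) := by rw [hc, ← hc', his]; simp only [mul_assoc]
      _ = magicIdem F θ φ * (δ (m : G) * δ (k : G) * (δ (m : G)⁻¹ * (magicIdem F θ φ * s)) *
          δ (k : G)⁻¹ * (δ (m : G)⁻¹ * δ (m : G) * magicIdem F θ φ)) := by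
        rw [of_inv_mul_of, one_mul]
      _ = _ := by rw [hsi, hsm, mul_assoc (δ (m : G)⁻¹), hc]; simp only [mul_assoc]
  simp only [magicProj_apply, smul_mul_assoc, Finset.sum_mul]
  rw [← Finset.smul_sum, Finset.sum_comm]
  simp only [h1]
  simp only [← mul_assoc]
  simp only [mul_smul _ (charVal F φ _)]
  rw [← Finset.smul_sum, sum_charVal_of_mul_idem hB]
  simp only [smul_smul]
  congr 1
  have := hB.φ_ne
  have := hB.θ_ne
  field_simp

include hB hs in
/-- The Casimir element of `S`, second form. -/
theorem sum_magicProj_mul_magicProj :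
    ∑ k : K, magicProj F θ φ (δ (k : G)) * s * magicProj F θ φ (δ (k : G)⁻¹) =
    ((Nat.card K : F) / (charVal F θ 1 * charVal F φ 1) * magicTr F θ φ s) • magicIdem F θ φ := by
  have hcard := natCard_ne_zero F ↥(H ⊓ K)
  -- The first form is a multiple of i, hence fixed under conjugation by m. Since P(k)s commutes
  -- with L, the conjugation falls on the last factor alone, which may therefore be averaged over L.
  have h1 : ∀ m : ↥(H ⊓ K), ∑ k : K, magicProj F θ φ (δ (k : G)) * s *
      (δ (m : G) * (magicIdem F θ φ * δ (k : G)⁻¹ * magicIdem F θ φ) * δ (m : G)⁻¹) =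
      ((Nat.card K : F) / (charVal F θ 1 * charVal F φ 1) * magicTr F θ φ s) •
        magicIdem F θ φ := by
    intro m
    have h2 := congrArg (fun a => δ (m : G) * a * δ (m : G)⁻¹) (sum_magicProj_mul_mul hB hs)
    simp only [mul_smul_comm, smul_mul_assoc] at h2
    rw [hB.idem_comm, mul_assoc (magicIdem F θ φ) (δ (m : G)), of_mul_of_inv, mul_one] at h2
    rw [← h2, Finset.mul_sum, Finset.sum_mul]
    refine Finset.sum_congr rfl fun k _ => ?_
    have h3 : magicProj F θ φ (δ (k : G)) * s ∈ magicSub F θ φ :=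
      mul_mem (magicProj_mem hB (of_mem_subgroupAlg F k)) hs
    simp only [← mul_assoc]
    rw [mul_assoc (δ (m : G)), of_mul_of_mem_magicSub h3 m.2]
  simp only [magicProj_apply (δ _⁻¹), mul_smul_comm, Finset.mul_sum]
  rw [← Finset.smul_sum, Finset.sum_comm]
  simp only [h1]
  rw [Finset.sum_const, Finset.card_univ, Fintype.card_eq_nat_card, ← Nat.cast_smul_eq_nsmul F,
    smul_smul (_⁻¹), inv_mul_cancel₀ hcard, one_smul]

include hB hs in
-- The trace is invariant under conjugation by L, and s commutes with L and absorbs i, so all terms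
-- of the average have the same trace against s.
theorem magicTr_mul_magicProj (a : MonoidAlgebra F G) :
    magicTr F θ φ (s * magicProj F θ φ a) = magicTr F θ φ (s * a) := by
  have hcard := natCard_ne_zero F ↥(H ⊓ K)
  have h1 : ∀ m : ↥(H ⊓ K), magicTr F θ φ (s * (δ (m : G) *
      (magicIdem F θ φ * a * magicIdem F θ φ) * δ (m : G)⁻¹)) = magicTr F θ φ (s * a) := by
    intro m
    have hm := of_mem_subgroupAlg F (⟨m, m.2.2⟩ : K)
    change δ (m : G) ∈ _ at hm
    have hm' := of_mem_subgroupAlg F (⟨m, m.2.2⟩ : K)⁻¹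
    change δ (m : G)⁻¹ ∈ _ at hm'
    rw [← mul_assoc, ← mul_assoc, ← of_mul_of_mem_magicSub hs m.2, ← magicTr_mul_comm hB hm']
    simp only [← mul_assoc]
    rw [of_inv_mul_of, one_mul, mul_idem_of_mem_magicSub hB hs,
      ← magicTr_mul_comm hB BasicConfig.idem_mem, ← mul_assoc, idem_mul_of_mem_magicSub hB hs]
  rw [magicProj_apply, mul_smul_comm, Finset.mul_sum, map_smul, map_sum]
  simp only [h1]
  rw [Finset.sum_const, Finset.card_univ, Fintype.card_eq_nat_card, ← Nat.cast_smul_eq_nsmul F,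
    smul_smul, inv_mul_cancel₀ hcard, one_smul]

include hB hs in
/-- The dual bases of `S` for its trace form. -/
theorem sum_magicTr_smul_magicProj :
    ∑ k : K, magicTr F θ φ (s * magicProj F θ φ (δ (k : G)⁻¹)) • magicProj F θ φ (δ (k : G)) =
    ((Nat.card K : F) / (charVal F θ 1 * charVal F φ 1)) • s := by
  have h1 : ∀ k : K, magicTr F θ φ (s * magicProj F θ φ (δ (k : G)⁻¹)) •
      magicProj F θ φ (δ (k : G)) =
      (charVal F φ 1)⁻¹ • magicProj F θ φ (thetaTr F θ (s * δ (k : G)⁻¹) • δ (k : G)) := by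
    intro k
    rw [magicTr_mul_magicProj hB hs, map_smul, smul_smul]
    rfl
  simp only [h1]
  -- The dual bases are inherited from FKe_θ: there Σ θ(sk⁻¹)k is a multiple of s, and applying the
  -- projection, which fixes s, gives the expansion in S.
  have h2 := subgroup_sum_linFun_smul_of hB.irr_θ hB.val_θ (mem_subgroupAlg_of_mem_magicSub hs)
  change ∑ v : K, thetaTr F θ _ • _ = _ at h2
  rw [← Finset.smul_sum, ← map_sum, h2, hB.idem_θ_central]
  have h3 : subIdem F θ * s = s := by
    rw [← idem_mul_of_mem_magicSub hB hs, ← mul_assoc, hB.idem_θ_mul_idem]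
  rw [h3, map_smul, magicProj_of_mem hB hs, smul_smul]
  congr 1
  have := hB.φ_ne
  have := hB.θ_ne
  field_simp

include hB in
/-- The algebra `i F K i` is spanned by the products of elements of `S` and of `L`. -/
theorem idem_mul_mul_idem_eq_sum (a : MonoidAlgebra F G) :
    magicIdem F θ φ * a * magicIdem F θ φ = (charVal F φ 1 ^ 2 / (Nat.card ↥(H ⊓ K) : F)) •
      ∑ l : ↥(H ⊓ K), magicProj F θ φ (a * δ (l : G)) * δ (l : G)⁻¹ := by
  have hcard := natCard_ne_zero F ↥(H ⊓ K)
  -- For fixed m in the averaging, the sum of l m⁻¹ l⁻¹ over l is a scalar on e_φ by Schur's lemma.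
  -- The remaining sum over m gives e_φ a second time; each step costs a factor |L|/φ(1), whence the
  -- constant.
  have h2 : ∀ m : ↥(H ⊓ K), ∑ l : ↥(H ⊓ K), δ (m : G) *
      (magicIdem F θ φ * (a * δ (l : G)) * magicIdem F θ φ) * δ (m : G)⁻¹ * δ (l : G)⁻¹ =
      ((Nat.card ↥(H ⊓ K) : F) / charVal F φ 1) • charVal F φ m⁻¹ •
        (δ (m : G) * magicIdem F θ φ * (a * magicIdem F θ φ)) := by
    intro m
    have h3 := subgroup_sum_conj hB.irr_φ hB.val_φ (of_mem_subgroupAlg F m⁻¹)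
    rw [linFun_of, extZero_coe] at h3
    have h4 := congrArg (fun x => δ (m : G) * magicIdem F θ φ * a * (x * magicIdem F θ φ)) h3
    simp only [smul_mul_assoc, mul_smul_comm, mul_assoc, hB.idem_φ_mul_idem] at h4
    rw [smul_smul]
    simp only [mul_assoc]
    rw [← h4]
    simp only [Finset.sum_mul, Finset.mul_sum]
    refine Finset.sum_congr rfl fun l _ => ?_
    have hc := hB.idem_comm m⁻¹
    have hc' := hB.idem_comm l⁻¹
    rw [Subgroup.coe_inv] at hc hc'
    simp only [mul_assoc, Subgroup.coe_inv]
    rw [← mul_assoc (magicIdem F θ φ) (δ (m : G)⁻¹), ← hc, mul_assoc, ← hc']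
  simp only [magicProj_apply, smul_mul_assoc, Finset.sum_mul]
  rw [← Finset.smul_sum, Finset.sum_comm]
  simp only [h2]
  rw [← Finset.smul_sum]
  have h5 := congrArg (· * (a * magicIdem F θ φ)) (sum_charVal_of_mul_idem hB)
  simp only [Finset.sum_mul, smul_mul_assoc] at h5
  rw [h5]
  simp only [smul_smul]
  have := hB.φ_ne
  have h6 : charVal F φ 1 ^ 2 / (Nat.card ↥(H ⊓ K) : F) * ((Nat.card ↥(H ⊓ K) : F)⁻¹ *
      ((Nat.card ↥(H ⊓ K) : F) / charVal F φ 1 * ((Nat.card ↥(H ⊓ K) : F) / charVal F φ 1))) = 1 := by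
    field_simp
  simp only [← mul_assoc] at h6 ⊢
  rw [h6, one_smul]

include hB in
-- The number is the multiplicity of φ in the restriction of θ, the dimension of a space of
-- intertwining maps. Integrality is what later allows tr to be identified with the reduced trace.
theorem magicTr_idem : ∃ m : ℕ, m ≠ 0 ∧ magicTr F θ φ (magicIdem F θ φ) = m := by
  have hinner : classInner (resFun inf_le_right θ) φ =
      ((magicTr F θ φ (magicIdem F θ φ) : F) : ℂ) := by
    have h1 : thetaTr F θ (magicIdem F θ φ) = thetaTr F θ (subIdem F φ) := by
      rw [magicIdem, hB.idem_θ_central, thetaTr_idem_mul hB]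
    rw [magicTr, LinearMap.smul_apply, h1, thetaTr, smul_eq_mul, Subfield.coe_mul,
      coe_linFun_charVal hB.val_θ, subIdem_eq_sum hB.val_φ, map_smul, map_sum,
      hB.irr_φ.classInner_right]
    have h2 := algebraMap_charVal (mem_range_of_mem hB.val_φ)
    have h3 : ∑ l : ↥(H ⊓ K), (linFun F (extZero K θ)) (charVal F φ l⁻¹ • δ (l : G)) =
        ∑ l : ↥(H ⊓ K), resFun inf_le_right θ l * φ l⁻¹ := by
      refine Finset.sum_congr rfl fun l _ => ?_
      rw [map_smul, linFun_of, extZero_of_mem _ l.2.2, Subfield.smul_def, smul_eq_mul, mul_comm]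
      exact congrArg _ (h2 _)
    have h4 : ((charVal F φ 1 : F) : ℂ) = φ 1 := h2 1
    rw [h3, Subfield.smul_def, smul_eq_mul]
    push_cast
    rw [h4]
    have := hB.irr_φ.one_ne_zero
    field_simp
  obtain ⟨n, ρ, hρ, hθ⟩ := hB.irr_θ
  obtain ⟨n', ρ', hρ', hφ⟩ := hB.irr_φ
  have : Invertible (Nat.card ↥(H ⊓ K) : ℂ) := invertibleOfNonzero (natCard_ne_zero' _)
  have h := Representation.card_inv_mul_sum_char_mul_char_eq_finrank ρ'
    (ρ.comp (Subgroup.inclusion (inf_le_right : H ⊓ K ≤ K)))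
  have h5 : ((magicTr F θ φ (magicIdem F θ φ) : F) : ℂ) = (Module.finrank ℂ (ρ'.IntertwiningMap
      (ρ.comp (Subgroup.inclusion (inf_le_right : H ⊓ K ≤ K)))) : ℂ) := by
    rw [← h, ← hinner, hB.irr_φ.classInner_right, hφ, hθ]
    rfl
  refine ⟨_, ?_, Subtype.ext (h5.trans (by push_cast; rfl))⟩
  intro h0
  rw [h0, Nat.cast_zero, ← hinner] at h5
  exact hB.occurs h5

include hB in
theorem magicTr_idem_ne_zero : magicTr F θ φ (magicIdem F θ φ) ≠ 0 := by
  obtain ⟨m, hm, h⟩ := magicTr_idem hB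
  rw [h]
  exact_mod_cast hm

end

end Magic

/-! ### The complement of `S` -/

section SubAlg

variable {R A : Type*} [CommRing R] [Ring A] [Algebra R A] {B : NonUnitalSubalgebra R A} {e : A}
  {h : e ∈ B ∧ ∀ x ∈ B, e * x = x ∧ x * e = x}

/-- An element of `B` as an element of the unital algebra `SubAlg B e h`. -/
def SubAlg.of (h : e ∈ B ∧ ∀ x ∈ B, e * x = x ∧ x * e = x) (a : A) (ha : a ∈ B) : SubAlg B e h :=
  (⟨a, ha⟩ : ↥B)

theorem SubAlg.val_of (a : A) (ha : a ∈ B) : (SubAlg.of h a ha).val = a := rfl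

theorem SubAlg.val_mem (x : SubAlg B e h) : x.val ∈ B := Subtype.property (p := fun a => a ∈ B) x

theorem SubAlg.val_injective : Function.Injective (SubAlg.val : SubAlg B e h → A) :=
  Subtype.val_injective

theorem SubAlg.val_mul (x y : SubAlg B e h) : (x * y).val = x.val * y.val := rfl

theorem SubAlg.val_one : (1 : SubAlg B e h).val = e := rfl

/-- The inclusion of `SubAlg B e h`, as a linear map. -/
def SubAlg.valₗ : SubAlg B e h →ₗ[R] A where
  toFun := SubAlg.val
  map_add' _ _ := rfl
  map_smul' _ _ := rfl

theorem SubAlg.valₗ_apply (x : SubAlg B e h) : SubAlg.valₗ x = x.val := rfl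

end SubAlg

/-! ### The elements σ(Lh)⁻¹h and averages over K and U -/

section Magic

variable {G : Type*} [Group G] [Finite G] {F : Subfield ℂ} {H K : Subgroup G} [hK : K.Normal]
  {θ : K → ℂ} {φ : ↥(H ⊓ K) → ℂ}

local notation "δ" => MonoidAlgebra.of F G

/-- If `G = HK`, then averages over `U ≥ K` are averages over `K` and `U ∩ H`. -/
theorem sum_sum_mul_eq (hmul : ∀ g : G, ∃ h ∈ H, ∃ k ∈ K, g = h * k) {U : Subgroup G} (hU : K ≤ U)
    {M : Type*} [AddCommMonoid M] (f : G → M) :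
    ∑ h : ↥(U ⊓ H), ∑ k : K, f (k * h) = ∑ _l : ↥(H ⊓ K), ∑ x : U, f x := by
  have hex : ∀ x : U, ∃ h : ↥(U ⊓ H), (x : G) * (h : G)⁻¹ ∈ K := by
    intro x
    obtain ⟨h, hh, k, hk, hx⟩ := hmul x
    have hhU : h ∈ U := by
      have : h = x * k⁻¹ := by rw [hx, mul_inv_cancel_right]
      rw [this]
      exact U.mul_mem x.2 (U.inv_mem (hU hk))
    refine ⟨⟨h, hhU, hh⟩, ?_⟩
    change (x : G) * h⁻¹ ∈ K
    rw [hx]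
    exact hK.conj_mem k hk h
  choose h₀ hh₀ using hex
  rw [← Fintype.sum_prod_type', ← Fintype.sum_prod_type' (f := fun (_ : ↥(H ⊓ K)) (x : U) => f x)]
  -- With h₀(x) in U ∩ H a representative of the coset Kx, the pair (h, k) corresponds to x = kh and
  -- l = h h₀(x)⁻¹, which lies in L.
  refine Finset.sum_bij'
    (i := fun p _ => ((⟨p.1 * (h₀ ⟨p.2 * p.1, U.mul_mem (hU p.2.2) p.1.2.1⟩ : G)⁻¹,
        H.mul_mem p.1.2.2 (H.inv_mem (h₀ _).2.2), ?_⟩ : ↥(H ⊓ K)),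
        (⟨p.2 * p.1, U.mul_mem (hU p.2.2) p.1.2.1⟩ : U)))
    (j := fun q _ => ((⟨q.1 * h₀ q.2, U.mul_mem (hU q.1.2.2) (h₀ q.2).2.1,
        H.mul_mem q.1.2.1 (h₀ q.2).2.2⟩ : ↥(U ⊓ H)), (⟨q.2 * (h₀ q.2 : G)⁻¹ * (q.1 : G)⁻¹,
          K.mul_mem (hh₀ q.2) (K.inv_mem q.1.2.2)⟩ : K)))
    (fun _ _ => Finset.mem_univ _) (fun _ _ => Finset.mem_univ _) ?_ ?_ ?_
  · have h1 := hh₀ ⟨p.2 * p.1, U.mul_mem (hU p.2.2) p.1.2.1⟩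
    have h2 := K.mul_mem (K.inv_mem p.2.2) h1
    simp only [mul_assoc, inv_mul_cancel_left] at h2
    exact h2
  · rintro ⟨h, k⟩ -
    refine Prod.ext (Subtype.ext ?_) (Subtype.ext ?_)
    · simp
    · simp [mul_assoc]
  · rintro ⟨l, x⟩ -
    have h3 : (⟨(x : G) * (h₀ x : G)⁻¹ * (l : G)⁻¹ * (l * h₀ x), by simp [mul_assoc]⟩ : U) = x :=
      Subtype.ext (by simp [mul_assoc])
    refine Prod.ext (Subtype.ext ?_) h3
    change (l : G) * h₀ x * (h₀ _ : G)⁻¹ = l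
    rw [h3, mul_inv_cancel_right]
  · rintro ⟨h, k⟩ -
    rfl

variable (hB : BasicConfig F H K θ φ) (σ : H ⧸ K.subgroupOf H →* (MagicAlg hB)ˣ)

/-- The element `σ(Lh)`. -/
def magicUnit (h : H) : MonoidAlgebra F G := SubAlg.val (σ (QuotientGroup.mk h)).val

/-- The element `σ(Lh)⁻¹ h`, which centralizes `S`. -/
def magicElt (h : H) : MonoidAlgebra F G := magicUnit hB σ h⁻¹ * δ (h : G)

variable {hB σ}

theorem magicUnit_mem (h : H) : magicUnit hB σ h ∈ magicSub F θ φ := SubAlg.val_mem _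

theorem magicUnit_inv (h : H) :
    magicUnit hB σ h⁻¹ = SubAlg.val ((σ (QuotientGroup.mk h))⁻¹ : (MagicAlg hB)ˣ).val := by
  rw [magicUnit, QuotientGroup.mk_inv, map_inv]

theorem magicUnit_mul (h k : H) :
    magicUnit hB σ (h * k) = magicUnit hB σ h * magicUnit hB σ k := by
  rw [magicUnit, QuotientGroup.mk_mul, map_mul, Units.val_mul, SubAlg.val_mul]
  rfl

theorem magicUnit_of_mem {h : H} (hh : (h : G) ∈ K) : magicUnit hB σ h = magicIdem F θ φ := by
  have : (QuotientGroup.mk h : H ⧸ K.subgroupOf H) = 1 := (QuotientGroup.eq_one_iff h).2 hh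
  rw [magicUnit, this, map_one, Units.val_one, SubAlg.val_one]

theorem magicUnit_mul_inv (h : H) : magicUnit hB σ h * magicUnit hB σ h⁻¹ = magicIdem F θ φ := by
  rw [← magicUnit_mul, mul_inv_cancel]
  exact magicUnit_of_mem (one_mem K)

theorem magicUnit_inv_mul (h : H) : magicUnit hB σ h⁻¹ * magicUnit hB σ h = magicIdem F θ φ := by
  rw [← magicUnit_mul, inv_mul_cancel]
  exact magicUnit_of_mem (one_mem K)

theorem idem_mul_magicElt (h : H) : magicIdem F θ φ * magicElt hB σ h = magicElt hB σ h := by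
  rw [magicElt, ← mul_assoc, idem_mul_of_mem_magicSub hB (magicUnit_mem _)]

theorem magicElt_mul_idem (h : H) : magicElt hB σ h * magicIdem F θ φ = magicElt hB σ h := by
  rw [magicElt, mul_assoc, hB.of_mul_idem h.2, ← mul_assoc,
    mul_idem_of_mem_magicSub hB (magicUnit_mem _)]

theorem magicElt_of_mem {h : H} (hh : (h : G) ∈ K) :
    magicElt hB σ h = magicIdem F θ φ * δ (h : G) := by
  rw [magicElt, magicUnit_of_mem]
  exact K.inv_mem hh

theorem magicUnit_mul_magicElt (h : H) :
    magicUnit hB σ h * magicElt hB σ h = magicIdem F θ φ * δ (h : G) := by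
  rw [magicElt, ← mul_assoc, magicUnit_mul_inv]

theorem magicElt_mem {U : Subgroup G} (hU : K ≤ U) {h : H} (hh : (h : G) ∈ U) :
    magicElt hB σ h ∈ subgroupAlg F U :=
  mul_mem (subgroupAlg_mono hU (mem_subgroupAlg_of_mem_magicSub (magicUnit_mem _)))
    (of_mem_subgroupAlg F (⟨h, hh⟩ : U))

variable (hσ : IsMagic hB σ)

include hσ

theorem of_conj_magicSub (h : H) {s : MonoidAlgebra F G} (hs : s ∈ magicSub F θ φ) :
    δ (h : G) * s * δ (h : G)⁻¹ = magicUnit hB σ h * s * magicUnit hB σ h⁻¹ := by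
  -- The magic relation is stated for h⁻¹sh, so it is used at h⁻¹.
  have h1 := hσ (SubAlg.of hB.unit s hs) (h : G)⁻¹ (H.inv_mem h.2)
  rw [inv_inv, SubAlg.val_mul, SubAlg.val_mul, SubAlg.val_of] at h1
  rw [h1]
  have h2 := magicUnit_inv (hB := hB) (σ := σ) h⁻¹
  rw [inv_inv] at h2
  rw [h2]
  rfl

theorem of_mul_magicSub (h : H) {s : MonoidAlgebra F G} (hs : s ∈ magicSub F θ φ) :
    δ (h : G) * s = magicUnit hB σ h * s * magicElt hB σ h := by
  rw [magicElt, ← mul_assoc, ← of_conj_magicSub hσ h hs, mul_assoc _ _ (δ (h : G)), of_inv_mul_of,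
    mul_one]

/-- Conjugation by h and by σ(Lh) agree on S, so they cancel in σ(Lh)⁻¹h. -/
theorem magicElt_mul_comm (h : H) {s : MonoidAlgebra F G} (hs : s ∈ magicSub F θ φ) :
    magicElt hB σ h * s = s * magicElt hB σ h := by
  rw [magicElt, mul_assoc, of_mul_magicSub hσ h hs, ← mul_assoc, ← mul_assoc, magicUnit_inv_mul,
    idem_mul_of_mem_magicSub hB hs]
  rfl

/-- The inner factor σ(Lk)⁻¹ belongs to S, so h can be moved past it by the magic relation;
multiplicativity of σ does the rest. -/
theorem magicElt_mul (h k : H) : magicElt hB σ (h * k) = magicElt hB σ h * magicElt hB σ k := by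
  conv_rhs => rw [magicElt, magicElt]
  rw [mul_assoc, ← mul_assoc (δ (h : G)), of_mul_magicSub hσ h (magicUnit_mem _), magicElt, magicElt,
    mul_inv_rev, magicUnit_mul]
  simp only [← mul_assoc]
  rw [magicUnit_inv_mul, idem_mul_of_mem_magicSub hB (magicUnit_mem _), mul_assoc _ (δ (h : G)),
    ← map_mul]
  rfl

omit hσ in
theorem magicElt_one : magicElt hB σ 1 = magicIdem F θ φ := by
  rw [magicElt_of_mem (one_mem K), Subgroup.coe_one, map_one, mul_one]

theorem magicElt_conj (h y : H) :
    magicElt hB σ (h * y * h⁻¹) = magicElt hB σ h * magicElt hB σ y * magicElt hB σ h⁻¹ := by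
  rw [magicElt_mul hσ, magicElt_mul hσ]

omit hσ in
theorem magicUnit_conj_mem (h : H) {s : MonoidAlgebra F G} (hs : s ∈ magicSub F θ φ) :
    magicUnit hB σ h * s * magicUnit hB σ h⁻¹ ∈ magicSub F θ φ :=
  mul_mem (mul_mem (magicUnit_mem _) hs) (magicUnit_mem _)

omit hσ in
theorem magicTr_magicUnit_conj (h : H) {s : MonoidAlgebra F G} (hs : s ∈ magicSub F θ φ) :
    magicTr F θ φ (magicUnit hB σ h * s * magicUnit hB σ h⁻¹) = magicTr F θ φ s := by
  rw [mul_assoc, magicTr_mul_comm hB (mem_subgroupAlg_of_mem_magicSub (magicUnit_mem _)), mul_assoc,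
    magicUnit_inv_mul, mul_idem_of_mem_magicSub hB hs]

/-- On the corner, h acts as σ(Lh)c_h. The first factor commutes with all c_y and the second with S,
so conjugation by h acts separately on the two tensor factors. -/
theorem of_conj_mul_magicElt (h y : H) {s : MonoidAlgebra F G} (hs : s ∈ magicSub F θ φ) :
    δ (h : G) * (s * magicElt hB σ y) * δ (h : G)⁻¹ =
      magicUnit hB σ h * s * magicUnit hB σ h⁻¹ * magicElt hB σ (h * y * h⁻¹) := by
  have h1 : magicElt hB σ y * δ (h : G)⁻¹ =
      magicElt hB σ y * magicElt hB σ h⁻¹ * magicUnit hB σ h⁻¹ := by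
    have h2 := magicUnit_mul_magicElt (hB := hB) (σ := σ) h⁻¹
    rw [mul_assoc, magicElt_mul_comm hσ _ (magicUnit_mem _), h2, ← mul_assoc, magicElt_mul_idem]
    rfl
  rw [mul_assoc, mul_assoc s, h1, ← mul_assoc, of_mul_magicSub hσ h hs, magicElt_conj hσ]
  simp only [mul_assoc]
  rw [magicElt_mul_comm hσ _ (magicUnit_mem _)]
  simp only [← mul_assoc]
  rw [mul_assoc _ (magicElt hB σ y), magicElt_mul_comm hσ y (magicUnit_mem _), ← mul_assoc,
    mul_assoc _ (magicElt hB σ h), magicElt_mul_comm hσ h (magicUnit_mem _), ← mul_assoc]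

theorem magicElt_conj_of_mem (y : H) (l : ↥(H ⊓ K)) :
    magicElt hB σ ((Subgroup.inclusion inf_le_left l)⁻¹ * y * Subgroup.inclusion inf_le_left l) =
      δ (l : G)⁻¹ * magicElt hB σ y * δ (l : G) := by
  have hc := hB.idem_comm l⁻¹
  rw [Subgroup.coe_inv] at hc
  have h1 : magicElt hB σ (Subgroup.inclusion inf_le_left l)⁻¹ =
      magicIdem F θ φ * δ (l : G)⁻¹ := magicElt_of_mem (K.inv_mem l.2.2)
  have h2 : magicElt hB σ (Subgroup.inclusion inf_le_left l) =
      magicIdem F θ φ * δ (l : G) := magicElt_of_mem l.2.2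
  rw [magicElt_mul hσ, magicElt_mul hσ, h1, h2, ← hc, mul_assoc _ (magicIdem F θ φ),
    idem_mul_magicElt, mul_assoc, ← mul_assoc _ (magicIdem F θ φ), magicElt_mul_idem, ← mul_assoc]

omit hσ in
-- The pure ring identity behind one step of the next computation. There p is a projected element of
-- K, l and l' are mutually inverse elements of L, c is c_y, and c' is its conjugate by l'.
theorem magic_shuffle {R : Type*} [Ring R] {p l l' s c i k c' : R} (h1 : l' * s = s * l')
    (h2 : l * l' = 1) (h3 : c' * (p * s) = p * s * c') (h4 : c' * i = c') (h5 : c * i = c)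
    (h6 : c' = l' * c * l) :
    p * l' * (s * c) * (i * k * i) = c' * (p * s * (i * (l' * k) * i)) := by
  calc p * l' * (s * c) * (i * k * i) = p * (l' * s) * (c * i) * k * i := by
        simp only [mul_assoc]
    _ = p * s * (l' * c * (l * l')) * k * i := by rw [h1, h5, h2]; simp only [mul_assoc, one_mul]
    _ = p * s * (c' * i) * l' * k * i := by rw [h4, h6]; simp only [mul_assoc]
    _ = c' * (p * s) * (i * (l' * k) * i) := by rw [h3]; simp only [mul_assoc]
    _ = _ := by simp only [mul_assoc]

/-- The Casimir element of `i F K i`, acting on the centralizer of `S`. -/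
theorem sum_conj_mul_magicElt {s : MonoidAlgebra F G} (hs : s ∈ magicSub F θ φ) (y : H) :
    ∑ k : K, magicIdem F θ φ * (δ (k : G) * (s * magicElt hB σ y) * δ (k : G)⁻¹) *
        magicIdem F θ φ =
      (charVal F φ 1 * Nat.card K / (charVal F θ 1 * Nat.card ↥(H ⊓ K)) * magicTr F θ φ s) •
        ∑ l : ↥(H ⊓ K), magicElt hB σ
          (Subgroup.inclusion inf_le_left l * y * (Subgroup.inclusion inf_le_left l)⁻¹) := by
  have hcard := natCard_ne_zero F ↥(H ⊓ K)
  have hsi := idem_mul_of_mem_magicSub hB hs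
  have hii := hB.idem
  let j : ↥(H ⊓ K) → H := Subgroup.inclusion inf_le_left
  -- Because s absorbs i on the left, the factor in front of s c_y is iki, which is expanded into
  -- products of elements of S and of L.
  have h1 : ∀ k : K, magicIdem F θ φ * (δ (k : G) * (s * magicElt hB σ y) * δ (k : G)⁻¹) *
      magicIdem F θ φ = (charVal F φ 1 ^ 2 / (Nat.card ↥(H ⊓ K) : F)) •
        ∑ l : ↥(H ⊓ K), magicProj F θ φ (δ (k : G) * δ (l : G)) * δ (l : G)⁻¹ *
          (s * magicElt hB σ y) * (magicIdem F θ φ * δ (k : G)⁻¹ * magicIdem F θ φ) := by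
    intro k
    have h2 := idem_mul_mul_idem_eq_sum hB (δ (k : G))
    have h3 := congrArg (· * (s * magicElt hB σ y) *
      (magicIdem F θ φ * δ (k : G)⁻¹ * magicIdem F θ φ)) h2
    simp only [smul_mul_assoc, Finset.sum_mul] at h3
    rw [← h3]
    calc _ = magicIdem F θ φ * δ (k : G) * (magicIdem F θ φ * s) * (magicElt hB σ y *
          magicIdem F θ φ) * δ (k : G)⁻¹ * magicIdem F θ φ := by
            rw [hsi, magicElt_mul_idem]; simp only [mul_assoc]
      _ = _ := by simp only [mul_assoc]
  -- Substituting kl for k and conjugating c_y by l pulls the centralizing factor out in front; what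
  -- remains is the first form of the Casimir identity.
  have h2 : ∀ l : ↥(H ⊓ K), ∑ k : K, magicProj F θ φ (δ (k : G) * δ (l : G)) * δ (l : G)⁻¹ *
      (s * magicElt hB σ y) * (magicIdem F θ φ * δ (k : G)⁻¹ * magicIdem F θ φ) =
      ((Nat.card K : F) / (charVal F θ 1 * charVal F φ 1) * magicTr F θ φ s) •
        magicElt hB σ ((j l)⁻¹ * y * (j l)) := by
    intro l
    have h3 := congrArg (magicElt hB σ ((j l)⁻¹ * y * (j l)) * ·) (sum_magicProj_mul_mul hB hs)
    simp only [mul_smul_comm, magicElt_mul_idem, Finset.mul_sum] at h3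
    rw [← h3]
    refine Fintype.sum_equiv (Equiv.mulRight (⟨l, l.2.2⟩ : K)) _ _ fun k => ?_
    simp only [Equiv.coe_mulRight, Subgroup.coe_mul, mul_inv_rev, map_mul]
    have h4 : δ (k : G) * δ (l : G) = δ (((k * ⟨l, l.2.2⟩ : K)) : G) := (map_mul _ _ _).symm
    have h5 : magicProj F θ φ (δ (k : G) * δ (l : G)) ∈ magicSub F θ φ := by
      rw [h4]
      exact magicProj_mem hB (of_mem_subgroupAlg F _)
    exact magic_shuffle (of_mul_of_mem_magicSub hs (inv_mem l.2)) (of_mul_of_inv (l : G))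
      (magicElt_mul_comm hσ _ (mul_mem h5 hs)) (magicElt_mul_idem _) (magicElt_mul_idem _)
      (magicElt_conj_of_mem hσ y l)
  simp only [h1]
  rw [← Finset.smul_sum, Finset.sum_comm]
  simp only [h2]
  rw [← Finset.smul_sum, smul_smul]
  congr 1
  · have := hB.φ_ne
    have := hB.θ_ne
    field_simp
  · refine Fintype.sum_equiv (Equiv.inv _) _ _ fun l => ?_
    simp only [Equiv.inv_apply, map_inv, inv_inv]
    rfl

/-- An average over U is split into averages over K and U ∩ H; conjugation by h keeps the trace of
the S-factor and moves only y. This identity converts averages over U into averages over U ∩ H, and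
surjectivity and irreducibility both rest on it. -/
theorem sum_conj_mul_magicElt_of_le {s : MonoidAlgebra F G} (hs : s ∈ magicSub F θ φ) (y : H)
    {U : Subgroup G} (hU : K ≤ U) :
    ∑ x : U, magicIdem F θ φ * (δ (x : G) * (s * magicElt hB σ y) * δ (x : G)⁻¹) *
        magicIdem F θ φ =
      (charVal F φ 1 * Nat.card K / (charVal F θ 1 * Nat.card ↥(H ⊓ K)) * magicTr F θ φ s) •
        ∑ h : ↥(U ⊓ H), magicElt hB σ
          (Subgroup.inclusion inf_le_right h * y * (Subgroup.inclusion inf_le_right h)⁻¹) := by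
  have hcard := natCard_ne_zero F ↥(H ⊓ K)
  have h1 := sum_sum_mul_eq hB.exists_mul hU fun x : G =>
    magicIdem F θ φ * (δ x * (s * magicElt hB σ y) * δ x⁻¹) * magicIdem F θ φ
  rw [Finset.sum_const, Finset.card_univ, Fintype.card_eq_nat_card, ← Nat.cast_smul_eq_nsmul F] at h1
  have h2 : ∀ h : ↥(U ⊓ H), ∑ k : K, magicIdem F θ φ * (δ (k * h : G) * (s * magicElt hB σ y) *
      δ (k * h : G)⁻¹) * magicIdem F θ φ =
      (charVal F φ 1 * Nat.card K / (charVal F θ 1 * Nat.card ↥(H ⊓ K)) * magicTr F θ φ s) •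
        ∑ l : ↥(H ⊓ K), magicElt hB σ
          (Subgroup.inclusion inf_le_left l * (Subgroup.inclusion inf_le_right h * y *
            (Subgroup.inclusion inf_le_right h)⁻¹) * (Subgroup.inclusion inf_le_left l)⁻¹) := by
    intro h
    have h3 := sum_conj_mul_magicElt hσ
      (magicUnit_conj_mem (hB := hB) (σ := σ) (Subgroup.inclusion inf_le_right h) hs)
      (Subgroup.inclusion inf_le_right h * y * (Subgroup.inclusion inf_le_right h)⁻¹)
    rw [magicTr_magicUnit_conj _ hs] at h3
    rw [← h3]
    refine Finset.sum_congr rfl fun k _ => ?_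
    rw [← of_conj_mul_magicElt hσ _ _ hs, Subgroup.coe_inclusion, mul_inv_rev, map_mul, map_mul]
    simp only [mul_assoc]
  simp only [h2] at h1
  rw [← Finset.smul_sum, Finset.sum_comm] at h1
  have h4 : ∀ l : ↥(H ⊓ K), ∑ h : ↥(U ⊓ H), magicElt hB σ
      (Subgroup.inclusion inf_le_left l * (Subgroup.inclusion inf_le_right h * y *
        (Subgroup.inclusion inf_le_right h)⁻¹) * (Subgroup.inclusion inf_le_left l)⁻¹) =
      ∑ h : ↥(U ⊓ H), magicElt hB σ
          (Subgroup.inclusion inf_le_right h * y * (Subgroup.inclusion inf_le_right h)⁻¹) := by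
    intro l
    refine Fintype.sum_equiv (Equiv.mulLeft (⟨l, hU l.2.2, l.2.1⟩ : ↥(U ⊓ H))) _ _ fun h => ?_
    simp only [Equiv.coe_mulLeft, map_mul, mul_inv_rev, mul_assoc]
    rfl
  simp only [h4] at h1
  rw [Finset.sum_const, Finset.card_univ, Fintype.card_eq_nat_card, ← Nat.cast_smul_eq_nsmul F,
    smul_comm] at h1
  have h5 := smul_right_injective (MonoidAlgebra F G) hcard h1
  exact h5.symm

end Magic

/-! ### The map `ι` -/

section LinFun

variable {G : Type*} [Group G] [Finite G] {F : Subfield ℂ} {V : Subgroup G}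

local notation "δ" => MonoidAlgebra.of F G

omit [Finite G] in
theorem linFun_extZero_add (f g : V → ℂ) (a : MonoidAlgebra F G) :
    linFun F (extZero V (f + g)) a = linFun F (extZero V f) a + linFun F (extZero V g) a := by
  induction a using MonoidAlgebra.induction_on with
  | of x =>
    rw [linFun_of, linFun_of, linFun_of]
    by_cases hx : x ∈ V
    · simp only [extZero_of_mem _ hx, Pi.add_apply]
    · simp only [extZero_of_notMem _ hx, add_zero]
  | add a b ha hb => rw [map_add, map_add, map_add, ha, hb, add_add_add_comm]
  | smul r a ha => rw [map_smul, map_smul, map_smul, ha, smul_add]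

omit [Finite G] in
theorem linFun_extZero_smul (r : ℂ) (f : V → ℂ) (a : MonoidAlgebra F G) :
    linFun F (extZero V (r • f)) a = r * linFun F (extZero V f) a := by
  induction a using MonoidAlgebra.induction_on with
  | of x =>
    rw [linFun_of, linFun_of]
    by_cases hx : x ∈ V
    · simp only [extZero_of_mem _ hx, Pi.smul_apply, smul_eq_mul]
    · simp only [extZero_of_notMem _ hx, mul_zero]
  | add a b ha hb => rw [map_add, map_add, ha, hb, mul_add]
  | smul s a ha => rw [map_smul, map_smul, ha, mul_smul_comm]

omit [Finite G] in
/-- A linear functional on `F V` is determined by its values on `V`. -/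
theorem linFun_extZero_eq {M : Type*} [AddCommGroup M] [Module F M] {f : V → M}
    (T : MonoidAlgebra F G →ₗ[F] M) (h : ∀ v : V, f v = T (δ (v : G)))
    {a : MonoidAlgebra F G} (ha : a ∈ subgroupAlg F V) : linFun F (extZero V f) a = T a := by
  induction ha using subgroupAlg_induction with
  | hof v => rw [linFun_of, extZero_coe, h]
  | hadd a b _ _ ha hb => rw [map_add, map_add, ha, hb]
  | hsmul r a _ ha => rw [map_smul, map_smul, ha]

omit [Finite G] in
theorem linFun_extZero_mul_of {M : Type*} [AddCommGroup M] [Module F M] {f : V → M}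
    {a : MonoidAlgebra F G} (ha : a ∈ subgroupAlg F V) {g : G} (hg : g ∉ V) :
    linFun F (extZero V f) (a * δ g) = 0 := by
  induction ha using subgroupAlg_induction with
  | hof v =>
    rw [← map_mul, linFun_of, extZero_of_notMem]
    rwa [Subgroup.mul_mem_cancel_left _ v.2]
  | hadd a b _ _ ha hb => rw [add_mul, map_add, ha, hb, add_zero]
  | hsmul r a _ ha => rw [smul_mul_assoc, map_smul, ha, smul_zero]

theorem linFun_subIdem_mul_of {N : Subgroup G} (hN : N ≤ V) {θ : N → ℂ} (hF : ∀ n, θ n ∈ F)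
    (f : V → ℂ) (v : V) :
    linFun F (extZero V f) (subIdem F θ * δ (v : G)) = aboveProj hN θ f v := by
  simp only [subIdem_eq_sum hF, smul_mul_assoc, Finset.sum_mul, ← map_mul, map_smul, map_sum,
    linFun_of]
  rw [aboveProj_apply, Algebra.smul_def, map_div₀, map_natCast,
    algebraMap_charVal (mem_range_of_mem hF)]
  congr 1
  refine Finset.sum_congr rfl fun n _ => ?_
  rw [Algebra.smul_def, algebraMap_charVal (mem_range_of_mem hF)]
  congr 1
  exact extZero_of_mem f (V.mul_mem (hN n.2) v.2)

/-- The product formula for an irreducible character, extended linearly. -/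
theorem IsIrrChar.sum_linFun_conj_mul {χ : V → ℂ} (hχ : IsIrrChar χ) {a b : MonoidAlgebra F G}
    (ha : a ∈ subgroupAlg F V) (hb : b ∈ subgroupAlg F V) :
    χ 1 * ∑ v : V, linFun F (extZero V χ) (δ (v : G) * a * δ (v : G)⁻¹ * b) =
      Nat.card V * (linFun F (extZero V χ) a * linFun F (extZero V χ) b) := by
  induction ha using subgroupAlg_induction with
  | hof x =>
    induction hb using subgroupAlg_induction with
    | hof y =>
      have h := hχ.sum_conj_mul x y
      simp only [← map_mul, linFun_of]
      rw [extZero_coe, extZero_coe, ← h]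
      congr 1
      refine Finset.sum_congr rfl fun v _ => ?_
      exact extZero_coe χ (v * x * v⁻¹ * y)
    | hadd a b _ _ ha hb =>
      simp only [mul_add, map_add, Finset.sum_add_distrib] at ha hb ⊢
      rw [ha, hb]
    | hsmul r a _ ha =>
      simp only [mul_smul_comm, map_smul, ← Finset.smul_sum] at ha ⊢
      rw [ha]
  | hadd a b _ _ ha hb =>
    simp only [mul_add, add_mul, map_add, Finset.sum_add_distrib] at ha hb ⊢
    rw [ha, hb]
  | hsmul r a _ ha =>
    simp only [mul_smul_comm, smul_mul_assoc, map_smul, ← Finset.smul_sum] at ha ⊢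
    rw [ha]

end LinFun

section Iota

variable {G : Type*} [Group G] [Finite G] {F : Subfield ℂ} {H K : Subgroup G} [hK : K.Normal]
  {θ : K → ℂ} {φ : ↥(H ⊓ K) → ℂ} {U : Subgroup G} {hU : K ≤ U}

local notation "δ" => MonoidAlgebra.of F G

section

variable (hB : BasicConfig F H K θ φ)

include hB

theorem BasicConfig.exists_invariant_θ (U : Subgroup G) :
    ∀ v ∈ U, ∀ n : K, ∃ h : v * n * v⁻¹ ∈ K, θ ⟨v * n * v⁻¹, h⟩ = θ n :=
  fun v _ n => ⟨_, hB.invariant_θ v n⟩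

theorem BasicConfig.exists_invariant_φ (U : Subgroup G) :
    ∀ v ∈ U ⊓ H, ∀ n : ↥(H ⊓ K), ∃ h : v * n * v⁻¹ ∈ H ⊓ K, φ ⟨v * n * v⁻¹, h⟩ = φ n :=
  fun v hv n => ⟨_, hB.inv_φ v hv.2 n⟩

theorem BasicConfig.coe_φ (l : ↥(H ⊓ K)) : ((charVal F φ l : F) : ℂ) = φ l :=
  algebraMap_charVal (mem_range_of_mem hB.val_φ) l

theorem BasicConfig.coe_θ (l : K) : ((charVal F θ l : F) : ℂ) = θ l :=
  algebraMap_charVal (mem_range_of_mem hB.val_θ) l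

variable {f : U → ℂ} (hf : IsAbove hU θ f)

include hf in
-- Schur's lemma for θ read through f: on e_θ the K-conjugates of b add up to a scalar, and f does
-- not notice the factor e_θ.
theorem sum_linFun_mul_conj {b : MonoidAlgebra F G} (hb : b ∈ subgroupAlg F K)
    (a : MonoidAlgebra F G) :
    ∑ k : K, linFun F (extZero U f) (δ (k : G) * b * δ (k : G)⁻¹ * a) =
      Nat.card K / θ 1 * thetaTr F θ b * linFun F (extZero U f) a := by
  have h1 := subgroup_sum_conj hB.irr_θ hB.val_θ hb
  have h2 := congrArg (fun x => linFun F (extZero U f) (x * a)) h1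
  simp only [smul_mul_assoc, map_smul, linFun_subIdem_mul hU hB.val_θ hf] at h2
  rw [hB.idem_θ_central, mul_assoc, linFun_subIdem_mul hU hB.val_θ hf, Finset.sum_mul, map_sum] at h2
  rw [h2, Algebra.smul_def, map_mul, map_div₀, map_natCast,
    algebraMap_charVal (mem_range_of_mem hB.val_θ)]
  rfl

include hf in
/-- On `F K`, the functions above `θ` are multiples of `θ`. -/
theorem linFun_of_mem {b : MonoidAlgebra F G} (hb : b ∈ subgroupAlg F K) :
    linFun F (extZero U f) b = f 1 / θ 1 * thetaTr F θ b := by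
  have hcard := natCard_ne_zero' K
  have h1 := sum_linFun_mul_conj hB hf hb 1
  have h2 : ∀ k : K, linFun F (extZero U f) (δ (k : G) * b * δ (k : G)⁻¹ * 1) =
      linFun F (extZero U f) b := by
    intro k
    have hk : δ (k : G) ∈ subgroupAlg F U := of_mem_subgroupAlg F (⟨k, hU k.2⟩ : U)
    rw [mul_one, mul_assoc, linFun_extZero_mul_comm hf.1 hk, mul_assoc, of_inv_mul_of, mul_one]
  have h3 : linFun F (extZero U f) (1 : MonoidAlgebra F G) = f 1 := by
    rw [← map_one (MonoidAlgebra.of F G), linFun_of]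
    exact extZero_coe f 1
  simp only [h2] at h1
  rw [Finset.sum_const, Finset.card_univ, Fintype.card_eq_nat_card, nsmul_eq_mul, h3] at h1
  refine mul_left_cancel₀ hcard (h1.trans ?_)
  ring

theorem coe_thetaTr_idem : ((thetaTr F θ (magicIdem F θ φ) : F) : ℂ) =
    φ 1 * magicTr F θ φ (magicIdem F θ φ) := by
  rw [thetaTr_eq hB, Subfield.coe_mul, hB.coe_φ]

theorem coe_magicTr_idem_ne_zero : ((magicTr F θ φ (magicIdem F θ φ) : F) : ℂ) ≠ 0 := by
  have := magicTr_idem_ne_zero hB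
  exact_mod_cast this

end

variable (hB : BasicConfig F H K θ φ) (σ : H ⧸ K.subgroupOf H →* (MagicAlg hB)ˣ)

/-- The map `ι`, in the form `h ↦ χ(σ(Lh)⁻¹ h)/tr(i)`. -/
def magicMap (U : Subgroup G) : (U → ℂ) →ₗ[ℂ] (↥(U ⊓ H) → ℂ) where
  toFun f h := (magicTr F θ φ (magicIdem F θ φ) : ℂ)⁻¹ *
    linFun F (extZero U f) (magicElt hB σ (Subgroup.inclusion inf_le_right h))
  map_add' f g := by
    funext h
    rw [linFun_extZero_add, mul_add]
    rfl
  map_smul' r f := by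
    funext h
    rw [linFun_extZero_smul, mul_left_comm]
    rfl

variable {hB σ}

theorem linFun_magicElt (f : U → ℂ) (h : ↥(U ⊓ H)) :
    linFun F (extZero U f) (magicElt hB σ (Subgroup.inclusion inf_le_right h)) =
      magicTr F θ φ (magicIdem F θ φ) * magicMap hB σ U f h :=
  (mul_inv_cancel_left₀ (coe_magicTr_idem_ne_zero hB) _).symm

variable (hσ : IsMagic hB σ) {f : U → ℂ} (hf : IsAbove hU θ f)

include hσ hf

/-- The key identity: on products s·c_y, f depends on s only through tr(s). Applying f to the
Casimir formula, the trace property shifts the K-conjugation onto i, whose conjugates add up to a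
scalar; on the other side all c_{lyl⁻¹} have the same value under f. -/
theorem linFun_mul_magicElt {s : MonoidAlgebra F G} (hs : s ∈ magicSub F θ φ) (y : H) :
    magicTr F θ φ (magicIdem F θ φ) * linFun F (extZero U f) (s * magicElt hB σ y) =
      magicTr F θ φ s * linFun F (extZero U f) (magicElt hB σ y) := by
  have hcardK := natCard_ne_zero' K
  have hcardL := natCard_ne_zero' ↥(H ⊓ K)
  have hθ := hB.irr_θ.one_ne_zero
  have hφ := hB.irr_φ.one_ne_zero
  have hi : magicIdem F θ φ ∈ subgroupAlg F U := subgroupAlg_mono hU BasicConfig.idem_mem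
  have h1 := congrArg (linFun F (extZero U f)) (sum_conj_mul_magicElt hσ hs y)
  have h2 : ∀ k : K, linFun F (extZero U f) (magicIdem F θ φ * (δ (k : G) *
      (s * magicElt hB σ y) * δ (k : G)⁻¹) * magicIdem F θ φ) =
      linFun F (extZero U f) (δ ((k⁻¹ : K) : G) * magicIdem F θ φ * δ ((k⁻¹ : K) : G)⁻¹ *
        (s * magicElt hB σ y)) := by
    intro k
    have hk : δ (k : G)⁻¹ ∈ subgroupAlg F U := of_mem_subgroupAlg F (⟨_, inv_mem (hU k.2)⟩ : U)
    rw [← linFun_extZero_mul_comm hf.1 hi, ← mul_assoc, hB.idem, ← mul_assoc, Subgroup.coe_inv,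
      inv_inv, ← linFun_extZero_mul_comm hf.1 hk]
    simp only [mul_assoc]
  have h3 : ∀ l : ↥(H ⊓ K), linFun F (extZero U f) (magicElt hB σ
      (Subgroup.inclusion inf_le_left l * y * (Subgroup.inclusion inf_le_left l)⁻¹)) =
      linFun F (extZero U f) (magicElt hB σ y) := by
    intro l
    have hl : magicElt hB σ (Subgroup.inclusion inf_le_left l) ∈ subgroupAlg F U :=
      magicElt_mem hU (hU l.2.2)
    rw [magicElt_conj hσ, mul_assoc, linFun_extZero_mul_comm hf.1 hl, mul_assoc, ← magicElt_mul hσ, inv_mul_cancel, magicElt_one, magicElt_mul_idem]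
  have h4 := sum_linFun_mul_conj hB hf (BasicConfig.idem_mem (θ := θ) (φ := φ)) (s * magicElt hB σ y)
  rw [← Equiv.sum_comp (Equiv.inv K)] at h4
  simp only [Equiv.inv_apply] at h4
  rw [map_sum, map_smul, map_sum] at h1
  simp only [h2, h3] at h1
  rw [h4, coe_thetaTr_idem hB, Finset.sum_const, Finset.card_univ, Fintype.card_eq_nat_card,
    nsmul_eq_mul, Algebra.smul_def] at h1
  simp only [map_mul, map_div₀, map_natCast, algebraMap_charVal (mem_range_of_mem hB.val_θ),
    algebraMap_charVal (mem_range_of_mem hB.val_φ)] at h1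
  change _ = _ * ((magicTr F θ φ s : F) : ℂ) * _ at h1
  field_simp at h1
  exact h1

/-- Independence of s₀: by the key identity only its trace enters. -/
theorem iotaFun_eq {s₀ : MagicAlg hB} (hs₀ : magicTr F θ φ s₀.val = 1) :
    iotaFun hB σ s₀ f = magicMap hB σ U f := by
  funext h
  have h1 := linFun_mul_magicElt hσ hf s₀.val_mem (Subgroup.inclusion inf_le_right h)
  rw [hs₀, linFun_magicElt] at h1
  have h2 : ((1 : F) : ℂ) = 1 := rfl
  rw [h2, one_mul] at h1
  have h3 := mul_left_cancel₀ (coe_magicTr_idem_ne_zero hB) h1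
  rw [← h3, iotaFun, linExt_eq, magicElt, ← mul_assoc, magicUnit_inv, SubAlg.val_mul]
  rfl

theorem magicMap_mul_comm (g h : ↥(U ⊓ H)) :
    magicMap hB σ U f (g * h) = magicMap hB σ U f (h * g) := by
  refine mul_left_cancel₀ (coe_magicTr_idem_ne_zero hB) ?_
  rw [← linFun_magicElt, ← linFun_magicElt, map_mul, map_mul, magicElt_mul hσ, magicElt_mul hσ,
    linFun_extZero_mul_comm hf.1]
  exact magicElt_mem hU g.2.1

/-- The factor e_φ is absorbed by i, hence by c_v, and l c_v = c_{lv} for l in L. So inserting e_φ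
before v changes nothing. -/
theorem isAbove_magicMap : IsAbove (inf_le_inf_right_of_le hU) φ (magicMap hB σ U f) := by
  refine ⟨magicMap_mul_comm hσ hf, ?_⟩
  funext v
  refine mul_left_cancel₀ (coe_magicTr_idem_ne_zero hB) ?_
  have h0 : subIdem F φ * magicElt hB σ (Subgroup.inclusion inf_le_right v) =
      magicElt hB σ (Subgroup.inclusion inf_le_right v) := by
    rw [← idem_mul_magicElt, ← mul_assoc, hB.idem_φ_mul_idem]
  have h1 : ∀ l : ↥(H ⊓ K), δ (l : G) * magicElt hB σ (Subgroup.inclusion inf_le_right v) =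
      magicElt hB σ (Subgroup.inclusion inf_le_right
        (Subgroup.inclusion (inf_le_inf_right_of_le hU) l * v)) := by
    intro l
    rw [map_mul, magicElt_mul hσ]
    have h2 : magicElt hB σ (Subgroup.inclusion inf_le_right
        (Subgroup.inclusion (inf_le_inf_right_of_le hU) l)) =
        magicIdem F θ φ * δ (l : G) := magicElt_of_mem l.2.2
    rw [h2, ← hB.idem_comm, mul_assoc, idem_mul_magicElt]
  have h2 := congrArg (linFun F (extZero U f)) h0
  rw [subIdem_eq_sum hB.val_φ, smul_mul_assoc, Finset.sum_mul] at h2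
  simp only [smul_mul_assoc, h1, map_smul, map_sum, linFun_magicElt] at h2
  rw [← h2, aboveProj_apply, Algebra.smul_def, map_div₀, map_natCast,
    algebraMap_charVal (mem_range_of_mem hB.val_φ), mul_left_comm]
  congr 1
  rw [Finset.mul_sum]
  refine Finset.sum_congr rfl fun l _ => ?_
  rw [Algebra.smul_def, algebraMap_charVal (mem_range_of_mem hB.val_φ)]
  ring

omit hσ in
-- Here c_1 = i lies in FK, where f is f(1)/θ(1) times θ, and θ(i) = φ(1) tr(i).
theorem magicMap_one : magicMap hB σ U f 1 = f 1 / θ 1 * φ 1 := by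
  refine mul_left_cancel₀ (coe_magicTr_idem_ne_zero hB) ?_
  rw [← linFun_magicElt, map_one, magicElt_one, linFun_of_mem hB hf BasicConfig.idem_mem,
    coe_thetaTr_idem hB]
  ring

omit hσ hf in
/-- The algebra `i F U i` is spanned by the products of elements of `S` and of the complement. -/
theorem idem_mul_of_mul_idem_mem (hU : K ≤ U) (u : U) :
    magicIdem F θ φ * δ (u : G) * magicIdem F θ φ ∈ Submodule.span F {x | ∃ s ∈ magicSub F θ φ,
      ∃ h : ↥(U ⊓ H), x = s * magicElt hB σ (Subgroup.inclusion inf_le_right h)} := by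
  -- Factoring the inverse of u puts the K-part first in u, so that h⁻¹ can be moved past i.
  obtain ⟨h, hh, k, hk, hu⟩ := hB.exists_mul (u : G)⁻¹
  have hu' : (u : G) = k⁻¹ * h⁻¹ := by rw [← mul_inv_rev, ← hu, inv_inv]
  have hhU : h⁻¹ ∈ U := by
    have : h⁻¹ = k * u := by rw [hu', mul_inv_cancel_left]
    rw [this]
    exact U.mul_mem (hU hk) u.2
  rw [hu', map_mul (MonoidAlgebra.of F G), mul_assoc, mul_assoc, hB.of_mul_idem (inv_mem hh),
    ← mul_assoc, ← mul_assoc, idem_mul_mul_idem_eq_sum hB, smul_mul_assoc, Finset.sum_mul]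
  refine Submodule.smul_mem _ _ (Submodule.sum_mem _ fun l _ => Submodule.subset_span ?_)
  rw [mul_assoc, ← map_mul, ← map_mul]
  have hw : (l : G)⁻¹ * h⁻¹ ∈ U ⊓ H := ⟨U.mul_mem (U.inv_mem (hU l.2.2)) hhU,
    H.mul_mem (H.inv_mem l.2.1) (H.inv_mem hh)⟩
  have hP : magicProj F θ φ (δ (k⁻¹ * (l : G))) ∈ magicSub F θ φ :=
    magicProj_mem hB (of_mem_subgroupAlg F (⟨_, K.mul_mem (K.inv_mem hk) l.2.2⟩ : K))
  -- For w = l⁻¹h⁻¹ in U ∩ H, the element iw equals σ(Lw)c_w, so σ(Lw) joins the factor from S.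
  refine ⟨_, mul_mem hP (magicUnit_mem (hB := hB) (σ := σ)
    (Subgroup.inclusion inf_le_right ⟨_, hw⟩)), ⟨_, hw⟩, ?_⟩
  rw [mul_assoc, magicUnit_mul_magicElt, ← mul_assoc, mul_idem_of_mem_magicSub hB hP]
  rfl

/-- The values on `i F U i` are determined by `ι`. -/
theorem linFun_idem_mul_of_mul_idem (h0 : magicMap hB σ U f = 0) (u : U) :
    linFun F (extZero U f) (magicIdem F θ φ * δ (u : G) * magicIdem F θ φ) = 0 := by
  refine (Submodule.span_le (p := LinearMap.ker (linFun F (extZero U f)))).2 ?_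
    (idem_mul_of_mul_idem_mem (hB := hB) (σ := σ) hU u)
  rintro _ ⟨s, hs, h, rfl⟩
  have h1 := linFun_mul_magicElt hσ hf hs (Subgroup.inclusion inf_le_right h)
  rw [linFun_magicElt, h0, Pi.zero_apply, mul_zero, mul_zero] at h1
  exact (mul_eq_zero.1 h1).resolve_left (coe_magicTr_idem_ne_zero hB)

/-- If f vanishes on i(FU)i, it vanishes on all products of K-conjugates of i with elements of U.
Under f these conjugates add up to a nonzero scalar, so f itself is zero. -/
theorem eq_zero_of_magicMap_eq_zero (h0 : magicMap hB σ U f = 0) : f = 0 := by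
  funext u
  have h1 := sum_linFun_mul_conj hB hf (BasicConfig.idem_mem (F := F) (θ := θ) (φ := φ)) (δ (u : G))
  have h2 : ∀ k : K, linFun F (extZero U f)
      (δ (k : G) * magicIdem F θ φ * δ (k : G)⁻¹ * δ (u : G)) = 0 := by
    intro k
    have hk : δ (k : G) ∈ subgroupAlg F U := of_mem_subgroupAlg F (⟨k, hU k.2⟩ : U)
    have hi : magicIdem F θ φ ∈ subgroupAlg F U := subgroupAlg_mono hU BasicConfig.idem_mem
    have h3 := linFun_idem_mul_of_mul_idem hσ hf h0
      ⟨_, U.mul_mem (U.mul_mem (U.inv_mem (hU k.2)) u.2) (hU k.2)⟩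
    rw [← h3, ← linFun_extZero_mul_comm hf.1 hi, ← mul_assoc, hB.idem,
      map_mul (MonoidAlgebra.of F G), map_mul (MonoidAlgebra.of F G), mul_assoc (δ (k : G)), mul_assoc (δ (k : G)), linFun_extZero_mul_comm hf.1 hk]
    simp only [mul_assoc]
  rw [Finset.sum_eq_zero fun k _ => h2 k, linFun_of, extZero_coe, coe_thetaTr_idem hB] at h1
  have hθ := hB.irr_θ.one_ne_zero
  have hφ := hB.irr_φ.one_ne_zero
  have hcardK := natCard_ne_zero' K
  have hm := coe_magicTr_idem_ne_zero hB
  have h5 : (Nat.card K : ℂ) / θ 1 * (φ 1 * magicTr F θ φ (magicIdem F θ φ)) ≠ 0 := by positivity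
  exact (mul_eq_zero.1 h1.symm).resolve_left h5

end Iota

/-! ### The inverse of `ι` -/

section Inverse

variable {G : Type*} [Group G] [Finite G] {F : Subfield ℂ} {H K : Subgroup G} [hK : K.Normal]
  {θ : K → ℂ} {φ : ↥(H ⊓ K) → ℂ} {U : Subgroup G} {hU : K ≤ U}

local notation "δ" => MonoidAlgebra.of F G

theorem natCard_mul_natCard (hmul : ∀ g : G, ∃ h ∈ H, ∃ k ∈ K, g = h * k) (hU : K ≤ U) :
    (Nat.card ↥(U ⊓ H) : ℂ) * Nat.card K = Nat.card ↥(H ⊓ K) * Nat.card U := by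
  have h := sum_sum_mul_eq hmul hU fun _ => (1 : ℂ)
  simpa only [Finset.sum_const, Finset.card_univ, Fintype.card_eq_nat_card, nsmul_eq_mul, mul_one]
    using h

variable (hB : BasicConfig F H K θ φ) (σ : H ⧸ K.subgroupOf H →* (MagicAlg hB)ˣ)

/-- The inverse of `ι`. -/
def magicInv (U : Subgroup G) (f : ↥(U ⊓ H) → ℂ) (u : U) : ℂ :=
  θ 1 / (Nat.card K * Nat.card ↥(U ⊓ H) * magicTr F θ φ (magicIdem F θ φ)) *
    ∑ x : U, ∑ h : ↥(U ⊓ H), (thetaTr F θ (δ (x : G) * δ (u : G) * δ (x : G)⁻¹ *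
      magicElt hB σ (Subgroup.inclusion inf_le_right h)⁻¹) : F) * f h

variable {hB σ}

/-- c_h lies in FK·h, so θ sees it only for h in K; for such h it is ih, and θ(ih) = tr(i)φ(h).
Hence h ↦ θ(c_h) is a multiple of φ extended by zero. -/
theorem thetaTr_magicElt (h : H) : ((thetaTr F θ (magicElt hB σ h) : F) : ℂ) =
    extZero (H ⊓ K) (fun l => magicTr F θ φ (magicIdem F θ φ) * φ l) h := by
  by_cases hh : (h : G) ∈ K
  · rw [extZero_of_mem (V := H ⊓ K) _ ⟨h.2, hh⟩, magicElt_of_mem hh, ← hB.coe_φ, ← Subfield.coe_mul,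
      ← magicTr_mul_of hB hB.unit.1]
  · rw [extZero_of_notMem (V := H ⊓ K) _ fun h1 => hh h1.2, magicElt, thetaTr, linFun_extZero_mul_of _ hh]
    · rfl
    · exact mem_subgroupAlg_of_mem_magicSub (magicUnit_mem _)

/-- Convolution with φ is a multiple of the projection given by e_φ, so this kernel reproduces
functions above φ. -/
theorem sum_thetaTr_magicElt (hU : K ≤ U) {f : ↥(U ⊓ H) → ℂ}
    (hf : IsAbove (inf_le_inf_right_of_le hU) φ f) (z : ↥(U ⊓ H)) :
    ∑ h : ↥(U ⊓ H), ((thetaTr F θ (magicElt hB σ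
      (Subgroup.inclusion inf_le_right (z * h⁻¹))) : F) : ℂ) * f h =
      magicTr F θ φ (magicIdem F θ φ) * (Nat.card ↥(H ⊓ K) / φ 1) * f z := by
  have hcard := natCard_ne_zero' ↥(H ⊓ K)
  have hφ := hB.irr_φ.one_ne_zero
  have h1 := sum_extZero_mul (V := H ⊓ K) (W := U ⊓ H)
    (fun l => (magicTr F θ φ (magicIdem F θ φ) : ℂ) * φ l)
    (extZero (U ⊓ H) fun w => f (w⁻¹ * z)) (inf_le_inf_right_of_le hU)
  have h2 := congrFun hf.2 z
  rw [aboveProj_apply] at h2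
  rw [← h2, ← Equiv.sum_comp ((Equiv.inv ↥(U ⊓ H)).trans (Equiv.mulRight z))]
  simp only [Equiv.trans_apply, Equiv.inv_apply, Equiv.coe_mulRight, mul_inv_rev, inv_inv,
    mul_inv_cancel_left, thetaTr_magicElt]
  refine Eq.trans (Finset.sum_congr rfl fun w _ => ?_) (h1.trans ?_)
  · rw [extZero_coe]
    rfl
  · rw [← Equiv.sum_comp (Equiv.inv ↥(H ⊓ K)), ← mul_assoc]
    have h3 : (magicTr F θ φ (magicIdem F θ φ) : ℂ) * (Nat.card ↥(H ⊓ K) / φ 1) *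
        (φ 1 / Nat.card ↥(H ⊓ K)) = magicTr F θ φ (magicIdem F θ φ) := by
      field_simp
    rw [h3, Finset.mul_sum]
    refine Finset.sum_congr rfl fun l _ => ?_
    rw [Equiv.inv_apply, extZero_of_mem _ (inf_le_inf_right_of_le hU l⁻¹.2), mul_assoc]
    congr 3
    exact Subtype.ext (by simp)

theorem linFun_magicInv (f : ↥(U ⊓ H) → ℂ) {a : MonoidAlgebra F G} (ha : a ∈ subgroupAlg F U) :
    linFun F (extZero U (magicInv hB σ U f)) a =
      θ 1 / (Nat.card K * Nat.card ↥(U ⊓ H) * magicTr F θ φ (magicIdem F θ φ)) *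
    ∑ x : U, ∑ h : ↥(U ⊓ H), (thetaTr F θ (δ (x : G) * a * δ (x : G)⁻¹ *
      magicElt hB σ (Subgroup.inclusion inf_le_right h)⁻¹) : F) * f h := by
  induction ha using subgroupAlg_induction with
  | hof v =>
    rw [linFun_of, extZero_coe]
    rfl
  | hadd a b _ _ ha hb =>
    simp only [map_add, mul_add, add_mul, Finset.sum_add_distrib, Subfield.coe_add] at ha hb ⊢
    rw [ha, hb]
  | hsmul r a _ ha =>
    simp only [mul_smul_comm, smul_mul_assoc, map_smul, smul_eq_mul, Subfield.coe_mul] at ha ⊢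
    simp only [mul_assoc, ← Finset.mul_sum] at ha ⊢
    rw [ha, Subfield.smul_def, smul_eq_mul, mul_left_comm]

variable (hσ : IsMagic hB σ)

/-- The sum over x in U makes the function conjugation invariant; e_θ is central and does not change
the values of θ. -/
theorem isAbove_magicInv (f : ↥(U ⊓ H) → ℂ) : IsAbove hU θ (magicInv hB σ U f) := by
  have hconj : ∀ u v : U, magicInv hB σ U f (v * u * v⁻¹) = magicInv hB σ U f u := by
    intro u v
    rw [magicInv, magicInv]
    refine congrArg (HMul.hMul (_ : ℂ)) ?_
    refine Fintype.sum_equiv (Equiv.mulRight v) _ _ fun x => ?_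
    simp only [Equiv.coe_mulRight, Subgroup.coe_mul, Subgroup.coe_inv, map_mul, mul_inv_rev,
      mul_assoc]
  refine ⟨fun g h => ?_, ?_⟩
  · rw [← hconj (h * g) g]
    congr 1
    group
  · funext u
    rw [← linFun_subIdem_mul_of hU hB.val_θ, linFun_magicInv, magicInv]
    · refine congrArg (HMul.hMul (_ : ℂ)) ?_
      refine Finset.sum_congr rfl fun x _ => Finset.sum_congr rfl fun h _ => ?_
      refine congrArg (fun t : F => (t : ℂ) * f h) ?_
      rw [← mul_assoc, hB.idem_θ_central]
      simp only [mul_assoc]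
      rw [thetaTr_idem_mul hB]
    · exact mul_mem (subIdem_mem_of_le hU _) (of_mem_subgroupAlg F u)

include hσ

theorem sum_thetaTr_conj_mul_magicElt (hU : K ≤ U) (y h : H) :
    ∑ x : U, thetaTr F θ (δ (x : G) * magicElt hB σ y * δ (x : G)⁻¹ * magicElt hB σ h) =
      (charVal F φ 1 * Nat.card K / (charVal F θ 1 * Nat.card ↥(H ⊓ K)) *
        magicTr F θ φ (magicIdem F θ φ)) * ∑ g : ↥(U ⊓ H), thetaTr F θ (magicElt hB σ
          (Subgroup.inclusion inf_le_right g * y * (Subgroup.inclusion inf_le_right g)⁻¹ * h)) := by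
  have h1 := congrArg (fun a => thetaTr F θ (a * magicElt hB σ h))
    (sum_conj_mul_magicElt_of_le hσ hB.unit.1 y hU)
  simp only [smul_mul_assoc, Finset.sum_mul, map_smul, map_sum, idem_mul_magicElt, smul_eq_mul,
    ← magicElt_mul hσ] at h1
  rw [← h1]
  refine Finset.sum_congr rfl fun x _ => ?_
  rw [mul_assoc (magicIdem F θ φ * _), idem_mul_magicElt, mul_assoc (magicIdem F θ φ),
    thetaTr_mul_comm hB BasicConfig.idem_mem, mul_assoc _ (magicElt hB σ h), magicElt_mul_idem]

/-- Evaluated at c_y, the sum over U in the inverse becomes a sum over U ∩ H, where the kernel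
θ(c_h) reproduces f; f being a class function makes all remaining terms equal, and |U ∩ H||K| =
|L||U| is encoded in the constants. -/
theorem magicMap_magicInv {f : ↥(U ⊓ H) → ℂ} (hf : IsAbove (inf_le_inf_right_of_le hU) φ f) :
    magicMap hB σ U (magicInv hB σ U f) = f := by
  have hcard := natCard_mul_natCard hB.exists_mul hU
  have hcardV := natCard_ne_zero' ↥(U ⊓ H)
  have hcardL := natCard_ne_zero' ↥(H ⊓ K)
  have hcardK := natCard_ne_zero' K
  have hm := coe_magicTr_idem_ne_zero hB
  have hθ := hB.irr_θ.one_ne_zero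
  have hφ := hB.irr_φ.one_ne_zero
  funext y
  refine mul_left_cancel₀ (coe_magicTr_idem_ne_zero hB) ?_
  have hy : magicElt hB σ (Subgroup.inclusion inf_le_right y) ∈ subgroupAlg F U :=
    magicElt_mem hU y.2.1
  rw [← linFun_magicElt, linFun_magicInv _ hy, Finset.sum_comm]
  have h1 : ∀ h : ↥(U ⊓ H), ∑ x : U, ((thetaTr F θ (δ (x : G) *
      magicElt hB σ (Subgroup.inclusion inf_le_right y) * δ (x : G)⁻¹ *
      magicElt hB σ (Subgroup.inclusion inf_le_right h)⁻¹) : F) : ℂ) * f h =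
      (φ 1 * Nat.card K / (θ 1 * Nat.card ↥(H ⊓ K)) * magicTr F θ φ (magicIdem F θ φ)) *
      ∑ g : ↥(U ⊓ H), ((thetaTr F θ (magicElt hB σ (Subgroup.inclusion inf_le_right
        (g * y * g⁻¹ * h⁻¹))) : F) : ℂ) * f h := by
    intro h
    have h2 := congrArg (algebraMap F ℂ) (sum_thetaTr_conj_mul_magicElt hσ hU
      (Subgroup.inclusion inf_le_right y) (Subgroup.inclusion inf_le_right h)⁻¹)
    simp only [map_sum, map_mul, map_div₀, map_natCast,
      algebraMap_charVal (mem_range_of_mem hB.val_θ),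
      algebraMap_charVal (mem_range_of_mem hB.val_φ)] at h2
    rw [← Finset.sum_mul]
    refine (congrArg (· * f h) h2).trans ?_
    rw [mul_assoc, Finset.sum_mul]
    rfl
  simp only [h1]
  rw [← Finset.mul_sum, Finset.sum_comm]
  simp only [sum_thetaTr_magicElt hU hf]
  have h2 : ∀ g : ↥(U ⊓ H), f (g * y * g⁻¹) = f y := fun g => by
    rw [hf.1, inv_mul_cancel_left]
  simp only [h2]
  rw [Finset.sum_const, Finset.card_univ, Fintype.card_eq_nat_card, nsmul_eq_mul]
  field_simp

omit hσ in
/-- The maps `magicMap` and `magicInv` are adjoint. -/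
theorem sum_magicInv_mul (f : ↥(U ⊓ H) → ℂ) {χ : U → ℂ} (hχ : IsAbove hU θ χ) :
    (Nat.card U : ℂ)⁻¹ * ∑ u : U, magicInv hB σ U f u * χ u⁻¹ =
      (Nat.card ↥(U ⊓ H) : ℂ)⁻¹ * ∑ h : ↥(U ⊓ H), f h * magicMap hB σ U χ h⁻¹ := by
  have hcardU := natCard_ne_zero' U
  have hcardV := natCard_ne_zero' ↥(U ⊓ H)
  have hcardK := natCard_ne_zero' K
  have hm := coe_magicTr_idem_ne_zero hB
  have hθ := hB.irr_θ.one_ne_zero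
  -- The kernel given by θ reproduces functions above θ, just as φ does on the side of H. It is
  -- applied to a = c_{h⁻¹} after absorbing the conjugation by x.
  have h1 : ∀ {a : MonoidAlgebra F G}, a ∈ subgroupAlg F U →
      ∑ u : U, ((thetaTr F θ (δ (u : G) * a) : F) : ℂ) * χ u⁻¹ =
        Nat.card K / θ 1 * linFun F (extZero U χ) a := by
    intro a ha
    induction ha using subgroupAlg_induction with
    | hof v =>
      have h2 := congrFun hχ.2 v
      have h3 := sum_extZero_mul (V := K) (W := U) θ (extZero U fun w => χ (w⁻¹ * v)) hU
      rw [linFun_of, extZero_coe, ← h2, aboveProj_apply,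
        ← Equiv.sum_comp (Equiv.mulRight v⁻¹)]
      refine Eq.trans (Finset.sum_congr rfl fun u _ => ?_) (h3.trans ?_)
      · rw [thetaTr, coe_linFun_charVal hB.val_θ, extZero_coe, Equiv.coe_mulRight, ← map_mul,
          linFun_of, Subgroup.coe_mul, Subgroup.coe_inv, inv_mul_cancel_right, hχ.1 u⁻¹]
        simp
      · rw [← Equiv.sum_comp (Equiv.inv K), ← mul_assoc]
        have h3 : (Nat.card K : ℂ) / θ 1 * (θ 1 / Nat.card K) = 1 := by field_simp
        rw [h3, one_mul]
        refine Finset.sum_congr rfl fun l _ => ?_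
        rw [Equiv.inv_apply, extZero_of_mem _ (hU l⁻¹.2)]
        congr 2
        exact congrArg (· * v) (Subtype.ext (by simp))
    | hadd a b _ _ ha hb =>
      simp only [map_add, mul_add, add_mul, Finset.sum_add_distrib, Subfield.coe_add] at ha hb ⊢
      rw [ha, hb]
    | hsmul r a _ ha =>
      simp only [mul_smul_comm, map_smul, smul_eq_mul, Subfield.coe_mul] at ha ⊢
      simp only [mul_assoc, ← Finset.mul_sum]
      rw [ha, Subfield.smul_def, smul_eq_mul, mul_left_comm (r : ℂ)]
  have h2 : ∀ (x : U) (h : ↥(U ⊓ H)), ∑ u : U, ((thetaTr F θ (δ (x : G) * δ (u : G) * δ (x : G)⁻¹ *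
      magicElt hB σ (Subgroup.inclusion inf_le_right h)⁻¹) : F) : ℂ) * f h * χ u⁻¹ =
      Nat.card K / θ 1 * magicTr F θ φ (magicIdem F θ φ) * (f h * magicMap hB σ U χ h⁻¹) := by
    intro x h
    have h3 := h1 (magicElt_mem (hB := hB) (σ := σ) hU
      (h := (Subgroup.inclusion inf_le_right h)⁻¹) (U.inv_mem h.2.1))
    rw [← map_inv, linFun_magicElt, map_inv] at h3
    rw [mul_assoc, mul_left_comm (magicTr F θ φ (magicIdem F θ φ) : ℂ), mul_left_comm, ← h3,
      Finset.mul_sum]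
    refine Fintype.sum_equiv (MulAut.conj x).toEquiv _ _ fun u => ?_
    have h4 : χ (x * (u * x⁻¹))⁻¹ = χ u⁻¹ := by
      rw [← mul_assoc, mul_inv_rev, inv_inv, mul_inv_rev, hχ.1, inv_mul_cancel_right]
    simp only [MulEquiv.toEquiv_eq_coe, EquivLike.coe_coe, MulAut.conj_apply, Subgroup.coe_mul,
      Subgroup.coe_inv, map_mul (MonoidAlgebra.of F G), mul_assoc]
    rw [h4, mul_left_comm]
  have h3 : ∑ u : U, (∑ x : U, ∑ h : ↥(U ⊓ H), ((thetaTr F θ (δ (x : G) * δ (u : G) * δ (x : G)⁻¹ *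
      magicElt hB σ (Subgroup.inclusion inf_le_right h)⁻¹) : F) : ℂ) * f h) * χ u⁻¹ =
      Nat.card U * (Nat.card K / θ 1 * magicTr F θ φ (magicIdem F θ φ) *
        ∑ h : ↥(U ⊓ H), f h * magicMap hB σ U χ h⁻¹) := by
    simp only [Finset.sum_mul]
    rw [Finset.sum_comm]
    have h4 : ∀ x : U, ∑ u : U, ∑ h : ↥(U ⊓ H), ((thetaTr F θ (δ (x : G) * δ (u : G) * δ (x : G)⁻¹ *
      magicElt hB σ (Subgroup.inclusion inf_le_right h)⁻¹) : F) : ℂ) * f h * χ u⁻¹ =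
      Nat.card K / θ 1 * magicTr F θ φ (magicIdem F θ φ) *
        ∑ h : ↥(U ⊓ H), f h * magicMap hB σ U χ h⁻¹ := by
      intro x
      rw [Finset.sum_comm, Finset.mul_sum]
      exact Finset.sum_congr rfl fun h _ => h2 x h
    simp only [h4]
    rw [Finset.sum_const, Finset.card_univ, Fintype.card_eq_nat_card, nsmul_eq_mul]
  simp only [magicInv, mul_assoc, ← Finset.mul_sum] at h3 ⊢
  rw [h3]
  field_simp

/-- The right inverse of an injective linear map is also a left inverse. -/
theorem magicInv_magicMap {f : U → ℂ} (hf : IsAbove hU θ f) :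
    magicInv hB σ U (magicMap hB σ U f) = f := by
  have h1 : IsAbove hU θ (magicInv hB σ U (magicMap hB σ U f)) := isAbove_magicInv _
  have h2 := magicMap_magicInv (hU := hU) hσ (isAbove_magicMap hσ hf)
  have h3 := fun {g} => mem_irrAboveSpan_iff (f := g) hB.irr_θ (hB.exists_invariant_θ U) (hN := hU)
  rw [← sub_eq_zero]
  refine eq_zero_of_magicMap_eq_zero (hU := hU) hσ (h3.1 (Submodule.sub_mem _ (h3.2 h1) (h3.2 hf))) ?_
  rw [map_sub, h2, sub_self]

/-- The map `ι` preserves the symmetric bilinear form of class functions. -/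
theorem sum_magicMap_mul_magicMap {f χ : U → ℂ} (hf : IsAbove hU θ f) (hχ : IsAbove hU θ χ) :
    (Nat.card ↥(U ⊓ H) : ℂ)⁻¹ * ∑ h : ↥(U ⊓ H), magicMap hB σ U f h * magicMap hB σ U χ h⁻¹ =
      (Nat.card U : ℂ)⁻¹ * ∑ u : U, f u * χ u⁻¹ := by
  rw [← sum_magicInv_mul _ hχ, magicInv_magicMap hσ hf]

end Inverse

/-! ### Irreducible characters -/

section Irr

variable {G : Type*} [Group G] [Finite G] {F : Subfield ℂ} {H K : Subgroup G} [hK : K.Normal]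
  {θ : K → ℂ} {φ : ↥(H ⊓ K) → ℂ} {U : Subgroup G} {hU : K ≤ U}

local notation "δ" => MonoidAlgebra.of F G

section

variable {N V : Subgroup G} {hN : N ≤ V} {η : N → ℂ}

theorem mem_irrAbove_iff (hη : IsIrrChar η)
    (hinv : ∀ v ∈ V, ∀ n : N, ∃ h : v * n * v⁻¹ ∈ N, η ⟨v * n * v⁻¹, h⟩ = η n) {χ : V → ℂ} :
    χ ∈ irrAbove hN η ↔ IsIrrChar χ ∧ IsAbove hN η χ := by
  classical
  refine ⟨fun h => ⟨h.1, (mem_irrAboveSpan_iff hη hinv).1 (Submodule.subset_span h)⟩, fun h => ?_⟩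
  have h1 := aboveProj_irr_eq_ite (hN := hN) hη hinv h.1
  rw [h.2.2] at h1
  by_contra h2
  rw [if_neg h2] at h1
  exact h.1.one_ne_zero (congrFun h1 1)

theorem classInner_eq_classInner_partAbove {f : V → ℂ} (hf : f ∈ irrAboveSpan hN η) (γ : V → ℂ) :
    classInner f (partAbove hN η γ) = classInner f γ := by
  rw [← classInner_conj_symm, ← classInner_conj_symm γ f]
  congr 1
  rw [← sub_eq_zero]
  induction hf using Submodule.span_induction with
  | mem χ hχ => rw [classInner_partAbove γ hχ, sub_self]
  | zero => simp [← classInnerₗ_apply]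
  | add a b _ _ ha hb =>
    simp only [← classInnerₗ_apply, map_add] at ha hb ⊢
    rw [add_sub_add_comm, ha, hb, add_zero]
  | smul r a _ ha =>
    simp only [← classInnerₗ_apply, map_smulₛₗ] at ha ⊢
    rw [← smul_sub, ha, smul_zero]

end

variable {hB : BasicConfig F H K θ φ} {σ : H ⧸ K.subgroupOf H →* (MagicAlg hB)ˣ}
  (hσ : IsMagic hB σ)

include hB in
theorem BasicConfig.mem_irrAboveSpan_θ_iff {f : U → ℂ} :
    f ∈ irrAboveSpan hU θ ↔ IsAbove hU θ f :=
  mem_irrAboveSpan_iff hB.irr_θ (hB.exists_invariant_θ U)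

include hB in
theorem BasicConfig.mem_irrAboveSpan_φ_iff (hU : K ≤ U) {f : ↥(U ⊓ H) → ℂ} :
    f ∈ irrAboveSpan (inf_le_inf_right_of_le hU) φ ↔ IsAbove (inf_le_inf_right_of_le hU) φ f :=
  mem_irrAboveSpan_iff hB.irr_φ (hB.exists_invariant_φ U)

include hB in
theorem BasicConfig.mem_irrAbove_θ_iff {f : U → ℂ} :
    f ∈ irrAbove hU θ ↔ IsIrrChar f ∧ IsAbove hU θ f :=
  mem_irrAbove_iff hB.irr_θ (hB.exists_invariant_θ U)

include hB in
theorem BasicConfig.mem_irrAbove_φ_iff (hU : K ≤ U) {f : ↥(U ⊓ H) → ℂ} :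
    f ∈ irrAbove (inf_le_inf_right_of_le hU) φ ↔
      IsIrrChar f ∧ IsAbove (inf_le_inf_right_of_le hU) φ f :=
  mem_irrAbove_iff hB.irr_φ (hB.exists_invariant_φ U)

include hσ

/-- The product relation of χ, evaluated at c_a and c_b, contains an average of conjugates of c_a
over U. The averaging identity replaces it by an average over U ∩ H, and comparing group orders
gives the same relation for the image. -/
theorem magicMap_product_formula {χ : U → ℂ} (hχ : IsIrrChar χ) (hχ' : IsAbove hU θ χ)
    (a b : ↥(U ⊓ H)) :
    magicMap hB σ U χ 1 * ∑ u : ↥(U ⊓ H), magicMap hB σ U χ (u * a * u⁻¹ * b) =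
      Nat.card ↥(U ⊓ H) * (magicMap hB σ U χ a * magicMap hB σ U χ b) := by
  have hcard := natCard_mul_natCard hB.exists_mul hU
  have hcardV := natCard_ne_zero' ↥(U ⊓ H)
  have hcardL := natCard_ne_zero' ↥(H ⊓ K)
  have hcardK := natCard_ne_zero' K
  have hm := coe_magicTr_idem_ne_zero hB
  have hθ := hB.irr_θ.one_ne_zero
  have hφ := hB.irr_φ.one_ne_zero
  have hχ1 := hχ.one_ne_zero
  have ha : magicElt hB σ (Subgroup.inclusion inf_le_right a) ∈ subgroupAlg F U :=
    magicElt_mem hU a.2.1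
  have hb : magicElt hB σ (Subgroup.inclusion inf_le_right b) ∈ subgroupAlg F U :=
    magicElt_mem hU b.2.1
  have hi : magicIdem F θ φ ∈ subgroupAlg F U := subgroupAlg_mono hU BasicConfig.idem_mem
  have h1 := congrArg (fun x => linFun F (extZero U χ)
    (x * magicElt hB σ (Subgroup.inclusion inf_le_right b)))
    (sum_conj_mul_magicElt_of_le hσ hB.unit.1 (Subgroup.inclusion inf_le_right a) hU)
  simp only [smul_mul_assoc, Finset.sum_mul, map_smul, map_sum, idem_mul_magicElt,
    ← magicElt_mul hσ] at h1
  have h2 : ∀ x : U, linFun F (extZero U χ) (magicIdem F θ φ *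
      (δ (x : G) * magicElt hB σ (Subgroup.inclusion inf_le_right a) * δ (x : G)⁻¹) *
      magicIdem F θ φ * magicElt hB σ (Subgroup.inclusion inf_le_right b)) =
      linFun F (extZero U χ) (δ (x : G) * magicElt hB σ (Subgroup.inclusion inf_le_right a) *
        δ (x : G)⁻¹ * magicElt hB σ (Subgroup.inclusion inf_le_right b)) := by
    intro x
    rw [mul_assoc (magicIdem F θ φ * _), idem_mul_magicElt, mul_assoc (magicIdem F θ φ),
      linFun_extZero_mul_comm hχ'.1 hi, mul_assoc _ (magicElt hB σ _) (magicIdem F θ φ),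
      magicElt_mul_idem]
  have h3 : ∀ x : ↥(U ⊓ H), linFun F (extZero U χ) (magicElt hB σ
      (Subgroup.inclusion inf_le_right x * Subgroup.inclusion inf_le_right a *
        (Subgroup.inclusion inf_le_right x)⁻¹ * Subgroup.inclusion inf_le_right b)) =
      magicTr F θ φ (magicIdem F θ φ) * magicMap hB σ U χ (x * a * x⁻¹ * b) :=
    fun x => linFun_magicElt χ (x * a * x⁻¹ * b)
  have h4 := hχ.sum_linFun_conj_mul ha hb
  simp only [h2, h3] at h1
  rw [h1, linFun_magicElt, linFun_magicElt, ← Finset.mul_sum, Subfield.smul_def, smul_eq_mul] at h4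
  have h5 : ((charVal F φ 1 * Nat.card K / (charVal F θ 1 * Nat.card ↥(H ⊓ K)) *
      magicTr F θ φ (magicIdem F θ φ) : F) : ℂ) = φ 1 * Nat.card K / (θ 1 * Nat.card ↥(H ⊓ K)) *
      magicTr F θ φ (magicIdem F θ φ) := by
    rw [Subfield.coe_mul, Subfield.coe_div, Subfield.coe_mul, Subfield.coe_mul, hB.coe_φ, hB.coe_θ]
    rfl
  rw [h5] at h4
  rw [magicMap_one hχ']
  field_simp at h4 ⊢
  refine mul_left_cancel₀ hcardK ?_
  linear_combination h4 - θ 1 * magicMap hB σ U χ a * magicMap hB σ U χ b * hcard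

/-- The criterion applies: the degree χ(1)φ(1)/θ(1) is positive, the product relation is
transported, and the norm is preserved. -/
theorem isIrrChar_magicMap {χ : U → ℂ} (hχ : χ ∈ irrAbove hU θ) :
    IsIrrChar (magicMap hB σ U χ) := by
  have hχ' := (hB.mem_irrAbove_θ_iff.1 hχ).2
  obtain ⟨a, ha, ha'⟩ := hχ.1.exists_one_eq
  obtain ⟨b, hb, hb'⟩ := hB.irr_θ.exists_one_eq
  obtain ⟨c, hc, hc'⟩ := hB.irr_φ.exists_one_eq
  refine isIrrChar_of_sum_conj_mul (r := (a : ℝ) / b * c) (magicMap_mul_comm hσ hχ') ?_ ?_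
    (magicMap_product_formula hσ hχ.1 hχ') ?_
  · positivity
  · rw [magicMap_one hχ', ha', hb', hc']
    push_cast
    rfl
  · have h1 := sum_magicMap_mul_magicMap hσ hχ' hχ'
    have h2 := hχ.1.classInner_right χ
    rw [hχ.1.classInner hχ.1, if_pos rfl] at h2
    rw [← h2, inv_mul_eq_one₀ (natCard_ne_zero' _)] at h1
    exact h1.symm

theorem magicMap_mem_irrAbove {χ : U → ℂ} (hχ : χ ∈ irrAbove hU θ) :
    magicMap hB σ U χ ∈ irrAbove (inf_le_inf_right_of_le hU) φ :=
  (hB.mem_irrAbove_φ_iff hU).2 ⟨isIrrChar_magicMap hσ hχ,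
    isAbove_magicMap hσ (hB.mem_irrAbove_θ_iff.1 hχ).2⟩

/-- `ι` is an isometry. -/
theorem classInner_magicMap {f χ : U → ℂ} (hf : IsAbove hU θ f) (hχ : IsAbove hU θ χ) :
    classInner (magicMap hB σ U f) (magicMap hB σ U χ) = classInner f χ := by
  have hχ' := (hB.mem_irrAboveSpan_θ_iff (hU := hU)).2 hχ
  clear hχ
  rw [← sub_eq_zero]
  induction hχ' using Submodule.span_induction with
  | mem χ hχ =>
    -- For an irreducible second argument, complex conjugation is inversion of the group element on
    -- both sides, so the bilinear identity is the Hermitian one; the rest is semilinearity.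
    rw [(isIrrChar_magicMap hσ hχ).classInner_right, hχ.1.classInner_right,
      sum_magicMap_mul_magicMap hσ hf (hB.mem_irrAbove_θ_iff.1 hχ).2, sub_self]
  | zero => simp [← classInnerₗ_apply]
  | add a b _ _ ha hb =>
    simp only [← classInnerₗ_apply, map_add] at ha hb ⊢
    rw [add_sub_add_comm, ha, hb, add_zero]
  | smul r a _ ha =>
    simp only [← classInnerₗ_apply, map_smulₛₗ, RingHom.id_apply] at ha ⊢
    rw [← smul_sub, ha, smul_zero]

/-- Some irreducible η above θ is not orthogonal to χ. By isometry its image is not orthogonal to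
the irreducible image of χ, so the images agree and χ = η. -/
theorem mem_irrAbove_of_magicMap {χ : U → ℂ} (hχ : IsAbove hU θ χ)
    (hξ : magicMap hB σ U χ ∈ irrAbove (inf_le_inf_right_of_le hU) φ) : χ ∈ irrAbove hU θ := by
  classical
  have hχ' := (hB.mem_irrAboveSpan_θ_iff (hU := hU)).2 hχ
  have h1 : ∃ η ∈ irrAbove hU θ, classInner χ η ≠ 0 := by
    by_contra! h
    have h2 := eq_of_classInner_eq hχ' (Submodule.zero_mem _) fun η hη => by
      rw [h η hη, ← classInnerₗ_apply, map_zero, LinearMap.zero_apply]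
    refine hξ.1.one_ne_zero ?_
    rw [h2, map_zero, Pi.zero_apply]
  obtain ⟨η, hη, hne⟩ := h1
  have hη' := (hB.mem_irrAbove_θ_iff.1 hη).2
  rw [← classInner_magicMap hσ hχ hη', hξ.1.classInner (isIrrChar_magicMap hσ hη)] at hne
  have h2 : magicMap hB σ U χ = magicMap hB σ U η := by
    by_contra h
    exact hne (if_neg h)
  rw [← magicInv_magicMap hσ hχ, h2, magicInv_magicMap hσ hη']
  exact hη

/-- The isomorphism `ι`. -/
def magicEquiv (U : Subgroup G) (hU : K ≤ U) :
    irrAboveSpan hU θ ≃ₗ[ℂ] irrAboveSpan (inf_le_inf_right_of_le (H := H) hU) φ where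
  toFun f := ⟨magicMap hB σ U f.1,
    (hB.mem_irrAboveSpan_φ_iff hU).2 (isAbove_magicMap hσ (hB.mem_irrAboveSpan_θ_iff.1 f.2))⟩
  map_add' f g := Subtype.ext (map_add _ f.1 g.1)
  map_smul' r f := Subtype.ext (map_smul _ r f.1)
  invFun f := ⟨magicInv hB σ U f.1, hB.mem_irrAboveSpan_θ_iff.2 (isAbove_magicInv _)⟩
  left_inv f := Subtype.ext (magicInv_magicMap hσ (hB.mem_irrAboveSpan_θ_iff.1 f.2))
  right_inv f := Subtype.ext (magicMap_magicInv (hU := hU) hσ ((hB.mem_irrAboveSpan_φ_iff hU).1 f.2))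

end Irr

/-! ### Compatibilities of `ι` -/

section Functorial

theorem alg_coe {F : Subfield ℂ} (α : ℂ ≃ₐ[F] ℂ) (x : F) : α (x : ℂ) = x := α.commutes x

theorem coe_mem_intermediateField {F : Subfield ℂ} (L : IntermediateField F ℂ) (x : F) :
    (x : ℂ) ∈ L := L.algebraMap_mem x

variable {G : Type*} [Group G] [Finite G] {F : Subfield ℂ}

local notation "δ" => MonoidAlgebra.of F G

section

variable {V W : Subgroup G}

omit [Finite G] in
theorem linFun_resFun (h : V ≤ W) (f : W → ℂ) {a : MonoidAlgebra F G} (ha : a ∈ subgroupAlg F V) :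
    linFun F (extZero V (resFun h f)) a = linFun F (extZero W f) a :=
  linFun_extZero_eq _ (fun v => by rw [linFun_of, extZero_of_mem _ (h v.2)]; rfl) ha

theorem isAbove_resFun {N : Subgroup G} {hN : N ≤ V} {η : N → ℂ} (h : V ≤ W) {f : W → ℂ}
    (hf : IsAbove (hN.trans h) η f) : IsAbove hN η (resFun h f) :=
  ⟨fun x y => hf.1 (Subgroup.inclusion h x) (Subgroup.inclusion h y),
    funext fun v => congrFun hf.2 (Subgroup.inclusion h v)⟩

theorem linFun_indFun (f : V → ℂ) {a : MonoidAlgebra F G} (ha : a ∈ subgroupAlg F W) :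
    linFun F (extZero W (indFun V W f)) a =
      (Nat.card V : ℂ)⁻¹ * ∑ x : W, linFun F (extZero V f) (δ (x : G) * a * δ (x : G)⁻¹) := by
  induction ha using subgroupAlg_induction with
  | hof w => simp only [← map_mul, linFun_of, extZero_coe, indFun_apply]
  | hadd a b _ _ ha hb =>
    simp only [mul_add, add_mul, map_add, Finset.sum_add_distrib, ha, hb]
  | hsmul r a _ ha =>
    simp only [mul_smul_comm, smul_mul_assoc, map_smul, ← Finset.smul_sum, ha]

theorem isAbove_indFun {N : Subgroup G} {hN : N ≤ V} {η : N → ℂ} (hη : ∀ n, η n ∈ F) (h : V ≤ W)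
    (hcomm : ∀ w ∈ W, δ w * subIdem F η = subIdem F η * δ w) {f : V → ℂ}
    (hf : IsAbove hN η f) : IsAbove (hN.trans h) η (indFun V W f) := by
  refine ⟨indFun_mul_comm f, funext fun w => ?_⟩
  rw [← linFun_subIdem_mul_of (hN.trans h) hη, linFun_indFun, indFun_apply]
  · refine congrArg (HMul.hMul (_ : ℂ)) (Finset.sum_congr rfl fun x _ => ?_)
    rw [← mul_assoc, hcomm x x.2, mul_assoc, mul_assoc, ← mul_assoc (δ (x : G)),
      linFun_subIdem_mul hN hη hf, ← map_mul, ← map_mul, linFun_of]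
  · exact mul_mem (subIdem_mem_of_le (hN.trans h) _) (of_mem_subgroupAlg F w)

omit [Finite G] in
theorem linFun_conjFun (f : V → ℂ) (g : G) {a : MonoidAlgebra F G}
    (ha : a ∈ subgroupAlg F (conjSub V g)) :
    linFun F (extZero (conjSub V g) (conjFun f g)) a =
      linFun F (extZero V f) (δ g * a * δ g⁻¹) := by
  induction ha using subgroupAlg_induction with
  | hof w =>
    rw [← map_mul, ← map_mul, linFun_of, linFun_of, extZero_coe]
    exact (extZero_of_mem f w.2).symm
  | hadd a b _ _ ha hb => simp only [mul_add, add_mul, map_add, ha, hb]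
  | hsmul r a _ ha => simp only [mul_smul_comm, smul_mul_assoc, map_smul, ha]

omit [Finite G] in
-- All group elements occurring in a·v lie in the coset Nv, on which β is constant. It is applied to
-- c_h, which lies in FK·h.
theorem linFun_mul_of {N : Subgroup G} (hN : N ≤ V) {β f : V → ℂ}
    (hβ : ∀ (n : N) v, β (Subgroup.inclusion hN n * v) = β v) {a : MonoidAlgebra F G}
    (ha : a ∈ subgroupAlg F N) (v : V) :
    linFun F (extZero V fun u => β u * f u) (a * δ (v : G)) =
      β v * linFun F (extZero V f) (a * δ (v : G)) := by
  induction ha using subgroupAlg_induction with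
  | hof n =>
    have h := V.mul_mem (hN n.2) v.2
    rw [← map_mul, linFun_of, linFun_of, extZero_of_mem _ h, extZero_of_mem _ h]
    exact congrArg (· * _) (hβ n v)
  | hadd a b _ _ ha hb => simp only [mul_add, add_mul, map_add, ha, hb]
  | hsmul r a _ ha => simp only [mul_smul_comm, smul_mul_assoc, map_smul, ha]

theorem isAbove_mul {N : Subgroup G} {hN : N ≤ V} {η : N → ℂ} {β f : V → ℂ}
    (hβ : ∀ (n : N) v, β (Subgroup.inclusion hN n * v) = β v)
    (hβ' : ∀ u v, β (u * v) = β (v * u)) (hf : IsAbove hN η f) :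
    IsAbove hN η fun u => β u * f u := by
  refine ⟨fun u v => congrArg₂ (· * ·) (hβ' u v) (hf.1 u v), funext fun v => ?_⟩
  have h := congrFun hf.2 v
  rw [aboveProj_apply] at h ⊢
  rw [← h]
  simp only [hβ, mul_left_comm _ (β v), ← Finset.mul_sum]

omit [Finite G] in
theorem linFun_alg (α : ℂ ≃ₐ[F] ℂ) (f : V → ℂ) (a : MonoidAlgebra F G) :
    linFun F (extZero V fun v => α (f v)) a = α (linFun F (extZero V f) a) := by
  induction a using MonoidAlgebra.induction_on with
  | of g =>
    rw [linFun_of, linFun_of]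
    by_cases hg : g ∈ V
    · rw [extZero_of_mem _ hg, extZero_of_mem _ hg]
    · rw [extZero_of_notMem _ hg, extZero_of_notMem _ hg, map_zero]
  | add a b ha hb => simp only [map_add, ha, hb]
  | smul r a ha =>
    rw [map_smul, map_smul, ha, Subfield.smul_def, Subfield.smul_def, smul_eq_mul, smul_eq_mul,
      map_mul, alg_coe]

theorem isAbove_alg {N : Subgroup G} {hN : N ≤ V} {η : N → ℂ} (hη : ∀ n, η n ∈ F)
    (α : ℂ ≃ₐ[F] ℂ) {f : V → ℂ} (hf : IsAbove hN η f) : IsAbove hN η fun v => α (f v) := by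
  refine ⟨fun u v => congrArg α (hf.1 u v), funext fun v => ?_⟩
  rw [← linFun_subIdem_mul_of hN hη, linFun_alg, linFun_subIdem_mul_of hN hη, hf.2]

omit [Finite G] in
theorem linFun_mem (L : IntermediateField F ℂ) {f : V → ℂ} (hf : ∀ v, f v ∈ L)
    (a : MonoidAlgebra F G) : linFun F (extZero V f) a ∈ L := by
  induction a using MonoidAlgebra.induction_on with
  | of g =>
    rw [linFun_of]
    by_cases hg : g ∈ V
    · rw [extZero_of_mem _ hg]
      exact hf _
    · rw [extZero_of_notMem _ hg]
      exact zero_mem L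
  | add a b ha hb =>
    rw [map_add]
    exact add_mem ha hb
  | smul r a ha =>
    rw [map_smul]
    exact L.smul_mem ha

end

variable {H K : Subgroup G} [hK : K.Normal] {θ : K → ℂ} {φ : ↥(H ⊓ K) → ℂ} {U : Subgroup G}
  {hU : K ≤ U} {hB : BasicConfig F H K θ φ} {σ : H ⧸ K.subgroupOf H →* (MagicAlg hB)ˣ}

theorem magicMap_eq (f : U → ℂ) (h : ↥(U ⊓ H)) : magicMap hB σ U f h =
    (magicTr F θ φ (magicIdem F θ φ) : ℂ)⁻¹ *
      linFun F (extZero U f) (magicElt hB σ (Subgroup.inclusion inf_le_right h)) := rfl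

theorem magicMap_resFun {U₁ U₂ : Subgroup G} (h₁ : K ≤ U₁) (h₁₂ : U₁ ≤ U₂) (χ : U₂ → ℂ) :
    magicMap hB σ U₁ (resFun h₁₂ χ) = resFun (inf_mono_left h₁₂) (magicMap hB σ U₂ χ) := by
  funext h
  have hm : magicElt hB σ (Subgroup.inclusion inf_le_right h) ∈ subgroupAlg F U₁ :=
    magicElt_mem h₁ h.2.1
  rw [magicMap_eq, linFun_resFun h₁₂ _ hm]
  rfl

theorem magicMap_mul {β f : U → ℂ}
    (hβ : ∀ (n : K) v, β (Subgroup.inclusion hU n * v) = β v) (x : ↥(U ⊓ H)) :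
    magicMap hB σ U (fun u => β u * f u) x =
      β (Subgroup.inclusion inf_le_left x) * magicMap hB σ U f x := by
  rw [magicMap_eq, magicMap_eq, mul_left_comm, magicElt]
  exact congrArg _ (linFun_mul_of hU hβ (mem_subgroupAlg_of_mem_magicSub (magicUnit_mem _))
    (Subgroup.inclusion inf_le_left x))

theorem magicMap_alg (α : ℂ ≃ₐ[F] ℂ) (f : U → ℂ) (x : ↥(U ⊓ H)) :
    magicMap hB σ U (fun u => α (f u)) x = α (magicMap hB σ U f x) := by
  rw [magicMap_eq, magicMap_eq, linFun_alg, map_mul, map_inv₀, alg_coe]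

theorem magicMap_mem (L : IntermediateField F ℂ) {f : U → ℂ} (hf : ∀ u, f u ∈ L) (x : ↥(U ⊓ H)) :
    magicMap hB σ U f x ∈ L :=
  mul_mem (inv_mem (coe_mem_intermediateField L _)) (linFun_mem L hf _)

theorem magicInv_mem (L : IntermediateField F ℂ) {f : ↥(U ⊓ H) → ℂ} (hf : ∀ u, f u ∈ L) (x : U) :
    magicInv hB σ U f x ∈ L := by
  refine mul_mem (div_mem (coe_mem_intermediateField L ⟨θ 1, hB.val_θ 1⟩) ?_) (sum_mem fun y _ =>
    sum_mem fun z _ => mul_mem (coe_mem_intermediateField L _) (hf z))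
  exact mul_mem (mul_mem (natCast_mem L _) (natCast_mem L _)) (coe_mem_intermediateField L _)

variable (hσ : IsMagic hB σ)

include hσ

/-- Both ι and its inverse are given by formulas with coefficients in F, so each function has its
values in the field generated by the other. -/
theorem charField_magicMap {f : U → ℂ} (hf : IsAbove hU θ f) :
    charField F f = charField F (magicMap hB σ U f) := by
  apply le_antisymm
  · refine IntermediateField.adjoin_le_iff.2 ?_
    rintro _ ⟨u, rfl⟩
    have h1 := magicInv_mem (hB := hB) (σ := σ) (charField F (magicMap hB σ U f))
      (f := magicMap hB σ U f)
      (fun h => IntermediateField.subset_adjoin F (Set.range _) ⟨h, rfl⟩) u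
    rwa [magicInv_magicMap hσ hf] at h1
  · refine IntermediateField.adjoin_le_iff.2 ?_
    rintro _ ⟨u, rfl⟩
    exact magicMap_mem (charField F f)
      (fun h => IntermediateField.subset_adjoin F (Set.range _) ⟨h, rfl⟩) u

theorem of_conj_magicElt {h : G} (hh : h ∈ H) (x : H) :
    δ h * magicElt hB σ x * δ h⁻¹ = magicElt hB σ (⟨h, hh⟩ * x * ⟨h, hh⟩⁻¹) := by
  have h1 := of_conj_mul_magicElt hσ ⟨h, hh⟩ x hB.unit.1
  rw [idem_mul_magicElt, mul_idem_of_mem_magicSub hB (magicUnit_mem _), magicUnit_mul_inv,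
    idem_mul_magicElt] at h1
  exact h1

theorem magicMap_conjFun (f : U → ℂ) {h : G} (hh : h ∈ H) (hU : K ≤ U) {x : G}
    (hx : x ∈ conjSub U h ⊓ H) :
    conjFun (magicMap hB σ U f) h ⟨x, mem_conjSub_inf hh hx⟩ =
      magicMap hB σ (conjSub U h) (conjFun f h) ⟨x, hx⟩ := by
  have hm : magicElt hB σ (Subgroup.inclusion inf_le_right (⟨x, hx⟩ : ↥(conjSub U h ⊓ H))) ∈
    subgroupAlg F (conjSub U h) := magicElt_mem (le_conjSub hU h) hx.1
  rw [magicMap_eq, linFun_conjFun f h hm, of_conj_magicElt hσ hh]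
  rfl

omit hσ in
include hB in
theorem isAbove_conjFun {f : U → ℂ} (hf : IsAbove hU θ f) (h : G) :
    IsAbove (le_conjSub hU h) θ (conjFun f h) := by
  refine ⟨fun x y => ?_, funext fun x => ?_⟩
  · refine Eq.trans ?_ ((hf.1 ⟨h * x * h⁻¹, x.2⟩ ⟨h * y * h⁻¹, y.2⟩).trans ?_)
    · exact congrArg f (Subtype.ext (by simp [mul_assoc]))
    · exact congrArg f (Subtype.ext (by simp [mul_assoc]))
  · rw [← linFun_subIdem_mul_of (le_conjSub hU h) hB.val_θ, linFun_conjFun]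
    · rw [← mul_assoc, hB.of_mul_idem_θ, mul_assoc, mul_assoc, linFun_subIdem_mul hU hB.val_θ hf,
        ← map_mul, ← map_mul, linFun_of, ← mul_assoc]
      exact extZero_of_mem f x.2
    · exact mul_mem (subIdem_mem_of_le (le_conjSub hU h) _) (of_mem_subgroupAlg F x)

/-- Induction is adjoint to restriction, and ι is an isometry commuting with restriction; it
suffices to compare inner products with irreducible characters above φ, all of which are images
under ι. -/
theorem magicMap_indFun {U₁ U₂ : Subgroup G} (h₁ : K ≤ U₁) (h₁₂ : U₁ ≤ U₂) {τ : U₁ → ℂ}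
    (hτ : IsAbove h₁ θ τ) :
    magicMap hB σ U₂ (indFun U₁ U₂ τ) = indFun (U₁ ⊓ H) (U₂ ⊓ H) (magicMap hB σ U₁ τ) := by
  have h1 : IsAbove (h₁.trans h₁₂) θ (indFun U₁ U₂ τ) :=
    isAbove_indFun hB.val_θ h₁₂ (fun w _ => hB.of_mul_idem_θ w) hτ
  have h2 : IsAbove (inf_le_inf_right_of_le (h₁.trans h₁₂)) φ
      (indFun (U₁ ⊓ H) (U₂ ⊓ H) (magicMap hB σ U₁ τ)) :=
    isAbove_indFun hB.val_φ (inf_mono_left h₁₂) (fun w hw => hB.of_mul_idem_φ hw.2)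
      (isAbove_magicMap hσ hτ)
  refine eq_of_classInner_eq ((hB.mem_irrAboveSpan_φ_iff (h₁.trans h₁₂)).2 (isAbove_magicMap hσ h1))
    ((hB.mem_irrAboveSpan_φ_iff (h₁.trans h₁₂)).2 h2) fun ξ hξ => ?_
  have h3 : IsAbove (h₁.trans h₁₂) θ (magicInv hB σ U₂ ξ) := isAbove_magicInv ξ
  have h4 := magicMap_magicInv (hU := h₁.trans h₁₂) hσ ((hB.mem_irrAbove_φ_iff (h₁.trans h₁₂)).1 hξ).2
  have h5 := mem_irrAbove_of_magicMap hσ h3 (by rwa [h4])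
  rw [classInner_indFun (inf_mono_left h₁₂) _ (Submodule.subset_span hξ.1), ← h4,
    classInner_magicMap hσ h1 h3, classInner_indFun h₁₂ _ (Submodule.subset_span h5.1),
    ← magicMap_resFun h₁ h₁₂, classInner_magicMap hσ hτ (isAbove_resFun h₁₂ h3)]

/-- The restriction to `U ∩ H`. -/
theorem partAbove_resFun {f : U → ℂ} (hf : IsAbove hU θ f) (x : ↥(U ⊓ H)) :
    partAbove (inf_le_inf_right_of_le hU) φ (resFun inf_le_left f) x =
      magicTr F θ φ (magicUnit hB σ (Subgroup.inclusion inf_le_right x)) *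
        magicMap hB σ U f x := by
  have hmem : resFun (inf_le_left : U ⊓ H ≤ U) f ∈ irrSpan ↥(U ⊓ H) :=
    mem_irrSpan_of_mul_comm fun x y =>
      hf.1 (Subgroup.inclusion inf_le_left x) (Subgroup.inclusion inf_le_left y)
  refine mul_left_cancel₀ (coe_magicTr_idem_ne_zero hB) ?_
  -- The part above φ is x ↦ f(e_φ x) = f(ix), and ix = σ(Lx)c_x, so the key identity brings out the
  -- trace of σ(Lx).
  rw [partAbove_eq hB.irr_φ (hB.exists_invariant_φ U) hmem,
    ← linFun_subIdem_mul_of (F := F) _ hB.val_φ, linFun_resFun, ← linFun_subIdem_mul hU hB.val_θ hf,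
    ← mul_assoc, ← hB.idem_θ_central, mul_left_comm, ← linFun_magicElt,
    ← linFun_mul_magicElt hσ hf (magicUnit_mem _), magicUnit_mul_magicElt]
  · rfl
  · exact mul_mem (subIdem_mem_of_le (inf_le_inf_right_of_le hU) _) (of_mem_subgroupAlg F x)

omit hσ in
theorem magicUnit_eq {h h' : H} (hh : (h : G)⁻¹ * h' ∈ K) :
    magicUnit hB σ h = magicUnit hB σ h' := by
  have h1 : (QuotientGroup.mk h : H ⧸ K.subgroupOf H) = QuotientGroup.mk h' :=
    QuotientGroup.eq.2 hh
  rw [magicUnit, magicUnit, h1]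

/-- The magic character, as a function on `G`. -/
def magicCharExt (hB : BasicConfig F H K θ φ) (σ : H ⧸ K.subgroupOf H →* (MagicAlg hB)ˣ) (g : G) :
    ℂ :=
  magicTr F θ φ (magicUnit hB σ ⟨_, (hB.exists_mul g).choose_spec.1⟩)

omit hσ in
theorem magicCharExt_eq {g : G} {h : H} (hg : (h : G)⁻¹ * g ∈ K) :
    magicCharExt hB σ g = magicTr F θ φ (magicUnit hB σ h) := by
  obtain ⟨k, hk, hgk⟩ := (hB.exists_mul g).choose_spec.2
  rw [magicCharExt]
  refine congrArg (fun x => ((magicTr F θ φ x : F) : ℂ)) (magicUnit_eq ?_)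
  change (hB.exists_mul g).choose⁻¹ * h ∈ K
  generalize (hB.exists_mul g).choose = h' at hgk
  have h1 : h' = g * k⁻¹ := by rw [hgk, mul_inv_cancel_right]
  have h2 : h'⁻¹ * h = k * ((h : G)⁻¹ * g)⁻¹ := by
    rw [h1]
    group
  rw [h2]
  exact K.mul_mem hk (K.inv_mem hg)

omit hσ in
theorem magicCharExt_coe (h : H) : magicCharExt hB σ h = magicTr F θ φ (magicUnit hB σ h) :=
  magicCharExt_eq (by rw [inv_mul_cancel]; exact one_mem K)

omit hσ hK in
theorem exists_inv_mul_mem [K.Normal] (hB : BasicConfig F H K θ φ) (g : G) :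
    ∃ h : H, (h : G)⁻¹ * g ∈ K := by
  obtain ⟨h, hh, k, hk, rfl⟩ := hB.exists_mul g
  exact ⟨⟨h, hh⟩, by rwa [inv_mul_cancel_left]⟩

omit hσ in
theorem magicCharExt_mul_comm (x y : G) :
    magicCharExt hB σ (x * y) = magicCharExt hB σ (y * x) := by
  have key : ∀ (a b : H) (x y : G), (a : G)⁻¹ * x ∈ K → (b : G)⁻¹ * y ∈ K →
      magicCharExt hB σ (x * y) = magicTr F θ φ (magicUnit hB σ a * magicUnit hB σ b) := by
    intro a b x y ha hb
    rw [← magicUnit_mul]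
    refine magicCharExt_eq ?_
    have h1 : ((a * b : H) : G)⁻¹ * (x * y) = ((b : G)⁻¹ * ((a : G)⁻¹ * x) * (b : G)⁻¹⁻¹) *
        ((b : G)⁻¹ * y) := by
      rw [Subgroup.coe_mul]
      group
    rw [h1]
    exact K.mul_mem (hK.conj_mem _ ha _) hb
  obtain ⟨a, ha⟩ := exists_inv_mul_mem hB x
  obtain ⟨b, hb⟩ := exists_inv_mul_mem hB y
  rw [key a b x y ha hb, key b a y x hb ha,
    magicTr_mul_comm hB (mem_subgroupAlg_of_mem_magicSub (magicUnit_mem a))]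

omit hσ in
theorem magicCharExt_mul_of_mem {k : G} (hk : k ∈ K) (g : G) :
    magicCharExt hB σ (k * g) = magicCharExt hB σ g := by
  obtain ⟨a, ha⟩ := exists_inv_mul_mem hB g
  rw [magicCharExt_eq ha]
  refine magicCharExt_eq ?_
  have : (a : G)⁻¹ * (k * g) = ((a : G)⁻¹ * k * (a : G)⁻¹⁻¹) * ((a : G)⁻¹ * g) := by group
  rw [this]
  exact K.mul_mem (hK.conj_mem _ hk _) ha

/-- Induction from `U ∩ H`. -/
theorem partAbove_indFun (hU : K ≤ U) {ξ : ↥(U ⊓ H) → ℂ}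
    (hξ : IsAbove (inf_le_inf_right_of_le hU) φ ξ) (u : U) :
    partAbove hU θ (indFun (U ⊓ H) U ξ) u =
      conj (magicCharExt hB σ u) * magicInv hB σ U ξ u := by
  have h1 : IsAbove hU θ (magicInv hB σ U ξ) := isAbove_magicInv ξ
  have hβ : ∀ (n : K) (v : U), conj (magicCharExt hB σ (Subgroup.inclusion hU n * v : U)) =
      conj (magicCharExt hB σ v) := fun n v =>
    congrArg _ (magicCharExt_mul_of_mem n.2 (v : G))
  have h2 : IsAbove hU θ fun u : U => conj (magicCharExt hB σ u) * magicInv hB σ U ξ u :=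
    isAbove_mul (β := fun u : U => conj (magicCharExt hB σ u)) hβ
      (fun u v => congrArg _ (magicCharExt_mul_comm (u : G) v)) h1
  have h3 := (hB.mem_irrAboveSpan_φ_iff hU).2 hξ
  suffices h : partAbove hU θ (indFun (U ⊓ H) U ξ) =
      fun u : U => conj (magicCharExt hB σ u) * magicInv hB σ U ξ u from congrFun h u
  -- Inner products with each χ above θ are compared: reciprocity leads to the restriction of χ,
  -- where ψ appears. It stands in the conjugate-linear argument, which explains the complex
  -- conjugate.
  refine eq_of_classInner_eq (partAbove_mem _) (hB.mem_irrAboveSpan_θ_iff.2 h2) fun χ hχ => ?_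
  have hχ' := (hB.mem_irrAbove_θ_iff.1 hχ).2
  rw [classInner_partAbove _ hχ, classInner_indFun inf_le_left _ (Submodule.subset_span hχ.1),
    ← classInner_eq_classInner_partAbove h3, ← classInner_magicMap hσ h2 hχ', classInner_eq,
    classInner_eq]
  refine congrArg (HMul.hMul (_ : ℂ)) (Finset.sum_congr rfl fun x _ => ?_)
  rw [partAbove_resFun hσ hχ', magicMap_mul (β := fun u : U => conj (magicCharExt hB σ u)) hβ,
    magicMap_magicInv (hU := hU) hσ hξ, map_mul]
  have h4 : magicCharExt hB σ ((Subgroup.inclusion inf_le_left x : U) : G) =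
      magicTr F θ φ (magicUnit hB σ (Subgroup.inclusion inf_le_right x)) :=
    magicCharExt_coe (Subgroup.inclusion inf_le_right x)
  rw [h4]
  ring

end Functorial

/-! ### Central simple algebras from Casimir elements -/

/-- A trace form on an algebra together with dual bases whose Casimir element maps to scalars. -/
structure CasimirDatum (k R ι : Type*) [Field k] [Ring R] [Algebra k R] [Fintype ι] where
  x : ι → R
  y : ι → R
  tr : R →ₗ[k] k
  tr_mul_comm : ∀ a b, tr (a * b) = tr (b * a)
  sum_mul_mul : ∀ r, ∑ i, x i * r * y i = tr r • (1 : R)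
  sum_tr_smul : ∀ r, ∑ i, tr (r * y i) • x i = r
  tr_one_ne_zero : tr 1 ≠ 0

namespace CasimirDatum

variable {k R ι : Type*} [Field k] [Ring R] [Algebra k R] [Fintype ι] (D : CasimirDatum k R ι)

include D

theorem nontrivial : Nontrivial R := by
  refine ⟨1, 0, fun h => D.tr_one_ne_zero ?_⟩
  rw [h, map_zero]

/-- For nonzero r the dual bases give some i with tr(r y_i) ≠ 0. The Casimir sum around r y_i is
this nonzero scalar and lies in every two-sided ideal containing r. -/
theorem isSimpleRing : IsSimpleRing R := by
  have := D.nontrivial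
  refine ⟨⟨fun I => ?_⟩⟩
  by_cases hI : I = ⊥
  · exact Or.inl hI
  right
  have h1 : ∃ r ∈ I, r ≠ 0 := by
    by_contra! h
    exact hI (eq_bot_iff.2 fun r hr => by rw [h r hr]; exact zero_mem _)
  obtain ⟨r, hr, hr0⟩ := h1
  have h2 : ∃ i, D.tr (r * D.y i) ≠ 0 := by
    by_contra! h
    refine hr0 ?_
    rw [← D.sum_tr_smul r]
    simp only [h, zero_smul, Finset.sum_const_zero]
  obtain ⟨i, hi⟩ := h2
  have h3 : D.tr (r * D.y i) • (1 : R) ∈ I := by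
    rw [← D.sum_mul_mul]
    exact sum_mem fun j _ => I.mul_mem_right _ _ (I.mul_mem_left _ _ (I.mul_mem_right _ _ hr))
  have h4 : (1 : R) ∈ I := by
    have h5 := I.mul_mem_left (algebraMap k R (D.tr (r * D.y i))⁻¹) _ h3
    rwa [← Algebra.smul_def, smul_smul, inv_mul_cancel₀ hi, one_smul] at h5
  rwa [TwoSidedIdeal.one_mem_iff] at h4

/-- A central z can be pulled out of its Casimir sum, so tr(1)z = tr(z)·1. -/
theorem isCentral : Algebra.IsCentral k R := by
  refine ⟨fun z hz => ?_⟩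
  rw [Subalgebra.mem_center_iff] at hz
  have h1 := D.sum_mul_mul z
  have h2 := D.sum_mul_mul 1
  simp only [hz, mul_one, mul_assoc] at h1 h2
  rw [← Finset.mul_sum, h2, mul_smul_comm, mul_one] at h1
  refine Algebra.mem_bot.2 ⟨(D.tr 1)⁻¹ * D.tr z, ?_⟩
  rw [Algebra.algebraMap_eq_smul_one, mul_smul, ← h1, smul_smul, inv_mul_cancel₀ D.tr_one_ne_zero,
    one_smul]

theorem finite : Module.Finite k R := by
  classical
  refine ⟨Finset.univ.image D.x, ?_⟩
  rw [eq_top_iff]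
  rintro r -
  rw [← D.sum_tr_smul r]
  exact Submodule.sum_mem _ fun i _ => Submodule.smul_mem _ _ (Submodule.subset_span (by simp))

/-- The dual bases write the identity map as a sum of rank-one maps. Its trace is therefore tr(Σ x_i
y_i), and the Casimir sum of 1 is tr(1)·1. -/
theorem finrank_eq : (Module.finrank k R : k) = D.tr 1 ^ 2 := by
  have := D.finite
  have h1 : (LinearMap.id : R →ₗ[k] R) =
      ∑ i, LinearMap.smulRight (D.tr ∘ₗ LinearMap.mulRight k (D.y i)) (D.x i) := by
    ext r
    simp only [LinearMap.id_apply, LinearMap.sum_apply, LinearMap.smulRight_apply,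
      LinearMap.comp_apply, LinearMap.mulRight_apply, D.sum_tr_smul]
  rw [← LinearMap.trace_id, h1, map_sum]
  simp only [LinearMap.trace_smulRight, LinearMap.comp_apply, LinearMap.mulRight_apply]
  rw [← map_sum]
  have h2 := D.sum_mul_mul 1
  simp only [mul_one] at h2
  rw [h2, map_smul, smul_eq_mul, sq]

/-- The datum of an algebra after extension of scalars. -/
def baseChange (E : Type*) [Field E] [Algebra k E] : CasimirDatum E (E ⊗[k] R) ι where
  x i := 1 ⊗ₜ D.x i
  y i := 1 ⊗ₜ D.y i
  tr := (TensorProduct.AlgebraTensorModule.rid k E E).toLinearMap ∘ₗ D.tr.baseChange E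
  tr_mul_comm a b := by
    induction a using TensorProduct.induction_on with
    | zero => rw [zero_mul, mul_zero]
    | add a a' ha ha' => rw [add_mul, mul_add, map_add, map_add, ha, ha']
    | tmul e r =>
      induction b using TensorProduct.induction_on with
      | zero => rw [zero_mul, mul_zero]
      | add a a' ha ha' => rw [add_mul, mul_add, map_add, map_add, ha, ha']
      | tmul f s =>
        simp [D.tr_mul_comm r s, mul_comm e f]
  sum_mul_mul r := by
    induction r using TensorProduct.induction_on with
    | zero => simp
    | add a b ha hb => simp only [mul_add, add_mul, Finset.sum_add_distrib, ha, hb, map_add, add_smul]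
    | tmul e r =>
      simp only [Algebra.TensorProduct.tmul_mul_tmul, one_mul, mul_one, ← TensorProduct.tmul_sum,
        D.sum_mul_mul]
      simp [Algebra.TensorProduct.one_def, TensorProduct.smul_tmul']
  sum_tr_smul r := by
    induction r using TensorProduct.induction_on with
    | zero => simp
    | add a b ha hb => simp only [add_mul, map_add, add_smul, Finset.sum_add_distrib, ha, hb]
    | tmul e r =>
      conv_rhs => rw [← D.sum_tr_smul r, TensorProduct.tmul_sum]
      simp [TensorProduct.smul_tmul']
  tr_one_ne_zero := by
    simp [Algebra.TensorProduct.one_def, D.tr_one_ne_zero, Algebra.smul_def]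

theorem baseChange_tr (E : Type*) [Field E] [Algebra k E] (r : R) :
    (D.baseChange E).tr (1 ⊗ₜ r) = algebraMap k E (D.tr r) := by
  simp [baseChange, Algebra.smul_def]

/-- A trace form is a multiple of the matrix trace. The dimension formula forces n = m in
characteristic zero, so the two agree at 1 and the multiple is one. -/
theorem trace_eq [CharZero k] {m : ℕ} (hm : D.tr 1 = m) {n : ℕ} (ε : R ≃ₐ[k] Matrix (Fin n) (Fin n) k)
    (a : R) : (ε a).trace = D.tr a := by
  have h1 := D.finrank_eq
  rw [ε.toLinearEquiv.finrank_eq, Module.finrank_matrix, hm] at h1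
  simp only [Fintype.card_fin, Module.finrank_self, mul_one] at h1
  have h2 : n = m := by
    have h3 : n * n = m ^ 2 := by exact_mod_cast h1
    rw [sq] at h3
    exact Nat.mul_self_inj.1 h3
  obtain ⟨c, hc⟩ := exists_eq_mul_trace (D.tr ∘ₗ ε.symm.toLinearMap) fun a b => by
    simp only [LinearMap.comp_apply, AlgEquiv.toLinearMap_apply, map_mul, D.tr_mul_comm]
  have h3 := hc 1
  have h4 := hc (ε a)
  simp only [LinearMap.comp_apply, AlgEquiv.toLinearMap_apply, map_one, Matrix.trace_one,
    Fintype.card_fin, AlgEquiv.symm_apply_apply] at h3 h4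
  have h5 := D.tr_one_ne_zero
  rw [hm] at h3 h5
  rw [h2] at h3
  rw [h4, mul_eq_right₀ h5 |>.1 h3.symm, one_mul]

theorem isReducedTrace [CharZero k] {m : ℕ} (hm : D.tr 1 = m) : IsReducedTrace k R D.tr := by
  have := (D.baseChange (AlgebraicClosure k)).isSimpleRing
  have := (D.baseChange (AlgebraicClosure k)).finite
  have : CharZero (AlgebraicClosure k) := charZero_of_injective_algebraMap (algebraMap k _).injective
  obtain ⟨n, -, ⟨ε⟩⟩ := IsSimpleRing.exists_algEquiv_matrix_of_isAlgClosed (AlgebraicClosure k)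
    (AlgebraicClosure k ⊗[k] R)
  refine ⟨n, ε, fun s => ?_⟩
  rw [(D.baseChange _).trace_eq (m := m), baseChange_tr]
  rw [Algebra.TensorProduct.one_def, baseChange_tr, hm, map_natCast]

/-- Uniqueness: the comparison with the matrix trace holds for every splitting isomorphism, so the
choice made in `reducedTrace` does not matter. -/
theorem eq_of_isReducedTrace [CharZero k] {m : ℕ} (hm : D.tr 1 = m) {t : R → k}
    (ht : IsReducedTrace k R t) : t = D.tr := by
  have : CharZero (AlgebraicClosure k) := charZero_of_injective_algebraMap (algebraMap k _).injective
  obtain ⟨n, ε, h⟩ := ht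
  funext s
  have h1 := h s
  rw [(D.baseChange _).trace_eq (m := m), baseChange_tr] at h1
  · exact (algebraMap k (AlgebraicClosure k)).injective h1
  · rw [Algebra.TensorProduct.one_def, baseChange_tr, hm, map_natCast]

theorem isReducedTrace_reducedTrace [CharZero k] {m : ℕ} (hm : D.tr 1 = m) :
    IsReducedTrace k R (reducedTrace k) := by
  have h : ∃ t : R → k, IsReducedTrace k R t := ⟨_, D.isReducedTrace hm⟩
  rw [reducedTrace, dif_pos h]
  exact h.choose_spec

theorem reducedTrace_eq [CharZero k] {m : ℕ} (hm : D.tr 1 = m) :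
    reducedTrace k = (D.tr : R → k) :=
  D.eq_of_isReducedTrace hm (D.isReducedTrace_reducedTrace hm)

/-- The datum of a tensor product. -/
def tensor {R' ι' : Type*} [Ring R'] [Algebra k R'] [Fintype ι'] (D' : CasimirDatum k R' ι') :
    CasimirDatum k (R ⊗[k] R') (ι × ι') where
  x i := D.x i.1 ⊗ₜ D'.x i.2
  y i := D.y i.1 ⊗ₜ D'.y i.2
  tr := LinearMap.mul' k k ∘ₗ TensorProduct.map D.tr D'.tr
  tr_mul_comm a b := by
    induction a using TensorProduct.induction_on with
    | zero => rw [zero_mul, mul_zero]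
    | add a a' ha ha' => rw [add_mul, mul_add, map_add, map_add, ha, ha']
    | tmul e r =>
      induction b using TensorProduct.induction_on with
      | zero => rw [zero_mul, mul_zero]
      | add a a' ha ha' => rw [add_mul, mul_add, map_add, map_add, ha, ha']
      | tmul f s => simp [D.tr_mul_comm e f, D'.tr_mul_comm r s]
  sum_mul_mul r := by
    induction r using TensorProduct.induction_on with
    | zero => simp
    | add a b ha hb => simp only [mul_add, add_mul, Finset.sum_add_distrib, ha, hb, map_add, add_smul]
    | tmul e r =>
      simp only [Algebra.TensorProduct.tmul_mul_tmul]
      rw [Fintype.sum_prod_type]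
      simp only [← TensorProduct.tmul_sum, ← TensorProduct.sum_tmul, D.sum_mul_mul, D'.sum_mul_mul]
      simp [Algebra.TensorProduct.one_def, TensorProduct.smul_tmul', smul_smul, mul_comm]
  sum_tr_smul r := by
    induction r using TensorProduct.induction_on with
    | zero => simp
    | add a b ha hb => simp only [add_mul, map_add, add_smul, Finset.sum_add_distrib, ha, hb]
    | tmul e r =>
      conv_rhs => rw [← D.sum_tr_smul e, ← D'.sum_tr_smul r]
      rw [Fintype.sum_prod_type]
      simp only [TensorProduct.tmul_sum, TensorProduct.sum_tmul]
      rw [Finset.sum_comm]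
      refine Finset.sum_congr rfl fun i _ => Finset.sum_congr rfl fun j _ => ?_
      simp [TensorProduct.smul_tmul', smul_smul, mul_comm]
  tr_one_ne_zero := by
    simp [Algebra.TensorProduct.one_def, D.tr_one_ne_zero, D'.tr_one_ne_zero]

end CasimirDatum

/-! ### The block of an irreducible character -/

section Block

variable {G : Type*} [Group G] [Finite G] {E : Type*} [Field E] [Algebra E ℂ]

theorem charIdem_ne_zero {χ : G → ℂ} (hχ : IsIrrChar χ)
    (hE : ∀ g, χ g ∈ Set.range (algebraMap E ℂ)) : charIdem E χ ≠ 0 := by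
  intro h
  have h1 := algebraMap_coeff_charIdem hE 1
  rw [h, inv_one, MonoidAlgebra.coeff_zero, Finsupp.zero_apply, map_zero] at h1
  have h2 := hχ.one_ne_zero
  have h3 := natCard_ne_zero' G
  have h4 : χ 1 / Nat.card G * χ 1 ≠ 0 := mul_ne_zero (div_ne_zero h2 h3) h2
  exact h4 h1.symm

/-- Averaging e_χ itself: all its conjugates are equal, and comparison with the scalar from Schur's
lemma gives the value. -/
theorem linFun_charIdem {χ : G → ℂ} (hχ : IsIrrChar χ)
    (hE : ∀ g, χ g ∈ Set.range (algebraMap E ℂ)) :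
    linFun E (charVal E χ) (charIdem E χ) = charVal E χ 1 := by
  have h1 := sum_conj_mul_charIdem hχ hE (charIdem E χ)
  have h2 : ∀ g : G, MonoidAlgebra.of E G g * charIdem E χ * MonoidAlgebra.of E G g⁻¹ *
      charIdem E χ = charIdem E χ := by
    intro g
    rw [charIdem_conj hχ.conj_eq, mul_assoc (charIdem E χ), ← map_mul, mul_inv_cancel, map_one,
      mul_one, charIdem_idem hχ hE]
  simp only [h2] at h1
  rw [Finset.sum_const, Finset.card_univ, Fintype.card_eq_nat_card, ← Nat.cast_smul_eq_nsmul E] at h1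
  have h3 := smul_left_injective E (charIdem_ne_zero hχ hE) h1
  have h4 := charVal_one_ne_zero hχ hE
  have h5 := natCard_ne_zero E G
  field_simp at h3
  exact h3.symm

theorem SubAlg.val_smul {R A : Type*} [CommRing R] [Ring A] [Algebra R A]
    {B : NonUnitalSubalgebra R A} {e : A} {h : e ∈ B ∧ ∀ x ∈ B, e * x = x ∧ x * e = x}
    (r : R) (x : SubAlg B e h) : (r • x).val = r • x.val := rfl

theorem SubAlg.val_sum {R A : Type*} [CommRing R] [Ring A] [Algebra R A]
    {B : NonUnitalSubalgebra R A} {e : A} {h : e ∈ B ∧ ∀ x ∈ B, e * x = x ∧ x * e = x}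
    {ι : Type*} (s : Finset ι) (f : ι → SubAlg B e h) :
    (∑ i ∈ s, f i).val = ∑ i ∈ s, (f i).val :=
  map_sum (SubAlg.valₗ (h := h)) f s

theorem SubAlg.idem_mul_val {R A : Type*} [CommRing R] [Ring A] [Algebra R A]
    {B : NonUnitalSubalgebra R A} {e : A} {h : e ∈ B ∧ ∀ x ∈ B, e * x = x ∧ x * e = x}
    (x : SubAlg B e h) : e * x.val = x.val := (h.2 _ x.val_mem).1

theorem SubAlg.val_mul_idem {R A : Type*} [CommRing R] [Ring A] [Algebra R A]
    {B : NonUnitalSubalgebra R A} {e : A} {h : e ∈ B ∧ ∀ x ∈ B, e * x = x ∧ x * e = x}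
    (x : SubAlg B e h) : x.val * e = x.val := (h.2 _ x.val_mem).2

theorem mul_charIdem_mem (χ : G → ℂ) (a : MonoidAlgebra E G) : a * charIdem E χ ∈ blockSub E χ :=
  ⟨a, rfl⟩

/-- The block of an irreducible character is central simple. -/
def blockDatum {χ : G → ℂ} (hχ : IsIrrChar χ) (hE : ∀ g, χ g ∈ Set.range (algebraMap E ℂ)) :
    CasimirDatum E (BlockAlg hχ hE) G where
  x g := (charVal E χ 1 / Nat.card G) • SubAlg.of _ (MonoidAlgebra.of E G g * charIdem E χ) (mul_charIdem_mem _ _)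
  y g := SubAlg.of _ (MonoidAlgebra.of E G g⁻¹ * charIdem E χ) (mul_charIdem_mem _ _)
  tr := linFun E (charVal E χ) ∘ₗ SubAlg.valₗ
  tr_mul_comm a b := linFun_mul_comm (charVal_mul_comm hχ) _ _
  sum_mul_mul r := by
    have h1 := charVal_one_ne_zero hχ hE
    have h2 := natCard_ne_zero E G
    refine SubAlg.val_injective ?_
    have h3 := sum_conj_mul_charIdem hχ hE r.val
    rw [SubAlg.val_sum, SubAlg.val_smul, SubAlg.val_one]
    simp only [SubAlg.val_mul, SubAlg.val_smul, SubAlg.val_of, smul_mul_assoc, ← Finset.smul_sum]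
    simp only [mul_assoc, SubAlg.idem_mul_val] at h3 ⊢
    rw [h3, smul_smul, ← mul_assoc, div_mul_div_cancel₀ h2, div_self h1, one_mul]
    rfl
  sum_tr_smul r := by
    have h1 := charVal_one_ne_zero hχ hE
    have h2 := natCard_ne_zero E G
    refine SubAlg.val_injective ?_
    have h3 := congrArg (· * charIdem E χ) (sum_linFun_smul_of hχ hE r.val)
    simp only [Finset.sum_mul, smul_mul_assoc,
      SubAlg.val_mul_idem] at h3
    rw [SubAlg.val_sum]
    simp only [SubAlg.val_smul, SubAlg.val_of, LinearMap.comp_apply, SubAlg.valₗ_apply,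
      SubAlg.val_mul]
    have h4 : ∀ g : G, r.val * (MonoidAlgebra.of E G g⁻¹ * charIdem E χ) =
        r.val * MonoidAlgebra.of E G g⁻¹ := by
      intro g
      rw [charIdem_central hχ.conj_eq, ← mul_assoc, SubAlg.val_mul_idem]
    simp only [h4, smul_comm _ (charVal E χ 1 / (Nat.card G : E)), ← Finset.smul_sum]
    rw [h3, smul_smul, div_mul_div_cancel₀ h2, div_self h1, one_smul]
  tr_one_ne_zero := by
    rw [LinearMap.comp_apply, SubAlg.valₗ_apply, SubAlg.val_one, linFun_charIdem hχ hE]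
    exact charVal_one_ne_zero hχ hE

end Block

/-! ### The algebra S is central simple with reduced trace tr -/

section MagicAlgebra

variable {G : Type*} [Group G] [Finite G] {F : Subfield ℂ} {H K : Subgroup G} [hK : K.Normal]
  {θ : K → ℂ} {φ : ↥(H ⊓ K) → ℂ} (hB : BasicConfig F H K θ φ)

local notation "δ" => MonoidAlgebra.of F G

/-- The algebra `S` is central simple. -/
def magicDatum : CasimirDatum F (MagicAlg hB) K where
  x k := (charVal F θ 1 * charVal F φ 1 / Nat.card K) • SubAlg.of _ (magicProj F θ φ (δ (k : G)))
    (magicProj_mem hB (of_mem_subgroupAlg F k))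
  y k := SubAlg.of _ (magicProj F θ φ (δ (k : G)⁻¹)) (magicProj_mem hB (of_mem_subgroupAlg F k⁻¹))
  tr := magicTr F θ φ ∘ₗ SubAlg.valₗ
  tr_mul_comm a _ := magicTr_mul_comm hB (mem_subgroupAlg_of_mem_magicSub a.val_mem) _
  sum_mul_mul r := by
    have h1 := hB.θ_ne
    have h2 := hB.φ_ne
    have h3 := natCard_ne_zero F K
    refine SubAlg.val_injective ?_
    have h4 := sum_magicProj_mul_magicProj hB r.val_mem
    rw [SubAlg.val_sum, SubAlg.val_smul, SubAlg.val_one]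
    simp only [SubAlg.val_mul, SubAlg.val_smul, SubAlg.val_of, smul_mul_assoc, ← Finset.smul_sum]
    rw [h4, smul_smul, ← mul_assoc, div_mul_div_cancel₀ h3, div_self (mul_ne_zero h1 h2), one_mul]
    rfl
  sum_tr_smul r := by
    have h1 := hB.θ_ne
    have h2 := hB.φ_ne
    have h3 := natCard_ne_zero F K
    refine SubAlg.val_injective ?_
    have h4 := sum_magicTr_smul_magicProj hB r.val_mem
    rw [SubAlg.val_sum]
    simp only [SubAlg.val_smul, SubAlg.val_of, LinearMap.comp_apply, SubAlg.valₗ_apply,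
      SubAlg.val_mul, smul_comm _ (charVal F θ 1 * charVal F φ 1 / (Nat.card K : F)),
      ← Finset.smul_sum]
    rw [h4, smul_smul, div_mul_div_cancel₀ h3, div_self (mul_ne_zero h1 h2), one_smul]
  tr_one_ne_zero := magicTr_idem_ne_zero hB

theorem isReducedTrace_magicAlg : IsReducedTrace F (MagicAlg hB) (reducedTrace F) := by
  obtain ⟨m, -, hm⟩ := magicTr_idem hB
  exact (magicDatum hB).isReducedTrace_reducedTrace hm

theorem reducedTrace_magicAlg (s : MagicAlg hB) : reducedTrace F s = magicTr F θ φ s.val := by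
  obtain ⟨m, -, hm⟩ := magicTr_idem hB
  exact congrFun ((magicDatum hB).reducedTrace_eq hm) s

theorem exists_reducedTrace_eq_one : ∃ s₀ : MagicAlg hB, reducedTrace F s₀ = 1 := by
  refine ⟨(magicTr F θ φ (magicIdem F θ φ))⁻¹ • 1, ?_⟩
  rw [reducedTrace_magicAlg, SubAlg.val_smul, map_smul, SubAlg.val_one, smul_eq_mul,
    inv_mul_cancel₀ (magicTr_idem_ne_zero hB)]

end MagicAlgebra

/-! ### Corners of simple algebras -/

section Morita

variable {k A B : Type*} [Field k] [Ring A] [Algebra k A] [Ring B] [Algebra k B]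

open Matrix in
-- Nested matrix algebras over D can be regrouped and their index sets swapped.
theorem exists_matrix_algEquiv_of_matrix {D : Type*} [Ring D] [Algebra k D] {n m : ℕ}
    (f : A ≃ₐ[k] Matrix (Fin n) (Fin n) D) (g : B ≃ₐ[k] Matrix (Fin m) (Fin m) D) :
    Nonempty (Matrix (Fin m) (Fin m) A ≃ₐ[k] Matrix (Fin n) (Fin n) B) :=
  ⟨f.mapMatrix.trans <| (compAlgEquiv _ _ _ _).trans <|
    (reindexAlgEquiv k D (.prodComm (Fin m) (Fin n))).trans <|
    (compAlgEquiv _ _ _ _).symm.trans g.symm.mapMatrix⟩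

/-- If `B` is isomorphic to a corner of the simple algebra `A`, then some full matrix algebras over
`A` and `B` are isomorphic. -/
theorem exists_matrix_algEquiv_of_corner [IsSimpleRing A] [IsArtinianRing A] [IsSimpleRing B]
    (Φ : B →ₗ[k] A)
    (hmul : ∀ a b, Φ (a * b) = Φ a * Φ b) (hne : Φ 1 ≠ 0)
    (hsurj : ∀ a, ∃ b, Φ b = Φ 1 * a * Φ 1) :
    ∃ n m : ℕ, n ≠ 0 ∧ m ≠ 0 ∧
      Nonempty (Matrix (Fin n) (Fin n) A ≃ₐ[k] Matrix (Fin m) (Fin m) B) := by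
  have hinj : ∀ b, Φ b = 0 → b = 0 := by
    -- The kernel is a two-sided ideal that omits 1, hence zero by simplicity. It is built by hand
    -- because Φ need not preserve units.
    let I : TwoSidedIdeal B := TwoSidedIdeal.mk' {b | Φ b = 0} (map_zero Φ)
      (fun {a b} ha hb => by
        change Φ (a + b) = 0
        rw [map_add, show Φ a = 0 from ha, show Φ b = 0 from hb, add_zero])
      (fun {a} ha => by
        change Φ (-a) = 0
        rw [map_neg, show Φ a = 0 from ha, neg_zero])
      (fun {a b} hb => by
        change Φ (a * b) = 0
        rw [hmul, show Φ b = 0 from hb, mul_zero])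
      (fun {a b} ha => by
        change Φ (a * b) = 0
        rw [hmul, show Φ a = 0 from ha, zero_mul])
    have hI : ∀ b, b ∈ I ↔ Φ b = 0 := fun b => TwoSidedIdeal.mem_mk' ..
    intro b hb
    rcases eq_bot_or_eq_top I with h | h
    · rw [← hI, h] at hb
      exact (TwoSidedIdeal.mem_bot B).1 hb
    · refine absurd ((hI 1).1 ?_) hne
      rw [h]
      exact TwoSidedIdeal.mem_top B
  set e := Φ 1 with he
  have hee : e * e = e := by rw [he, ← hmul, one_mul]
  -- M is the left ideal Ae. Right multiplication identifies eAe, and so B, with the opposite of its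
  -- endomorphism ring; an endomorphism is recovered from the image of e.
  let M : Ideal A := Ideal.span {e}
  have hM : ∀ x ∈ M, x * e = x := by
    intro x hx
    obtain ⟨a, rfl⟩ := Ideal.mem_span_singleton'.1 hx
    rw [mul_assoc, hee]
  have heM : e ∈ M := Ideal.subset_span rfl
  have hΦe : ∀ b, e * Φ b = Φ b := fun b => by rw [he, ← hmul, one_mul]
  have hΦe' : ∀ b, Φ b * e = Φ b := fun b => by rw [he, ← hmul, mul_one]
  have hMΦ : ∀ b, ∀ x : A, x * Φ b ∈ M := fun b x => by
    rw [← hΦe', ← mul_assoc]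
    exact M.mul_mem_left _ heM
  let R : B → Module.End A M := fun b =>
    { toFun := fun x => ⟨x * Φ b, hMΦ b x⟩
      map_add' := fun x y => Subtype.ext (add_mul _ _ _)
      map_smul' := fun r x => Subtype.ext (mul_assoc _ _ _) }
  have hR : ∀ b x, ((R b x : M) : A) = x * Φ b := fun _ _ => rfl
  let T : B →ₐ[k] (Module.End A M)ᵐᵒᵖ := AlgHom.ofLinearMap
    { toFun := fun b => MulOpposite.op (R b)
      map_add' := fun a b => by
        rw [← MulOpposite.op_add]
        congr 1
        refine LinearMap.ext fun x => Subtype.ext ?_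
        change (x : A) * Φ (a + b) = x * Φ a + x * Φ b
        rw [map_add, mul_add]
      map_smul' := fun r b => by
        rw [RingHom.id_apply, ← MulOpposite.op_smul]
        congr 1
        refine LinearMap.ext fun x => Subtype.ext ?_
        change (x : A) * Φ (r • b) = r • (x * Φ b : A)
        rw [map_smul, mul_smul_comm] }
    (by
      change MulOpposite.op (R 1) = 1
      rw [← MulOpposite.op_one]
      congr 1
      exact LinearMap.ext fun x => Subtype.ext (hM x x.2))
    (fun a b => by
      change MulOpposite.op (R (a * b)) = MulOpposite.op (R a) * MulOpposite.op (R b)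
      rw [← MulOpposite.op_mul]
      congr 1
      refine LinearMap.ext fun x => Subtype.ext ?_
      change (x : A) * Φ (a * b) = x * Φ a * Φ b
      rw [hmul, mul_assoc])
  have hTinj : Function.Injective T := by
    rw [injective_iff_map_eq_zero]
    intro b hb
    have h1 : R b = 0 := MulOpposite.op_injective hb
    have h2 := congrArg Subtype.val (LinearMap.congr_fun h1 ⟨e, heM⟩)
    exact hinj b ((hΦe b).symm.trans h2)
  have hTsurj : Function.Surjective T := by
    intro f
    obtain ⟨b, hb⟩ := hsurj (f.unop ⟨e, heM⟩ : M)
    have h1 : e * (f.unop ⟨e, heM⟩ : M) = ((f.unop ⟨e, heM⟩ : M) : A) := by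
      have h2 := (f.unop).map_smul e ⟨e, heM⟩
      have h3 : e • (⟨e, heM⟩ : M) = ⟨e, heM⟩ := Subtype.ext hee
      rw [h3] at h2
      exact (congrArg Subtype.val h2).symm
    rw [h1, hM _ (f.unop ⟨e, heM⟩ : M).2] at hb
    refine ⟨b, MulOpposite.unop_injective (LinearMap.ext fun x => Subtype.ext ?_)⟩
    change (x : A) * Φ b = (f.unop x : M)
    have h2 := (f.unop).map_smul (x : A) ⟨e, heM⟩
    have h3 : (x : A) • (⟨e, heM⟩ : M) = x := Subtype.ext (hM x x.2)
    rw [h3] at h2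
    rw [hb, h2]
    rfl
  let T' : B ≃ₐ[k] (Module.End A M)ᵐᵒᵖ := AlgEquiv.ofBijective T ⟨hTinj, hTsurj⟩
  -- Over the simple Artinian ring A both A and Ae are finite powers of one simple module S, so both
  -- algebras are full matrix algebras over the opposite of End(S).
  have hiso := IsSimpleRing.isIsotypic A A
  obtain ⟨n, hn, S, hS, ⟨f⟩⟩ := hiso.linearEquiv_fun
  have hMS : IsIsotypicOfType A M S :=
    IsIsotypicOfType.of_injective (hiso S) M.subtype M.subtype_injective
  obtain ⟨m, ⟨g⟩⟩ := hMS.linearEquiv_fun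
  have hm : m ≠ 0 := by
    rintro rfl
    refine hne (congrArg Subtype.val (g.injective (Subsingleton.elim (g ⟨e, heM⟩) (g 0))))
  -- A has matrix size n and B size m over the common division algebra, so the sizes cross over.
  refine ⟨m, n, hm, hn.out, exists_matrix_algEquiv_of_matrix (D := (Module.End A S)ᵐᵒᵖ) ?_ ?_⟩
  · exact .trans (.opOp k A) <| .trans (.op <| .trans (.moduleEndSelf k) <|
      .trans (f.conjAlgEquiv k) (endVecAlgEquivMatrixEnd ..)) (.symm .mopMatrix)
  · exact .trans T' <| .trans (.op <| .trans (g.conjAlgEquiv k) (endVecAlgEquivMatrixEnd ..))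
      (.symm .mopMatrix)

theorem sameBrauerClass_of_corner.{u, v} {E : Type u} [Field E] {A B : Type v} [Ring A]
    [Algebra E A] [Ring B] [Algebra E B] {ι ι' : Type*} [Fintype ι] [Fintype ι']
    (DA : CasimirDatum E A ι) (DB : CasimirDatum E B ι') (Φ : B →ₗ[E] A)
    (hmul : ∀ a b, Φ (a * b) = Φ a * Φ b) (hne : Φ 1 ≠ 0)
    (hsurj : ∀ a, ∃ b, Φ b = Φ 1 * a * Φ 1) : SameBrauerClass E A B := by
  have := DA.isSimpleRing
  have := DA.isCentral
  have := DA.finite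
  have := DB.isSimpleRing
  have := DB.isCentral
  have := DB.finite
  have : IsArtinianRing A := IsArtinianRing.of_finite E A
  exact ⟨{ AlgCat.of E A with }, { AlgCat.of E B with }, ⟨AlgEquiv.refl⟩, ⟨AlgEquiv.refl⟩,
    exists_matrix_algEquiv_of_corner Φ hmul hne hsurj⟩

end Morita

/-! ### Brauer classes -/

/-- Multiplying the commuting images of S and T gives a multiplicative map on the tensor product,
which π carries into A. The hypotheses make its image a nonzero corner. The maps are only linear and
multiplicative since they need not preserve units. -/
theorem sameBrauerClass_tensorProduct_of_commute.{u, v} {E : Type u} [Field E] {A S T : Type v}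
    [Ring A] [Algebra E A] [Ring S] [Algebra E S] [Ring T] [Algebra E T] {R ι₁ ι₂ ι₃ : Type*}
    [Ring R] [Algebra E R] [Fintype ι₁] [Fintype ι₂] [Fintype ι₃] (DA : CasimirDatum E A ι₁)
    (DS : CasimirDatum E S ι₂) (DT : CasimirDatum E T ι₃) (f : S →ₗ[E] R) (g : T →ₗ[E] R)
    (π : R →ₗ[E] A) (hf : ∀ a b, f (a * b) = f a * f b) (hg : ∀ a b, g (a * b) = g a * g b)
    (hπ : ∀ a b, π (a * b) = π a * π b) (hcomm : ∀ s t, g t * f s = f s * g t)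
    (hne : π (f 1 * g 1) ≠ 0)
    (hsurj : ∀ a, ∃ x ∈ Submodule.span E {y | ∃ s t, y = f s * g t},
      π x = π (f 1 * g 1) * a * π (f 1 * g 1)) : SameBrauerClass E A (S ⊗[E] T) := by
  let Ξ : S ⊗[E] T →ₗ[E] R := LinearMap.mul' E R ∘ₗ TensorProduct.map f g
  have hΞ : ∀ s b, Ξ (s ⊗ₜ b) = f s * g b := fun s b => rfl
  have hΞmul : ∀ a b, Ξ (a * b) = Ξ a * Ξ b := by
    intro a b
    induction a using TensorProduct.induction_on with
    | zero => rw [zero_mul, map_zero, zero_mul]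
    | add a a' ha ha' => rw [add_mul, map_add, map_add, add_mul, ha, ha']
    | tmul s x =>
      induction b using TensorProduct.induction_on with
      | zero => rw [mul_zero, map_zero, mul_zero]
      | add a a' ha ha' => rw [mul_add, map_add, map_add, mul_add, ha, ha']
      | tmul t y =>
        rw [Algebra.TensorProduct.tmul_mul_tmul, hΞ, hΞ, hΞ, hf, hg, mul_assoc, mul_assoc,
          ← mul_assoc (g x), hcomm, mul_assoc]
  have hΞ1 : Ξ 1 = f 1 * g 1 := by rw [Algebra.TensorProduct.one_def, hΞ]
  refine sameBrauerClass_of_corner DA (DS.tensor DT) (π ∘ₗ Ξ) (fun a b => ?_) ?_ fun a => ?_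
  · rw [LinearMap.comp_apply, hΞmul, hπ]
    rfl
  · rw [LinearMap.comp_apply, hΞ1]
    exact hne
  · obtain ⟨x, hx, hxa⟩ := hsurj a
    rw [LinearMap.comp_apply, hΞ1, ← hxa]
    have key : ∃ t, Ξ t = x := by
      clear hxa
      induction hx using Submodule.span_induction with
      | mem x hx =>
        obtain ⟨s, t, rfl⟩ := hx
        exact ⟨s ⊗ₜ t, rfl⟩
      | zero => exact ⟨0, map_zero _⟩
      | add x y _ _ hx hy =>
        obtain ⟨t, rfl⟩ := hx
        obtain ⟨u, rfl⟩ := hy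
        exact ⟨t + u, map_add _ _ _⟩
      | smul r x _ hx =>
        obtain ⟨t, rfl⟩ := hx
        exact ⟨r • t, map_smul _ _ _⟩
    obtain ⟨t, rfl⟩ := key
    exact ⟨t, rfl⟩

/-- The projection of `E G` onto the block of `χ`. -/
def blockProj {G : Type*} [Group G] [Finite G] {E : Type*} [Field E] [Algebra E ℂ] {χ : G → ℂ}
    (hχ : IsIrrChar χ) (hE : ∀ g, χ g ∈ Set.range (algebraMap E ℂ)) :
    MonoidAlgebra E G →ₗ[E] BlockAlg hχ hE where
  toFun x := SubAlg.of (blockSub_unit hχ hE) (x * charIdem E χ) (mul_charIdem_mem χ _)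
  map_add' x y := SubAlg.val_injective (add_mul x y _)
  map_smul' r x := SubAlg.val_injective (smul_mul_assoc r x _)

theorem val_blockProj {G : Type*} [Group G] [Finite G] {E : Type*} [Field E] [Algebra E ℂ]
    {χ : G → ℂ} (hχ : IsIrrChar χ) (hE : ∀ g, χ g ∈ Set.range (algebraMap E ℂ))
    (x : MonoidAlgebra E G) : (blockProj hχ hE x).val = x * charIdem E χ := rfl

section Brauer

variable {G : Type*} [Group G] [Finite G] {F : Subfield ℂ} (E : IntermediateField F ℂ)

local notation "δ" => MonoidAlgebra.of F G

/-- The projection of `F G` onto `E U`. -/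
def extendScalars (U : Subgroup G) : MonoidAlgebra F G →ₗ[F] MonoidAlgebra E U :=
  linFun F (extZero U (MonoidAlgebra.of E U))

variable {E} {U : Subgroup G}

omit [Finite G] in
theorem extendScalars_of (u : U) : extendScalars E U (δ (u : G)) = MonoidAlgebra.of E U u := by
  rw [extendScalars, linFun_of, extZero_coe]

omit [Finite G] in
theorem extendScalars_mul {a b : MonoidAlgebra F G} (ha : a ∈ subgroupAlg F U)
    (hb : b ∈ subgroupAlg F U) :
    extendScalars E U (a * b) = extendScalars E U a * extendScalars E U b := by
  induction ha using subgroupAlg_induction with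
  | hof u =>
    induction hb using subgroupAlg_induction with
    | hof v => rw [extendScalars_of, extendScalars_of, ← map_mul, ← map_mul, ← extendScalars_of]; rfl
    | hadd a b _ _ ha hb => rw [mul_add, map_add, ha, hb, map_add, mul_add]
    | hsmul r a _ ha => rw [mul_smul_comm, map_smul, ha, map_smul, mul_smul_comm]
  | hadd a b _ _ ha hb => rw [add_mul, map_add, ha, hb, map_add, add_mul]
  | hsmul r a _ ha => rw [smul_mul_assoc, map_smul, ha, map_smul, smul_mul_assoc]

omit [Finite G] in
theorem linFun_extendScalars {χ : U → ℂ} (hE : ∀ u, χ u ∈ Set.range (algebraMap E ℂ))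
    {a : MonoidAlgebra F G} (ha : a ∈ subgroupAlg F U) :
    algebraMap E ℂ (linFun E (charVal E χ) (extendScalars E U a)) =
      linFun F (extZero U χ) a := by
  induction ha using subgroupAlg_induction with
  | hof u => rw [extendScalars_of, linFun_of, linFun_of, extZero_coe, algebraMap_charVal hE]
  | hadd a b _ _ ha hb => simp only [map_add, ha, hb]
  | hsmul r a _ ha =>
    rw [map_smul (extendScalars E U), ← algebraMap_smul E r (extendScalars E U a), map_smul,
      smul_eq_mul, map_mul, ha, map_smul, ← IsScalarTower.algebraMap_apply, Algebra.smul_def]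

variable {H K : Subgroup G} [hK : K.Normal]
  {θ : K → ℂ} {φ : ↥(H ⊓ K) → ℂ} (hU : K ≤ U)
  {hB : BasicConfig F H K θ φ} {σ : H ⧸ K.subgroupOf H →* (MagicAlg hB)ˣ} (hσ : IsMagic hB σ)

variable (E hB) in
/-- The image of `S` in `E U`. -/
def magicAlgHom (U : Subgroup G) : E ⊗[F] MagicAlg hB →ₗ[E] MonoidAlgebra E U :=
  LinearMap.liftBaseChange E (extendScalars E U ∘ₗ SubAlg.valₗ)

variable (E hB σ) in
/-- The image of `E (U ∩ H)` in `E U`. -/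
def complementHom (U : Subgroup G) : MonoidAlgebra E ↥(U ⊓ H) →ₗ[E] MonoidAlgebra E U :=
  linFun E fun v => extendScalars E U (magicElt hB σ (Subgroup.inclusion inf_le_right v))

theorem magicAlgHom_tmul (e : E) (s : MagicAlg hB) :
    magicAlgHom E hB U (e ⊗ₜ s) = e • extendScalars E U s.val := by
  rw [magicAlgHom, LinearMap.liftBaseChange_tmul]
  rfl

include hU in
theorem magicAlgHom_mul (a b : E ⊗[F] MagicAlg hB) :
    magicAlgHom E hB U (a * b) = magicAlgHom E hB U a * magicAlgHom E hB U b := by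
  have hmem : ∀ s : MagicAlg hB, s.val ∈ subgroupAlg F U := fun s =>
    subgroupAlg_mono hU (mem_subgroupAlg_of_mem_magicSub s.val_mem)
  induction a using TensorProduct.induction_on with
  | zero => rw [zero_mul, map_zero, zero_mul]
  | add a a' ha ha' => rw [add_mul, map_add, map_add, add_mul, ha, ha']
  | tmul e r =>
    induction b using TensorProduct.induction_on with
    | zero => rw [mul_zero, map_zero, mul_zero]
    | add a a' ha ha' => rw [mul_add, map_add, map_add, mul_add, ha, ha']
    | tmul f s =>
      rw [Algebra.TensorProduct.tmul_mul_tmul, magicAlgHom_tmul, magicAlgHom_tmul, magicAlgHom_tmul,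
        SubAlg.val_mul, extendScalars_mul (hmem r) (hmem s), smul_mul_smul_comm]

theorem complementHom_of (v : ↥(U ⊓ H)) : complementHom E hB σ U (MonoidAlgebra.of E _ v) =
    extendScalars E U (magicElt hB σ (Subgroup.inclusion inf_le_right v)) := linFun_of _ _

include hU hσ

theorem complementHom_mul (a b : MonoidAlgebra E ↥(U ⊓ H)) :
    complementHom E hB σ U (a * b) = complementHom E hB σ U a * complementHom E hB σ U b := by
  have hmem : ∀ v : ↥(U ⊓ H), magicElt hB σ (Subgroup.inclusion inf_le_right v) ∈
    subgroupAlg F U := fun v => magicElt_mem hU v.2.1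
  induction a using MonoidAlgebra.induction_on with
  | of v =>
    induction b using MonoidAlgebra.induction_on with
    | of w => rw [← map_mul, complementHom_of, complementHom_of, complementHom_of, map_mul,
        magicElt_mul hσ, extendScalars_mul (hmem v) (hmem w)]
    | add a b ha hb => simp only [map_add, mul_add, ha, hb]
    | smul r a ha => simp only [map_smul, mul_smul_comm, ha]
  | add a b ha hb => simp only [map_add, add_mul, ha, hb]
  | smul r a ha => simp only [map_smul, smul_mul_assoc, ha]

theorem complementHom_mul_comm (a : MonoidAlgebra E ↥(U ⊓ H)) (s : E ⊗[F] MagicAlg hB) :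
    complementHom E hB σ U a * magicAlgHom E hB U s =
      magicAlgHom E hB U s * complementHom E hB σ U a := by
  have hmem : ∀ s : MagicAlg hB, s.val ∈ subgroupAlg F U := fun s =>
    subgroupAlg_mono hU (mem_subgroupAlg_of_mem_magicSub s.val_mem)
  have hmem' : ∀ v : ↥(U ⊓ H), magicElt hB σ (Subgroup.inclusion inf_le_right v) ∈
    subgroupAlg F U := fun v => magicElt_mem hU v.2.1
  induction s using TensorProduct.induction_on with
  | zero => rw [map_zero, mul_zero, zero_mul]
  | add s t hs ht => rw [map_add, mul_add, add_mul, hs, ht]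
  | tmul e s =>
    rw [magicAlgHom_tmul, mul_smul_comm, smul_mul_assoc]
    congr 1
    induction a using MonoidAlgebra.induction_on with
    | of v => rw [complementHom_of, ← extendScalars_mul (hmem s) (hmem' v),
        ← extendScalars_mul (hmem' v) (hmem s), magicElt_mul_comm hσ _ s.val_mem]
    | add a b ha hb => rw [map_add, add_mul, mul_add, ha, hb]
    | smul r a ha => rw [map_smul, smul_mul_assoc, mul_smul_comm, ha]

omit hσ in
theorem idem_mul_complementHom (a : MonoidAlgebra E ↥(U ⊓ H)) :
    extendScalars E U (magicIdem F θ φ) * complementHom E hB σ U a = complementHom E hB σ U a := by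
  have hmem : ∀ v : ↥(U ⊓ H), magicElt hB σ (Subgroup.inclusion inf_le_right v) ∈
    subgroupAlg F U := fun v => magicElt_mem hU v.2.1
  have hi : magicIdem F θ φ ∈ subgroupAlg F U := subgroupAlg_mono hU BasicConfig.idem_mem
  induction a using MonoidAlgebra.induction_on with
  | of v => rw [complementHom_of, ← extendScalars_mul hi (hmem v), idem_mul_magicElt]
  | add a b ha hb => rw [map_add, mul_add, ha, hb]
  | smul r a ha => rw [map_smul, mul_smul_comm, ha]

omit hσ in
theorem complementHom_mul_idem (a : MonoidAlgebra E ↥(U ⊓ H)) :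
    complementHom E hB σ U a * extendScalars E U (magicIdem F θ φ) = complementHom E hB σ U a := by
  have hmem : ∀ v : ↥(U ⊓ H), magicElt hB σ (Subgroup.inclusion inf_le_right v) ∈
    subgroupAlg F U := fun v => magicElt_mem hU v.2.1
  have hi : magicIdem F θ φ ∈ subgroupAlg F U := subgroupAlg_mono hU BasicConfig.idem_mem
  induction a using MonoidAlgebra.induction_on with
  | of v => rw [complementHom_of, ← extendScalars_mul (hmem v) hi, magicElt_mul_idem]
  | add a b ha hb => rw [map_add, add_mul, ha, hb]
  | smul r a ha => rw [map_smul, smul_mul_assoc, ha]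

omit hσ in
/-- The algebra `i E U i` is generated by `S` and its complement. -/
theorem idem_mul_mul_idem_mem (a : MonoidAlgebra E U) :
    extendScalars E U (magicIdem F θ φ) * a * extendScalars E U (magicIdem F θ φ) ∈
      Submodule.span E {x | ∃ (s : E ⊗[F] MagicAlg hB) (b : MonoidAlgebra E ↥(U ⊓ H)),
        x = magicAlgHom E hB U s * complementHom E hB σ U b} := by
  have hi : magicIdem F θ φ ∈ subgroupAlg F U := subgroupAlg_mono hU BasicConfig.idem_mem
  induction a using MonoidAlgebra.induction_on with
  | of u =>
    have hu := of_mem_subgroupAlg F u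
    rw [← extendScalars_of, ← extendScalars_mul hi hu, ← extendScalars_mul (mul_mem hi hu) hi]
    have h1 := idem_mul_of_mul_idem_mem (hB := hB) (σ := σ) hU u
    generalize magicIdem F θ φ * MonoidAlgebra.of F G (u : G) * magicIdem F θ φ = x at h1 ⊢
    induction h1 using Submodule.span_induction with
    | mem x hx =>
      obtain ⟨s, hs, h, rfl⟩ := hx
      have hh : magicElt hB σ (Subgroup.inclusion inf_le_right h) ∈ subgroupAlg F U :=
        magicElt_mem hU h.2.1
      refine Submodule.subset_span ⟨1 ⊗ₜ SubAlg.of hB.unit s hs, MonoidAlgebra.of E _ h, ?_⟩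
      rw [magicAlgHom_tmul, one_smul, complementHom_of, SubAlg.val_of, extendScalars_mul
        (subgroupAlg_mono hU (mem_subgroupAlg_of_mem_magicSub hs)) hh]
    | zero =>
      rw [map_zero]
      exact zero_mem _
    | add x y _ _ hx hy =>
      rw [map_add]
      exact add_mem hx hy
    | smul r x _ hx =>
      rw [map_smul, ← algebraMap_smul E r (extendScalars E U x)]
      exact Submodule.smul_mem _ _ hx
  | add a b ha hb =>
    rw [mul_add, add_mul]
    exact add_mem ha hb
  | smul r a ha =>
    rw [mul_smul_comm, smul_mul_assoc]
    exact Submodule.smul_mem _ _ ha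

omit hσ in
-- On the level of algebras, pulling χ back along h ↦ c_h gives tr(i) times its image under ι. This
-- shows that the image of the idempotent of χ^ι is not killed by χ.
theorem linFun_complementHom {χ : U → ℂ} (hE : ∀ u, χ u ∈ Set.range (algebraMap E ℂ))
    (hE' : ∀ v, magicMap hB σ U χ v ∈ Set.range (algebraMap E ℂ))
    (a : MonoidAlgebra E ↥(U ⊓ H)) :
    linFun E (charVal E χ) (complementHom E hB σ U a) =
      algebraMap F E (magicTr F θ φ (magicIdem F θ φ)) *
        linFun E (charVal E (magicMap hB σ U χ)) a := by
  induction a using MonoidAlgebra.induction_on with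
  | of v =>
    have hmem : magicElt hB σ (Subgroup.inclusion inf_le_right v) ∈ subgroupAlg F U :=
      magicElt_mem hU v.2.1
    refine (algebraMap E ℂ).injective ?_
    rw [complementHom_of, linFun_extendScalars hE hmem, linFun_magicElt, linFun_of, map_mul,
      algebraMap_charVal hE', ← IsScalarTower.algebraMap_apply]
    rfl
  | add a b ha hb => rw [map_add, map_add, map_add, ha, hb, mul_add]
  | smul r a ha => rw [map_smul, map_smul, map_smul, ha, smul_eq_mul, smul_eq_mul, mul_left_comm]

/-- The Brauer classes of `χ` and `χ^ι` differ by the one of `S`. -/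
theorem sameBrauerClass_magicMap {χ : U → ℂ} (hχ : IsIrrChar χ)
    (hE : ∀ u, χ u ∈ Set.range (algebraMap E ℂ)) (hξ : IsIrrChar (magicMap hB σ U χ))
    (hE' : ∀ v, magicMap hB σ U χ v ∈ Set.range (algebraMap E ℂ)) :
    SameBrauerClass E (BlockAlg hχ hE) ((E ⊗[F] MagicAlg hB) ⊗[E] BlockAlg hξ hE') := by
  have hcentral : ∀ a, a * charIdem E χ = charIdem E χ * a := charIdem_central hχ.conj_eq
  have hidem := charIdem_idem hχ hE
  have h11 : magicAlgHom E hB U 1 * complementHom E hB σ U (charIdem E (magicMap hB σ U χ)) =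
      complementHom E hB σ U (charIdem E (magicMap hB σ U χ)) := by
    rw [Algebra.TensorProduct.one_def, magicAlgHom_tmul, one_smul, SubAlg.val_one,
      idem_mul_complementHom hU]
  refine sameBrauerClass_tensorProduct_of_commute (blockDatum hχ hE) ((magicDatum hB).baseChange E)
    (blockDatum hξ hE') (magicAlgHom E hB U) (complementHom E hB σ U ∘ₗ SubAlg.valₗ)
    (blockProj hχ hE) (magicAlgHom_mul hU) (fun a b => ?_) (fun a b => ?_) (fun s t => ?_)
    (fun h0 => ?_) fun a => ?_
  · exact complementHom_mul hU hσ _ _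
  · refine SubAlg.val_injective ?_
    rw [SubAlg.val_mul, val_blockProj, val_blockProj, val_blockProj, mul_assoc a b,
      mul_assoc a (charIdem E χ), ← mul_assoc (charIdem E χ) b, ← hcentral b, mul_assoc b, hidem]
  · exact complementHom_mul_comm hU hσ _ _
  -- If the image of the idempotent of χ^ι were zero in the block of χ, its average over U would
  -- give it the value zero under χ. That value is tr(i)χ^ι(1), which is nonzero.
  · have h1 : complementHom E hB σ U (charIdem E (magicMap hB σ U χ)) * charIdem E χ = 0 := by
      have h2 := congrArg SubAlg.val h0
      rw [val_blockProj] at h2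
      rw [← h11]
      exact h2
    have h2 := sum_conj_mul_charIdem hχ hE (complementHom E hB σ U (charIdem E (magicMap hB σ U χ)))
    have h3 : ∀ u : U, MonoidAlgebra.of E U u *
        complementHom E hB σ U (charIdem E (magicMap hB σ U χ)) * MonoidAlgebra.of E U u⁻¹ *
          charIdem E χ = 0 := by
      intro u
      rw [mul_assoc, hcentral, mul_assoc (MonoidAlgebra.of E U u), ← mul_assoc (complementHom _ _ _ _ _), h1, zero_mul,
        mul_zero]
    rw [Finset.sum_eq_zero fun u _ => h3 u, linFun_complementHom hU hE hE',
      linFun_charIdem hξ hE'] at h2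
    have h4 := (smul_eq_zero.1 h2.symm).resolve_right (charIdem_ne_zero hχ hE)
    have h5 : algebraMap F E (magicTr F θ φ (magicIdem F θ φ)) ≠ 0 :=
      (map_ne_zero _).2 (magicTr_idem_ne_zero hB)
    exact mul_ne_zero (div_ne_zero (natCard_ne_zero E U) (charVal_one_ne_zero hχ hE))
      (mul_ne_zero h5 (charVal_one_ne_zero hξ hE')) h4
  · set c := complementHom E hB σ U (charIdem E (magicMap hB σ U χ)) with hc
    -- Compressing a product from S and E(U ∩ H) by c leaves the S-factor alone, since c commutes
    -- with it, and compresses the other factor into the block of χ^ι. As c absorbs i, the whole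
    -- corner is reached.
    have key : ∀ x ∈ Submodule.span E {x | ∃ (s : E ⊗[F] MagicAlg hB)
        (b : MonoidAlgebra E ↥(U ⊓ H)), x = magicAlgHom E hB U s * complementHom E hB σ U b},
        c * x * c ∈ Submodule.span E {y | ∃ (s : E ⊗[F] MagicAlg hB) (t : BlockAlg hξ hE'),
          y = magicAlgHom E hB U s * complementHom E hB σ U t.val} := by
      intro x hx
      induction hx using Submodule.span_induction with
      | mem x hx =>
        obtain ⟨s, b, rfl⟩ := hx
        refine Submodule.subset_span ⟨s, SubAlg.of (blockSub_unit hξ hE') _ (mul_charIdem_mem _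
          (charIdem E (magicMap hB σ U χ) * b)), ?_⟩
        rw [SubAlg.val_of, complementHom_mul hU hσ, complementHom_mul hU hσ, ← mul_assoc,
          ← mul_assoc, ← mul_assoc, ← hc, ← complementHom_mul_comm hU hσ]
      | zero =>
        rw [mul_zero, zero_mul]
        exact zero_mem _
      | add x y _ _ hx hy =>
        rw [mul_add, add_mul]
        exact add_mem hx hy
      | smul r x _ hx =>
        rw [mul_smul_comm, smul_mul_assoc]
        exact Submodule.smul_mem _ _ hx
    have h1 : c * extendScalars E U (magicIdem F θ φ) = c := complementHom_mul_idem hU _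
    have h2 : extendScalars E U (magicIdem F θ φ) * c = c := idem_mul_complementHom hU _
    refine ⟨_, key _ (idem_mul_mul_idem_mem (σ := σ) hU a.val), SubAlg.val_injective ?_⟩
    have h3 : magicAlgHom E hB U 1 *
      (complementHom E hB σ U ∘ₗ SubAlg.valₗ) (1 : BlockAlg hξ hE') = c := h11
    rw [SubAlg.val_mul, SubAlg.val_mul, h3, val_blockProj, val_blockProj]
    calc _ = c * extendScalars E U (magicIdem F θ φ) * a.val *
          (extendScalars E U (magicIdem F θ φ) * c) * charIdem E χ := by simp only [mul_assoc]
      _ = c * (a.val * charIdem E χ) * c * charIdem E χ := by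
          rw [h1, h2, SubAlg.val_mul_idem]
      _ = _ := by
          rw [hcentral a.val]
          simp only [mul_assoc]

end Brauer

end MagicRep

end

open MagicRep in
theorem theoremt {G : Type*} [Group G] [Finite G] (F : Subfield ℂ) (H K : Subgroup G) [K.Normal]
    (θ : K → ℂ) (φ : ↥(H ⊓ K) → ℂ) (hB : BasicConfig F H K θ φ)
    (σ : H ⧸ K.subgroupOf H →* (MagicAlg hB)ˣ) (hσ : IsMagic hB σ) :
    -- `reducedTrace` is the reduced trace of `S`, and it takes the value `1`
    IsReducedTrace F (MagicAlg hB) (reducedTrace F) ∧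
    (∃ s₀ : MagicAlg hB, reducedTrace F s₀ = 1) ∧
    -- the isomorphisms `ι`, for all `U` at once
    ∃ ι : ∀ (U : Subgroup G) (hU : K ≤ U),
        irrAboveSpan hU θ ≃ₗ[ℂ] irrAboveSpan (inf_le_inf_right_of_le (H := H) hU) φ,
      -- the defining formula, for every choice of `s₀`
      (∀ s₀ : MagicAlg hB, reducedTrace F s₀ = 1 →
        ∀ (U : Subgroup G) (hU : K ≤ U) (χ : irrAboveSpan hU θ),
          (ι U hU χ).1 = iotaFun hB σ s₀ χ.1) ∧
      -- irreducible characters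
      (∀ (U : Subgroup G) (hU : K ≤ U) (χ : irrAboveSpan hU θ),
        χ.1 ∈ irrAbove hU θ ↔ (ι U hU χ).1 ∈ irrAbove (inf_le_inf_right_of_le hU) φ) ∧
      -- isometry
      (∀ (U : Subgroup G) (hU : K ≤ U) (χ₁ χ₂ : irrAboveSpan hU θ),
        classInner (ι U hU χ₁).1 (ι U hU χ₂).1 = classInner χ₁.1 χ₂.1) ∧
      -- ratios of degrees
      (∀ (U : Subgroup G) (hU : K ≤ U) (χ : irrAboveSpan hU θ),
        χ.1 1 / θ 1 = (ι U hU χ).1 1 / φ 1) ∧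
      -- restriction
      (∀ (U₁ U₂ : Subgroup G) (h₁ : K ≤ U₁) (h₁₂ : U₁ ≤ U₂)
        (χ : irrAboveSpan (h₁.trans h₁₂) θ),
        ∃ hm : resFun h₁₂ χ.1 ∈ irrAboveSpan h₁ θ,
          (ι U₁ h₁ ⟨_, hm⟩).1 = resFun (inf_mono_left h₁₂) (ι U₂ (h₁.trans h₁₂) χ).1) ∧
      -- induction
      (∀ (U₁ U₂ : Subgroup G) (h₁ : K ≤ U₁) (h₁₂ : U₁ ≤ U₂) (τ : irrAboveSpan h₁ θ),
        ∃ hm : indFun U₁ U₂ τ.1 ∈ irrAboveSpan (h₁.trans h₁₂) θ,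
          (ι U₂ (h₁.trans h₁₂) ⟨_, hm⟩).1 = indFun (U₁ ⊓ H) (U₂ ⊓ H) (ι U₁ h₁ τ).1) ∧
      -- conjugation
      (∀ (U : Subgroup G) (hU : K ≤ U) (χ : irrAboveSpan hU θ) (h : G) (hh : h ∈ H),
        ∃ hm : conjFun χ.1 h ∈ irrAboveSpan (le_conjSub hU h) θ,
          ∀ (x : G) (hx : x ∈ conjSub U h ⊓ H),
            conjFun (ι U hU χ).1 h ⟨x, mem_conjSub_inf hh hx⟩ =
              (ι (conjSub U h) (le_conjSub hU h) ⟨_, hm⟩).1 ⟨x, hx⟩) ∧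
      -- multiplication by characters of `U/K`
      (∀ (U : Subgroup G) (hU : K ≤ U) (χ : irrAboveSpan hU θ), ∀ β ∈ irrSpan (U ⧸ K.subgroupOf U),
        ∃ hm : (fun u : U => β (QuotientGroup.mk u) * χ.1 u) ∈ irrAboveSpan hU θ,
          ∀ x : ↥(U ⊓ H), (ι U hU ⟨_, hm⟩).1 x =
            β (QuotientGroup.mk (Subgroup.inclusion inf_le_left x)) * (ι U hU χ).1 x) ∧
      -- field automorphisms fixing `F`
      (∀ (U : Subgroup G) (hU : K ≤ U) (χ : irrAboveSpan hU θ) (α : ℂ ≃ₐ[F] ℂ),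
        ∃ hm : (fun u : U => α (χ.1 u)) ∈ irrAboveSpan hU θ,
          ∀ x : ↥(U ⊓ H), (ι U hU ⟨_, hm⟩).1 x = α ((ι U hU χ).1 x)) ∧
      -- fields of values
      (∀ (U : Subgroup G) (hU : K ≤ U) (χ : irrAboveSpan hU θ),
        charField F χ.1 = charField F (ι U hU χ).1) ∧
      -- Brauer classes, as classes of central simple algebras over `F(χ) = F(χ^ι)`
      (∀ (U : Subgroup G) (hU : K ≤ U) (χ : irrAboveSpan hU θ) (hχ : χ.1 ∈ irrAbove hU θ),
        ∃ (hξ : IsIrrChar (ι U hU χ).1)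
          (hE : ∀ x, (ι U hU χ).1 x ∈ Set.range (algebraMap (charField F χ.1) ℂ)),
          SameBrauerClass (charField F χ.1) (BlockAlg hχ.1 (mem_charField F χ.1))
            ((charField F χ.1 ⊗[F] MagicAlg hB) ⊗[charField F χ.1] BlockAlg hξ hE)) ∧
      -- restriction to `U ∩ H`
      (∀ (U : Subgroup G) (hU : K ≤ U) (χ : irrAboveSpan hU θ) (x : ↥(U ⊓ H)),
        partAbove (inf_le_inf_right_of_le hU) φ (resFun inf_le_left χ.1) x =
          magicChar hB σ (coset K x.2.2) * (ι U hU χ).1 x) ∧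
      -- induction from `U ∩ H`; the value of `ψ` at `u` is the one at `Lh` if `Ku = Kh`, `h ∈ H`
      (∀ (U : Subgroup G) (hU : K ≤ U)
        (ξ : irrAboveSpan (inf_le_inf_right_of_le (H := H) hU) φ) (u : U) (h : G) (hh : h ∈ H),
        (QuotientGroup.mk (u : G) : G ⧸ K) = QuotientGroup.mk h →
          partAbove hU θ (indFun (U ⊓ H) U ξ.1) u =
            conj (magicChar hB σ (coset K hh)) * ((ι U hU).symm ξ).1 u) := by
  have ha : ∀ {U : Subgroup G} {hU : K ≤ U} (χ : irrAboveSpan hU θ), IsAbove hU θ χ.1 := fun χ =>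
    hB.mem_irrAboveSpan_θ_iff.1 χ.2
  have hψ : ∀ h : H, magicChar hB σ (coset K h.2) = magicTr F θ φ (magicUnit hB σ h) := fun h =>
    congrArg _ (reducedTrace_magicAlg hB _)
  refine ⟨isReducedTrace_magicAlg hB, exists_reducedTrace_eq_one hB, fun U hU => magicEquiv hσ U hU,
    ?_, ?_, ?_, ?_, ?_, ?_, ?_, ?_, ?_, ?_, ?_, ?_, ?_⟩
  · intro s₀ hs₀ U hU χ
    rw [reducedTrace_magicAlg] at hs₀
    exact (iotaFun_eq hσ (ha χ) hs₀).symm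
  · intro U hU χ
    exact ⟨fun h => magicMap_mem_irrAbove hσ h, fun h => mem_irrAbove_of_magicMap hσ (ha χ) h⟩
  · intro U hU χ₁ χ₂
    exact classInner_magicMap hσ (ha χ₁) (ha χ₂)
  · intro U hU χ
    have h1 : (magicEquiv hσ U hU χ).1 1 = χ.1 1 / θ 1 * φ 1 := magicMap_one (ha χ)
    rw [h1, mul_div_cancel_right₀ _ hB.irr_φ.one_ne_zero]
  · intro U₁ U₂ h₁ h₁₂ χ
    exact ⟨hB.mem_irrAboveSpan_θ_iff.2 (isAbove_resFun h₁₂ (ha χ)), magicMap_resFun h₁ h₁₂ χ.1⟩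
  · intro U₁ U₂ h₁ h₁₂ τ
    exact ⟨hB.mem_irrAboveSpan_θ_iff.2
      (isAbove_indFun hB.val_θ h₁₂ (fun w _ => hB.of_mul_idem_θ w) (ha τ)),
      magicMap_indFun hσ h₁ h₁₂ (ha τ)⟩
  · intro U hU χ h hh
    exact ⟨hB.mem_irrAboveSpan_θ_iff.2 (isAbove_conjFun (hB := hB) (ha χ) h), fun x hx =>
      magicMap_conjFun hσ χ.1 hh hU hx⟩
  · intro U hU χ β hβ
    have h1 : ∀ (n : K) (v : U), β (QuotientGroup.mk (Subgroup.inclusion hU n * v)) =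
        β (QuotientGroup.mk v) := fun n v => by
      rw [QuotientGroup.mk_mul, (QuotientGroup.eq_one_iff (N := K.subgroupOf U) _).2 n.2, one_mul]
    exact ⟨hB.mem_irrAboveSpan_θ_iff.2 (isAbove_mul h1
      (fun u v => mul_comm_of_mem_irrSpan hβ (QuotientGroup.mk u) (QuotientGroup.mk v)) (ha χ)),
      fun x => magicMap_mul (β := fun u => β (QuotientGroup.mk u)) h1 x⟩
  · intro U hU χ α
    exact ⟨hB.mem_irrAboveSpan_θ_iff.2 (isAbove_alg hB.val_θ α (ha χ)),
      fun x => magicMap_alg α χ.1 x⟩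
  · intro U hU χ
    exact charField_magicMap hσ (ha χ)
  · intro U hU χ hχ
    -- Equality of the two fields of values allows the block of χ^ι to be formed over F(χ).
    have hE : ∀ x, magicMap hB σ U χ.1 x ∈ Set.range (algebraMap (charField F χ.1) ℂ) := fun x => by
      rw [charField_magicMap hσ (ha χ)]
      exact mem_charField F _ x
    exact ⟨isIrrChar_magicMap hσ hχ, hE, sameBrauerClass_magicMap hU hσ hχ.1 _ _ hE⟩
  · intro U hU χ x
    rw [partAbove_resFun hσ (ha χ)]
    exact congrArg (· * _) (hψ _).symm
  · intro U hU ξ u h hh huh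
    have h1 : ((⟨h, hh⟩ : H) : G)⁻¹ * u ∈ K := QuotientGroup.eq.1 huh.symm
    rw [partAbove_indFun hσ hU ((hB.mem_irrAboveSpan_φ_iff hU).1 ξ.2), magicCharExt_eq h1, hψ ⟨h, hh⟩]
    rfl
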